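/- **Theorem (Robust cardinality with deletions).** Consider streams of updates over a universe $U$ of keys. Each update is either $\mathsf{Insert}(x)$, which adds $x\in U$ to the set $A_t$ of active keys (initially empty), or $\mathsf{Delete}(x)$, which removes $x$ from it if present. Write $N_t=|A_t|$ for the number of active keys after the $t$-th update. A *streaming sketch* is a randomized algorithm whose memory holds a set of keys and a list of integer counters. After each update it changes its memory using only the current memory, the update, and fresh randomness. It can store a key only if that key was already stored or is the key of the current update. It then publishes an estimate $\hat N_t$ computed from the memory. Its space is the number of memory cells in use (between updates), where one cell holds one key or one integer counter of $O(\log T)$ bits. An *adaptive adversary* chooses each update, possibly at random, as a function of all previous updates and all previously published estimates. There is a universal constant $C>0$ such that for every universe $U$, every integer $T\ge 2$, and all $\varepsilon,\delta\in(0,1)$ there is a streaming sketch with the following properties against every adaptive adversary and for every stream length $n$, provided that the stream contains at most $T$ insertions (the number of deletions is arbitrary; in particular this covers every adaptive stream of total length $T$). 1. **Space.** The space is always at most $$C\cdot\frac{1}{\varepsilon^{2}}\,\log^{3/2}T\cdot\log\frac{T}{\delta}$$ cells, and every counter has at most $C\log T$ bits. 2. **Accuracy.** With probability at least $1-\delta$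 over the randomness of the sketch and the adversary, for all $t\in\{1,\dots,n\}$ simultaneously, $$|\hat N_t-N_t|\le\varepsilon\,\max_{1\le t'\le t}N_{t'},$$ and in particular $|\hat N_t-N_t|\le\varepsilon\,\max_{1\le t'\le n}N_{t'}$. -/

import Mathlib

/-- An update of the cardinality-with-deletions stream. -/
inductive Op (U : Type*) where
  | insert (x : U) : Op U
  | delete (x : U) : Op U

/-- The key an update concerns. -/
def Op.key {U : Type*} : Op U → U
  | .insert x => x
  | .delete x => x

/-- Whether an update is an insertion. -/
def Op.isInsert {U : Type*} : Op U → Bool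
  | .insert _ => true
  | .delete _ => false

/-- The effect of an update on the set of active keys. -/
def Op.apply {U : Type*} [DecidableEq U] (A : Finset U) : Op U → Finset U
  | .insert x => Insert.insert x A
  | .delete x => A.erase x

/-- The public transcript of an interaction, in chronological order: entry number `t - 1` holds the
`t`-th update and the estimate that the sketch published right after it. -/
abbrev Transcript (U : Type*) := List (Op U × ℝ)

/-- The number of insertions in a transcript. -/
def Transcript.insertions {U : Type*} (h : Transcript U) : ℕ :=
  h.countP fun e => e.1.isInsert

/-- The set of active keys after the first `t` updates (initially empty). -/
def Transcript.active {U : Type*} [DecidableEq U] (h : Transcript U) (t : ℕ) : Finset U :=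
  (h.take t).foldl (fun A e => e.1.apply A) ∅

/-- The true cardinality after the first `t` updates. -/
def Transcript.card {U : Type*} [DecidableEq U] (h : Transcript U) (t : ℕ) : ℕ :=
  (h.active t).card

/-- The maximum of the true cardinality over the times `1, …, t`. -/
def Transcript.prefixMax {U : Type*} [DecidableEq U] (h : Transcript U) (t : ℕ) : ℕ :=
  (Finset.Icc 1 t).sup fun s => h.card s

/-- At every time, the published estimate is within `ε` times the prefix maximum of the true
cardinality. List index `i` is time `i + 1`. -/
def Transcript.PrefixMaxAccurate {U : Type*} [DecidableEq U] (ε : ℝ) (h : Transcript U) : Prop :=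
  ∀ (i : ℕ) (hi : i < h.length),
    |(h[i]).2 - (h.card (i + 1) : ℝ)| ≤ ε * (h.prefixMax (i + 1) : ℝ)

/-- At every time, the published estimate is within `ε` times the overall maximum of the true
cardinality. -/
def Transcript.OverallMaxAccurate {U : Type*} [DecidableEq U] (ε : ℝ) (h : Transcript U) : Prop :=
  ∀ (i : ℕ) (hi : i < h.length),
    |(h[i]).2 - (h.card (i + 1) : ℝ)| ≤ ε * (h.prefixMax h.length : ℝ)

/-- The contents of the memory of a sketch: a set of stored keys, and integer counters. -/
structure Memory (U : Type*) where
  keys : Finset U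
  counters : List ℤ

/-- Space, in memory cells: a cell holds one key or one counter. -/
def Memory.cells {U : Type*} (m : Memory U) : ℕ := m.keys.card + m.counters.length

/-- The number of bits of a counter: its binary digits and a sign bit. -/
def counterBits (c : ℤ) : ℕ := c.natAbs.size + 1

/-- A randomized streaming sketch. An update is processed with fresh randomness, the new memory
depends only on the old memory and the update, and the estimate is read off the memory.
Keys can only be stored when they arrive: the memory is initially free of keys, and after an update
every stored key was stored before or is the key of that update (so that a key cell cannot be used
to encode other data). -/
structure Sketch (U : Type*) [DecidableEq U] where
  init : Memory U
  step : Memory U → Op U → PMF (Memory U)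
  estimate : Memory U → ℝ
  init_keys : init.keys = ∅
  step_keys : ∀ (m : Memory U) (o : Op U), ∀ m' ∈ (step m o).support,
    m'.keys ⊆ Insert.insert o.key m.keys

/-- An adaptive, possibly randomized adversary: it picks the next update from all previous updates
and published estimates. -/
abbrev Adversary (U : Type*) := Transcript U → PMF (Op U)

/-- The joint law of the transcript and the memory after `n` rounds of interaction. -/
noncomputable def Sketch.run {U : Type*} [DecidableEq U] (A : Sketch U) (adv : Adversary U) :
    ℕ → PMF (Transcript U × Memory U)
  | 0 => PMF.pure ([], A.init)
  | n + 1 => (A.run adv n).bind fun z =>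
      (adv z.1).bind fun o =>
        (A.step z.2 o).map fun m => (z.1 ++ [(o, A.estimate m)], m)

/-!
The sketch samples keys at a rate that is halved whenever the noisy sample size exceeds a threshold `k`
of order `ε⁻² log T log (T / δ)`, and publishes the noisy sample size over the rate. The danger is that
an adaptive adversary learns from the estimates which keys are sampled, and deletes or keeps exactly
those. The noise prevents this, as in differentially private counting.

**Noise.** The insertions are the leaves of a dyadic tree. Each node, when opened, draws two-sided
geometric noise of scale about `1 / η`, where `η` is of order `ε / log T`. The noise in use is that of
the nodes which partition the insertions of the current phase (the period since the rate was last
halved), plus one value for the keys that were stored when the phase began. Deletions draw no noise: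
they reveal only the decision on a key that is no longer active.

**Privacy.** For every transcript, `AllHidden` compares the likelihood of each state in which an active
key `x` is sampled with that of the state in which it is not and in which the noise of the node that
covers `x` is larger by one. All estimates are the same in both, so the likelihoods differ by the prior
odds and by a factor `E = exp η` for each node that `x` passes through: at most one per level and one per
phase. `allHidden_sampleRun` proves this by induction over the rounds. Hence, given the transcript, the
active keys are sampled almost independently, and `tsum_not_sampleAccurate_le` gives a Chernoff bound
for the sample size which holds for any adversary.

**Magnitude of the noise.** `noisePotential` is a supermartingale that bounds the expected number of
insertions after which the total noise exceeds `θ k`, with `θ = ε / 16`, by an exponential moment.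

**Accounting.** If noise and sample are good at all times, then all estimates are accurate and the state
fits into the memory (`Successful.step`, `Successful.fits`). The number of rounds is not bounded, but
only insertions and deletions of active keys can spoil the sample, and there are at most `2 * T` of
those. So `one_le_tsum_survivingMass_add` bounds the probability of failure independently of the number
of rounds. The actual sketch is reset when its state becomes too large, which does not happen in
successful runs (`successfulRun_le_run`). When `k` exceeds `T`, all active keys can be stored.
-/

open scoped ENNReal NNReal

/-! ### Two-sided geometric noise -/

lemma tsum_int_pow_natAbs (x : ℝ≥0∞) :
    ∑' z : ℤ, x ^ z.natAbs = (1 + x) * (1 - x)⁻¹ := by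
  have h1 : HasSum (fun n : ℕ => x ^ ((n : ℤ)).natAbs) ((1 - x)⁻¹) := by
    simpa using (ENNReal.tsum_geometric x) ▸ ENNReal.summable.hasSum
  have h2 : HasSum (fun n : ℕ => x ^ (-((n : ℤ) + 1)).natAbs) (x * (1 - x)⁻¹) := by
    have h3 : ∀ n : ℕ, x ^ (-((n : ℤ) + 1)).natAbs = x * x ^ n := by
      intro n
      rw [← pow_succ']
      congr 1
    simp_rw [h3]
    rw [← ENNReal.tsum_geometric x, ← ENNReal.tsum_mul_left]
    exact ENNReal.summable.hasSum
  have := (HasSum.of_nat_of_neg_add_one (f := fun z : ℤ => x ^ z.natAbs) h1 h2).tsum_eq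
  rw [this]; ring

/-- The two-sided geometric law `g z ∝ r ^ (2 |z|)`: a unit shift changes its density by a factor of
at most `r⁻²`, and the exponential moment `E[r ^ (-|z|)]` is at most `2`. -/
lemma exists_two_sided_geometric (r : ℝ≥0) (h0 : 0 < r) (h1 : r < 1) :
    ∃ g : PMF ℤ, (∀ z, g z ≤ ((r : ℝ≥0∞)⁻¹) ^ 2 * g (z + 1)) ∧
      (∀ z, g z ≤ ((r : ℝ≥0∞)⁻¹) ^ 2 * g (z - 1)) ∧
      ∑' z, g z * ((r : ℝ≥0∞)⁻¹) ^ z.natAbs ≤ 2 := by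
  have hr0 : (r : ℝ≥0∞) ≠ 0 := by simpa using h0.ne'
  have hrt : (r : ℝ≥0∞) ≠ ∞ := ENNReal.coe_ne_top
  have hr1 : (r : ℝ≥0∞) < 1 := by exact_mod_cast h1
  have hq1 : (r : ℝ≥0∞) ^ 2 < 1 := pow_lt_one₀ (zero_le) hr1 (by norm_num)
  set f : ℤ → ℝ≥0∞ := fun z => ((r : ℝ≥0∞) ^ 2) ^ z.natAbs with hf
  have hS : ∑' z, f z = (1 + (r : ℝ≥0∞) ^ 2) * (1 - (r : ℝ≥0∞) ^ 2)⁻¹ := tsum_int_pow_natAbs _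
  have hd : 1 - (r : ℝ≥0∞) ^ 2 ≠ 0 := (tsub_pos_of_lt hq1).ne'
  have hS0 : ∑' z, f z ≠ 0 := by
    rw [hS]
    refine mul_ne_zero (by simp) (ENNReal.inv_ne_zero.2 (ne_top_of_le_ne_top ENNReal.one_ne_top tsub_le_self))
  have hSt : ∑' z, f z ≠ ∞ := by
    rw [hS]
    exact ENNReal.mul_ne_top (ENNReal.add_ne_top.2 ⟨ENNReal.one_ne_top, ENNReal.pow_ne_top hrt⟩)
      (ENNReal.inv_ne_top.2 hd)
  have hinv : (r : ℝ≥0∞)⁻¹ * r = 1 := ENNReal.inv_mul_cancel hr0 hrt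
  have hle : (r : ℝ≥0∞) ≤ 1 := hr1.le
  have step : ∀ z w : ℤ, w.natAbs ≤ z.natAbs + 1 → f z ≤ ((r : ℝ≥0∞)⁻¹) ^ 2 * f w := by
    intro z w h
    calc f z = (((r : ℝ≥0∞)⁻¹) * r) ^ 2 * f z := by rw [hinv]; simp
      _ = ((r : ℝ≥0∞)⁻¹) ^ 2 * ((r : ℝ≥0∞) ^ 2) ^ (z.natAbs + 1) := by
          simp only [hf]; ring
      _ ≤ _ := by
          gcongr
          exact pow_le_pow_right_of_le_one' hq1.le h
  refine ⟨PMF.normalize f hS0 hSt, fun z => ?_, fun z => ?_, ?_⟩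
  · rw [PMF.normalize_apply, PMF.normalize_apply, ← mul_assoc]
    gcongr
    exact step _ _ (by omega)
  · rw [PMF.normalize_apply, PMF.normalize_apply, ← mul_assoc]
    gcongr
    exact step _ _ (by omega)
  · simp_rw [PMF.normalize_apply]
    have h2 : ∀ z : ℤ, f z * (∑' z, f z)⁻¹ * ((r : ℝ≥0∞)⁻¹) ^ z.natAbs
        = (∑' z, f z)⁻¹ * (r : ℝ≥0∞) ^ z.natAbs := by
      intro z
      calc f z * (∑' z, f z)⁻¹ * ((r : ℝ≥0∞)⁻¹) ^ z.natAbs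
          = (∑' z, f z)⁻¹ * (r : ℝ≥0∞) ^ z.natAbs * (((r : ℝ≥0∞)⁻¹) * r) ^ z.natAbs := by
            simp only [hf]; ring
        _ = _ := by rw [hinv]; simp
    simp_rw [h2]
    rw [ENNReal.tsum_mul_left, mul_comm, ← div_eq_mul_inv]
    refine ENNReal.div_le_of_le_mul ?_
    rw [hS, tsum_int_pow_natAbs]
    have e1 : (1 - (r : ℝ≥0∞)) = ((1 - r : ℝ≥0) : ℝ≥0∞) := by simp
    have e2 : (1 - (r : ℝ≥0∞) ^ 2) = ((1 - r ^ 2 : ℝ≥0) : ℝ≥0∞) := by simp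
    have hr2 : r ^ 2 < 1 := by exact_mod_cast hq1
    rw [e1, e2, ← ENNReal.coe_inv (tsub_pos_of_lt h1).ne', ← ENNReal.coe_inv (tsub_pos_of_lt hr2).ne']
    norm_cast
    rw [← NNReal.coe_le_coe]
    push_cast [NNReal.coe_sub h1.le, NNReal.coe_sub hr2.le]
    have h0' : (0 : ℝ) < r := h0
    have h1' : (r : ℝ) < 1 := h1
    rw [← div_eq_mul_inv, ← div_eq_mul_inv, ← mul_div_assoc, div_le_div_iff₀ (by linarith) (by nlinarith)]
    nlinarith [mul_nonneg (sub_nonneg.2 h1'.le) (sq_nonneg (1 - (r : ℝ)))]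

/-! ### Dyadic levels -/

lemma padicValNat_two_lt {c l : ℕ} (h1 : 1 ≤ c) (h2 : c < 2 ^ l) : padicValNat 2 c < l := by
  have h3 : 2 ^ padicValNat 2 c ∣ c := pow_padicValNat_dvd
  have h4 := Nat.le_of_dvd h1 h3
  exact (Nat.pow_lt_pow_iff_right (by norm_num : 1 < 2)).1 (lt_of_le_of_lt h4 h2)

lemma two_pow_dvd_iff_le {c j : ℕ} (h : 1 ≤ c) : 2 ^ j ∣ c ↔ j ≤ padicValNat 2 c :=
  padicValNat_dvd_iff_le (p := 2) (by omega)

/-- The dyadic node of level `j` opened at time `d` is either still intact at time `c + 1`, and the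
node opened at time `c + 1` has a lower level, or it is absorbed then by a node of a higher level. -/
lemma dyadic_level_step {c d j : ℕ} (hd : 1 ≤ d) (hj : padicValNat 2 d = j) (hc : d ≤ c)
    (hcd : c < d + 2 ^ j) :
    (c + 1 < d + 2 ^ j ∧ padicValNat 2 (c + 1) < j) ∨ j < padicValNat 2 (c + 1) := by
  have hdv : 2 ^ j ∣ d := (two_pow_dvd_iff_le hd).2 hj.ge
  rcases Nat.lt_or_ge (c + 1) (d + 2 ^ j) with h | h
  · left
    refine ⟨h, ?_⟩
    by_contra hcon
    have h2 : 2 ^ j ∣ c + 1 := (two_pow_dvd_iff_le (by omega)).2 (by omega)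
    have h3 : 2 ^ j ∣ (c + 1) - d := Nat.dvd_sub h2 hdv
    have := Nat.le_of_dvd (by omega) h3
    omega
  · right
    have he : c + 1 = d + 2 ^ j := by omega
    have hnd : ¬ 2 ^ (j + 1) ∣ d := by
      rw [two_pow_dvd_iff_le hd]; omega
    obtain ⟨m, rfl⟩ := hdv
    have hm : m % 2 = 1 := by
      by_contra hm
      have : 2 ∣ m := by omega
      obtain ⟨t, rfl⟩ := this
      exact hnd ⟨t, by ring⟩
    have : 2 ^ (j + 1) ∣ c + 1 := by
      rw [he]
      refine ⟨(m + 1) / 2, ?_⟩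
      have : m + 1 = 2 * ((m + 1) / 2) := by omega
      calc 2 ^ j * m + 2 ^ j = 2 ^ j * (m + 1) := by ring
        _ = 2 ^ j * (2 * ((m + 1) / 2)) := by rw [← this]
        _ = _ := by ring
    exact (two_pow_dvd_iff_le (by omega)).1 this

/-- The node that covers the end of `[1, t]` at level `padicValNat 2 (c + 1)` is not opened before
time `c + 1`. -/
lemma lt_dyadic_start {c t : ℕ} (h : c + 1 ≤ t) :
    c < t / 2 ^ padicValNat 2 (c + 1) * 2 ^ padicValNat 2 (c + 1) := by
  set v := padicValNat 2 (c + 1)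
  have h1 : 2 ^ v ∣ c + 1 := pow_padicValNat_dvd
  obtain ⟨m, hm⟩ := h1
  have h2 : m ≤ t / 2 ^ v := by
    rw [Nat.le_div_iff_mul_le (by positivity)]
    rw [mul_comm, ← hm]; exact h
  calc c < c + 1 := by omega
    _ = m * 2 ^ v := by rw [hm, mul_comm]
    _ ≤ _ := Nat.mul_le_mul_right _ h2

/-! ### Concentration of nearly independent samples -/

/-- Exponential moments of the size of a random subset of `A` (with unnormalized law `ν`), if the
conditional probability of each element given the others is at most `q` (for `1 ≤ t`), respectively
at least `q` (for `t ≤ 1`). -/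
lemma sum_powerset_mul_pow_card_le {U : Type*} [DecidableEq U] (q t : ℝ) (ht : 0 ≤ t)
    (hqt : 0 ≤ 1 + q * (t - 1)) (A : Finset U) :
    ∀ ν : Finset U → ℝ, (∀ S, 0 ≤ ν S) →
    (∀ x ∈ A, ∀ S, x ∉ S →
      (t - 1) * ν (insert x S) ≤ (t - 1) * (q * (ν S + ν (insert x S)))) →
    ∑ S ∈ A.powerset, ν S * t ^ S.card ≤ (1 + q * (t - 1)) ^ A.card * ∑ S ∈ A.powerset, ν S := by
  induction A using Finset.induction_on with
  | empty => intro ν _ _; simp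
  | insert a A ha ih =>
    intro ν h0 h
    rw [Finset.sum_powerset_insert ha, Finset.sum_powerset_insert ha, Finset.card_insert_of_notMem ha,
      ← Finset.sum_add_distrib, ← Finset.sum_add_distrib]
    have key := ih (fun S => ν S + ν (insert a S)) (fun S => add_nonneg (h0 _) (h0 _)) (by
      intro x hx S hS
      have hxa : x ≠ a := fun e => ha (e ▸ hx)
      have h1 := h x (Finset.mem_insert_of_mem hx) S hS
      have h2 := h x (Finset.mem_insert_of_mem hx) (insert a S) (by simp [hxa, hS])
      rw [Finset.insert_comm a x S]
      nlinarith)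
    calc _ ≤ ∑ S ∈ A.powerset, (1 + q * (t - 1)) * ((ν S + ν (insert a S)) * t ^ S.card) := by
          refine Finset.sum_le_sum fun S hS => ?_
          have haS : a ∉ S := fun h => ha (Finset.mem_powerset.1 hS h)
          rw [Finset.card_insert_of_notMem haS, pow_succ]
          have h1 := h a (Finset.mem_insert_self _ _) S haS
          have h2 : (0 : ℝ) ≤ t ^ S.card := pow_nonneg ht _
          nlinarith [mul_le_mul_of_nonneg_right h1 h2]
      _ = (1 + q * (t - 1)) * ∑ S ∈ A.powerset, (ν S + ν (insert a S)) * t ^ S.card := by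
          rw [Finset.mul_sum]
      _ ≤ (1 + q * (t - 1)) * ((1 + q * (t - 1)) ^ A.card * ∑ S ∈ A.powerset, (ν S + ν (insert a S))) :=
          mul_le_mul_of_nonneg_left key hqt
      _ = _ := by ring

set_option maxHeartbeats 800000 in
/-- If, conditionally on the others, each element of `A` is present with probability `p` up to a
factor `F ≤ exp (θ / 4)`, then the number of present elements is concentrated around `p * |A|`. -/
lemma sum_powerset_deviation_le {U : Type*} [DecidableEq U] (A : Finset U) (ν : Finset U → ℝ)
    (h0 : ∀ S, 0 ≤ ν S) {p F θ k : ℝ} (hp0 : 0 ≤ p) (hp1 : p ≤ 1) (hF1 : 1 ≤ F)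
    (hF : F ≤ Real.exp (θ / 4)) (hθ0 : 0 < θ) (hθ1 : θ ≤ 1)
    (hu : ∀ x ∈ A, ∀ S, x ∉ S → ν (insert x S) ≤ F * p * (ν S + ν (insert x S)))
    (hl : ∀ x ∈ A, ∀ S, x ∉ S → p * (ν S + ν (insert x S)) ≤ F * ν (insert x S)) :
    ∑ S ∈ A.powerset, (if θ * (p * A.card + k) < |(S.card : ℝ) - p * A.card| then ν S else 0)
      ≤ 2 * Real.exp (-(θ ^ 2 * k / 4)) * ∑ S ∈ A.powerset, ν S := by
  set N : ℝ := (A.card : ℝ) with hN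
  have hN0 : 0 ≤ N := Nat.cast_nonneg _
  set mass := ∑ S ∈ A.powerset, ν S
  have hmass0 : 0 ≤ mass := Finset.sum_nonneg fun S _ => h0 S
  set b := θ / 4 with hb
  have hb0 : 0 < b := by positivity
  have hb1 : b ≤ 1 / 4 := by rw [hb]; linarith
  have habs := Real.abs_exp_sub_one_sub_id_le (x := b) (by rw [abs_of_pos hb0]; linarith)
  have habs' := Real.abs_exp_sub_one_sub_id_le (x := -b) (by rw [abs_neg, abs_of_pos hb0]; linarith)
  rw [abs_le] at habs habs'
  have hpN : 0 ≤ p * N := mul_nonneg hp0 hN0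
  have hF2 : F ≤ 1 + b + b ^ 2 := by linarith
  have hFi : F⁻¹ ≥ 1 - b := by
    have h1 : (Real.exp b)⁻¹ ≤ F⁻¹ := inv_anti₀ (by linarith) hF
    rw [← Real.exp_neg] at h1
    linarith [Real.add_one_le_exp (-b)]
  have hF0 : 0 < F := by linarith
  have hFi1 : F⁻¹ ≤ 1 := inv_le_one_of_one_le₀ hF1
  have hexp1 : Real.exp (-b) ≤ 1 := Real.exp_le_one_iff.2 (by linarith)
  have hexpb : 1 ≤ Real.exp b := Real.one_le_exp hb0.le
  have hbk : θ ^ 2 * k / 4 = b * (θ * k) := by rw [hb]; ring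
  -- upper tail
  have hup : ∑ S ∈ A.powerset, (ν S * Real.exp b ^ S.card) ≤ Real.exp (b * ((1 + θ) * (p * N))) * mass := by
    refine (sum_powerset_mul_pow_card_le (F * p) (Real.exp b) (Real.exp_pos _).le
      (by nlinarith [mul_nonneg hF0.le hp0]) A ν h0 ?_).trans ?_
    · intro x hx S hS
      exact mul_le_mul_of_nonneg_left (hu x hx S hS) (by linarith)
    · refine mul_le_mul_of_nonneg_right ?_ hmass0
      calc (1 + F * p * (Real.exp b - 1)) ^ A.card
          ≤ Real.exp (F * p * (Real.exp b - 1)) ^ A.card := by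
            refine pow_le_pow_left₀ (by nlinarith [mul_nonneg hF0.le hp0]) ?_ _
            linarith [Real.add_one_le_exp (F * p * (Real.exp b - 1))]
        _ = Real.exp (F * (Real.exp b - 1) * (p * N)) := by
            rw [← Real.exp_nat_mul]; congr 1; rw [hN]; ring
        _ ≤ _ := by
            rw [Real.exp_le_exp]
            suffices F * (Real.exp b - 1) ≤ b * (1 + θ) by
              linarith [mul_le_mul_of_nonneg_right this hpN]
            have h1 : F * (Real.exp b - 1) ≤ (1 + b + b ^ 2) * (b + b ^ 2) :=
              mul_le_mul hF2 (by linarith) (by linarith) (by positivity)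
            have h2 : (1 + b + b ^ 2) * (1 + b) ≤ 1 + θ := by
              have : θ = 4 * b := by rw [hb]; ring
              rw [this]; nlinarith [mul_nonneg hb0.le hb0.le, mul_nonneg hb0.le (mul_nonneg hb0.le hb0.le)]
            nlinarith
  -- lower tail
  have hlo : ∑ S ∈ A.powerset, (ν S * Real.exp (-b) ^ S.card)
      ≤ Real.exp (-(b * ((1 - θ) * (p * N)))) * mass := by
    have hq0 : 0 ≤ F⁻¹ * p := mul_nonneg (by positivity) hp0
    have hq1 : F⁻¹ * p ≤ 1 := mul_le_one₀ hFi1 hp0 hp1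
    have hnn : 0 ≤ 1 + F⁻¹ * p * (Real.exp (-b) - 1) := by nlinarith [Real.exp_pos (-b)]
    refine (sum_powerset_mul_pow_card_le (F⁻¹ * p) (Real.exp (-b)) (Real.exp_pos _).le hnn
      A ν h0 ?_).trans ?_
    · intro x hx S hS
      refine mul_le_mul_of_nonpos_left ?_ (by linarith)
      rw [mul_assoc, inv_mul_le_iff₀ hF0]
      exact hl x hx S hS
    · refine mul_le_mul_of_nonneg_right ?_ hmass0
      calc (1 + F⁻¹ * p * (Real.exp (-b) - 1)) ^ A.card
          ≤ Real.exp (F⁻¹ * p * (Real.exp (-b) - 1)) ^ A.card := by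
            refine pow_le_pow_left₀ hnn ?_ _
            linarith [Real.add_one_le_exp (F⁻¹ * p * (Real.exp (-b) - 1))]
        _ = Real.exp (F⁻¹ * (Real.exp (-b) - 1) * (p * N)) := by
            rw [← Real.exp_nat_mul]; congr 1; rw [hN]; ring
        _ ≤ _ := by
            rw [Real.exp_le_exp]
            suffices F⁻¹ * (Real.exp (-b) - 1) ≤ -(b * (1 - θ)) by
              linarith [mul_le_mul_of_nonneg_right this hpN]
            have h1 : (1 - b) * (b - b ^ 2) ≤ F⁻¹ * (1 - Real.exp (-b)) := by
              refine mul_le_mul hFi (by nlinarith) (by nlinarith) (by positivity)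
            have h2 : (1 - θ) ≤ (1 - b) * (1 - b) := by
              have : θ = 4 * b := by rw [hb]; ring
              rw [this]; nlinarith
            nlinarith
  calc _ ≤ ∑ S ∈ A.powerset, (ν S * Real.exp b ^ S.card * Real.exp (-(b * ((1 + θ) * (p * N) + θ * k)))
            + ν S * Real.exp (-b) ^ S.card * Real.exp (b * ((1 - θ) * (p * N) - θ * k))) := by
        refine Finset.sum_le_sum fun S _ => ?_
        have e1 : ν S * Real.exp b ^ S.card * Real.exp (-(b * ((1 + θ) * (p * N) + θ * k)))
            = ν S * Real.exp (b * ((S.card : ℝ) - p * N - θ * (p * N + k))) := by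
          rw [← Real.exp_nat_mul, mul_assoc, ← Real.exp_add]; congr 2; ring
        have e2 : ν S * Real.exp (-b) ^ S.card * Real.exp (b * ((1 - θ) * (p * N) - θ * k))
            = ν S * Real.exp (b * (-((S.card : ℝ) - p * N) - θ * (p * N + k))) := by
          rw [← Real.exp_nat_mul, mul_assoc, ← Real.exp_add]; congr 2; ring
        rw [e1, e2]
        have p1 := mul_nonneg (h0 S) (Real.exp_pos (b * ((S.card : ℝ) - p * N - θ * (p * N + k)))).le
        have p2 := mul_nonneg (h0 S) (Real.exp_pos (b * (-((S.card : ℝ) - p * N) - θ * (p * N + k)))).le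
        split_ifs with hS
        · rcases lt_abs.1 hS with h | h
          · have : 1 ≤ Real.exp (b * ((S.card : ℝ) - p * N - θ * (p * N + k))) :=
              Real.one_le_exp (mul_nonneg hb0.le (by linarith))
            linarith [le_mul_of_one_le_right (h0 S) this]
          · have : 1 ≤ Real.exp (b * (-((S.card : ℝ) - p * N) - θ * (p * N + k))) :=
              Real.one_le_exp (mul_nonneg hb0.le (by linarith))
            linarith [le_mul_of_one_le_right (h0 S) this]
        · positivity
    _ = (∑ S ∈ A.powerset, (ν S * Real.exp b ^ S.card)) * Real.exp (-(b * ((1 + θ) * (p * N) + θ * k)))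
        + (∑ S ∈ A.powerset, (ν S * Real.exp (-b) ^ S.card)) * Real.exp (b * ((1 - θ) * (p * N) - θ * k)) := by
        rw [Finset.sum_add_distrib, Finset.sum_mul, Finset.sum_mul]
    _ ≤ (Real.exp (b * ((1 + θ) * (p * N))) * mass) * Real.exp (-(b * ((1 + θ) * (p * N) + θ * k)))
        + (Real.exp (-(b * ((1 - θ) * (p * N)))) * mass) * Real.exp (b * ((1 - θ) * (p * N) - θ * k)) := by
        gcongr
    _ = _ := by
        rw [hbk]
        have e1 : Real.exp (b * ((1 + θ) * (p * N))) * Real.exp (-(b * ((1 + θ) * (p * N) + θ * k)))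
            = Real.exp (-(b * (θ * k))) := by rw [← Real.exp_add]; congr 1; ring
        have e2 : Real.exp (-(b * ((1 - θ) * (p * N)))) * Real.exp (b * ((1 - θ) * (p * N) - θ * k))
            = Real.exp (-(b * (θ * k))) := by rw [← Real.exp_add]; congr 1; ring
        calc _ = (Real.exp (b * ((1 + θ) * (p * N))) * Real.exp (-(b * ((1 + θ) * (p * N) + θ * k)))) * mass
              + (Real.exp (-(b * ((1 - θ) * (p * N)))) * Real.exp (b * ((1 - θ) * (p * N) - θ * k))) * mass := by ring
          _ = _ := by rw [e1, e2]; ring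

/-! ### Expectations -/

lemma PMF.tsum_bind_mul {α β : Type*} (p : PMF α) (f : α → PMF β) (h : β → ℝ≥0∞) :
    ∑' b, p.bind f b * h b = ∑' a, p a * ∑' b, f a b * h b := by
  simp only [PMF.bind_apply, ← ENNReal.tsum_mul_right, ← ENNReal.tsum_mul_left]
  rw [ENNReal.tsum_comm]
  simp only [mul_assoc]

lemma PMF.tsum_pure_mul {α : Type*} (a : α) (h : α → ℝ≥0∞) : ∑' b, PMF.pure a b * h b = h a := by
  classical
  rw [tsum_eq_single a]
  · simp
  · intro b hb; simp [hb]

lemma PMF.tsum_map_mul {α β : Type*} (p : PMF α) (f : α → β) (h : β → ℝ≥0∞) :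
    ∑' b, p.map f b * h b = ∑' a, p a * h (f a) := by
  rw [← PMF.bind_pure_comp, PMF.tsum_bind_mul]
  simp only [Function.comp_apply, PMF.tsum_pure_mul]

lemma PMF.tsum_mul_le {α : Type*} (p : PMF α) {h : α → ℝ≥0∞} {b : ℝ≥0∞}
    (hb : ∀ a ∈ p.support, h a ≤ b) : ∑' a, p a * h a ≤ b := by
  calc ∑' a, p a * h a ≤ ∑' a, p a * b := by
        refine ENNReal.tsum_le_tsum fun a => ?_
        by_cases ha : a ∈ p.support
        · exact mul_le_mul_right (hb a ha) _
        · rw [(PMF.apply_eq_zero_iff p a).2 ha]; simp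
    _ = b := by rw [ENNReal.tsum_mul_right, PMF.tsum_coe, one_mul]

/-! ### Interaction of an arbitrary randomized state machine with an adversary -/

/-- One round of interaction: the adversary picks an update, the state is updated, and the estimate
`est` of the new state is published. -/
noncomputable def interactRound {U σ : Type*} (step : σ → Op U → PMF σ) (est : σ → ℝ)
    (adv : Adversary U) (z : Transcript U × σ) : PMF (Transcript U × σ) :=
  (adv z.1).bind fun o => (step z.2 o).map fun s => (z.1 ++ [(o, est s)], s)

/-- The joint law of transcript and state after `n` rounds, for a state machine whose states need not
be memories of a sketch. -/
noncomputable def interact {U σ : Type*} (step : σ → Op U → PMF σ) (est : σ → ℝ) (init : σ)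
    (adv : Adversary U) : ℕ → PMF (Transcript U × σ)
  | 0 => PMF.pure ([], init)
  | n + 1 => (interact step est init adv n).bind (interactRound step est adv)

lemma Sketch.run_eq_interact {U : Type*} [DecidableEq U] (A : Sketch U) (adv : Adversary U) (n : ℕ) :
    A.run adv n = interact A.step A.estimate A.init adv n := by
  induction n with
  | zero => rfl
  | succ n ih => rw [Sketch.run, ih]; rfl

lemma mem_support_interactRound {U σ : Type*} {step : σ → Op U → PMF σ} {est : σ → ℝ}
    {adv : Adversary U} {z z' : Transcript U × σ} :
    z' ∈ (interactRound step est adv z).support ↔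
      ∃ o ∈ (adv z.1).support, ∃ s ∈ (step z.2 o).support, z' = (z.1 ++ [(o, est s)], s) := by
  simp [interactRound, eq_comm]

lemma tsum_interactRound_mul {U σ : Type*} (step : σ → Op U → PMF σ) (est : σ → ℝ)
    (adv : Adversary U) (z : Transcript U × σ) (f : Transcript U × σ → ℝ≥0∞) :
    ∑' z', interactRound step est adv z z' * f z' =
      ∑' o, adv z.1 o * ∑' s, step z.2 o s * f (z.1 ++ [(o, est s)], s) := by
  simp only [interactRound, PMF.tsum_bind_mul, PMF.tsum_map_mul]

/-- An inequality between expectations that holds for each update of a state machine holds for each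
round of interaction. -/
lemma tsum_interactRound_mul_le {U σ : Type*} {step : σ → Op U → PMF σ} {est : σ → ℝ}
    {adv : Adversary U} {z : Transcript U × σ} {f : Transcript U × σ → ℝ≥0∞} {b : ℝ≥0∞}
    (h : ∀ o, ∑' s, step z.2 o s * f (z.1 ++ [(o, est s)], s) ≤ b) :
    ∑' z', interactRound step est adv z z' * f z' ≤ b := by
  rw [tsum_interactRound_mul]
  exact PMF.tsum_mul_le _ fun o _ => h o

/-- The mass of a state after a round, for a fixed transcript. -/
lemma interact_succ_apply {U σ : Type*} (step : σ → Op U → PMF σ) (est : σ → ℝ) (init : σ)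
    (adv : Adversary U) (n : ℕ) (τ : Transcript U) (o : Op U) (y : ℝ) (s' : σ) [Decidable (y = est s')] :
    interact step est init adv (n + 1) (τ ++ [(o, y)], s') =
      if y = est s' then adv τ o * ∑' s, interact step est init adv n (τ, s) * step s o s' else 0 := by
  classical
  rw [interact, PMF.bind_apply, ENNReal.tsum_prod']
  have h1 : ∀ (τ' : Transcript U) (s : σ),
      interactRound step est adv (τ', s) (τ ++ [(o, y)], s') =
        if τ' = τ ∧ y = est s' then adv τ o * step s o s' else 0 := by
    intro τ' s
    simp only [interactRound, PMF.bind_apply, PMF.map_apply, Prod.mk.injEq]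
    split_ifs with h
    · obtain ⟨rfl, rfl⟩ := h
      rw [tsum_eq_single o]
      · rw [tsum_eq_single s']
        · simp
        · intro b hb; simp [hb.symm]
      · intro o' ho'
        simp [ho'.symm]
    · refine ENNReal.tsum_eq_zero.2 fun o' => ?_
      refine mul_eq_zero_of_right _ (ENNReal.tsum_eq_zero.2 fun s'' => ?_)
      rw [if_neg]
      rintro ⟨h2, rfl⟩
      have h3 := List.append_inj' h2 rfl
      simp only [List.cons.injEq, Prod.mk.injEq, and_true] at h3
      exact h ⟨h3.1.symm, h3.2.2⟩
  simp_rw [h1]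
  rw [tsum_eq_single τ]
  · by_cases h : y = est s'
    · rw [if_pos h, ← ENNReal.tsum_mul_left]
      refine tsum_congr fun s => ?_
      rw [if_pos ⟨rfl, h⟩]; ring
    · simp [h]
  · intro τ' hτ'
    simp [hτ']

/-! ### Transcripts -/

/-- The set of active keys at the end of a transcript. -/
def Transcript.current {U : Type*} [DecidableEq U] (h : Transcript U) : Finset U :=
  h.foldl (fun A e => e.1.apply A) ∅

@[simp] lemma Transcript.insertions_nil {U : Type*} :
    Transcript.insertions ([] : Transcript U) = 0 := rfl

@[simp] lemma Transcript.insertions_append_insert {U : Type*} (h : Transcript U) (y : ℝ) (x : U) :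
    Transcript.insertions (h ++ [(.insert x, y)]) = h.insertions + 1 := by
  simp [Transcript.insertions, Op.isInsert]

@[simp] lemma Transcript.insertions_append_delete {U : Type*} (h : Transcript U) (y : ℝ) (x : U) :
    Transcript.insertions (h ++ [(.delete x, y)]) = h.insertions := by
  simp [Transcript.insertions, Op.isInsert]

lemma Transcript.insertions_le_append {U : Type*} (h : Transcript U) (o : Op U) (y : ℝ) :
    h.insertions ≤ Transcript.insertions (h ++ [(o, y)]) := by
  cases o <;> simp

section TranscriptLemmas
variable {U : Type*} [DecidableEq U] (h : Transcript U) (o : Op U) (y : ℝ)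

@[simp] lemma Transcript.current_nil : Transcript.current ([] : Transcript U) = ∅ := rfl

@[simp] lemma Transcript.current_append :
    Transcript.current (h ++ [(o, y)]) = o.apply h.current := by
  simp [Transcript.current]

lemma Transcript.active_length : h.active h.length = h.current := by
  simp [Transcript.active, Transcript.current]

lemma Transcript.card_length : h.card h.length = h.current.card := by
  simp [Transcript.card, Transcript.active_length]

lemma Transcript.card_append_of_le {t : ℕ} (ht : t ≤ h.length) :
    Transcript.card (h ++ [(o, y)]) t = h.card t := by
  simp [Transcript.card, Transcript.active, List.take_append_of_le_length ht]

lemma Transcript.prefixMax_append_of_le {t : ℕ} (ht : t ≤ h.length) :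
    Transcript.prefixMax (h ++ [(o, y)]) t = h.prefixMax t := by
  refine Finset.sup_congr rfl fun s hs => ?_
  exact h.card_append_of_le o y ((Finset.mem_Icc.1 hs).2.trans ht)

lemma Transcript.prefixMax_mono {s t : ℕ} (hst : s ≤ t) : h.prefixMax s ≤ h.prefixMax t :=
  Finset.sup_mono (Finset.Icc_subset_Icc le_rfl hst)

lemma Transcript.card_current_le_prefixMax : h.current.card ≤ h.prefixMax h.length := by
  rw [← Transcript.card_length]
  rcases Nat.eq_zero_or_pos h.length with h0 | h0
  · rw [h0]; simp [Transcript.card, Transcript.active]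
  · exact Finset.le_sup (f := fun s => h.card s) (Finset.mem_Icc.2 ⟨h0, le_rfl⟩)

lemma Transcript.prefixMax_le_append :
    h.prefixMax h.length ≤ Transcript.prefixMax (h ++ [(o, y)]) (h ++ [(o, y)]).length := by
  rw [← h.prefixMax_append_of_le o y le_rfl]
  exact Transcript.prefixMax_mono _ (by simp)

lemma Op.card_apply_le (A : Finset U) : (o.apply A).card ≤ A.card + 1 := by
  cases o with
  | insert x => exact Finset.card_insert_le _ _
  | delete x => exact (Finset.card_le_card (Finset.erase_subset _ _)).trans (Nat.le_succ _)

lemma Transcript.card_current_le_insertions : h.current.card ≤ h.insertions := by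
  induction h using List.reverseRecOn with
  | nil => simp
  | append_singleton h e ih =>
    obtain ⟨o, y⟩ := e
    rw [Transcript.current_append]
    cases o with
    | insert x =>
      rw [Transcript.insertions_append_insert]
      exact (Op.card_apply_le _ _).trans (by omega)
    | delete x =>
      rw [Transcript.insertions_append_delete]
      exact (Finset.card_le_card (Finset.erase_subset _ _)).trans ih

variable {h} in
lemma Transcript.PrefixMaxAccurate.overall {ε : ℝ} (hε : 0 ≤ ε) (hh : h.PrefixMaxAccurate ε) :
    h.OverallMaxAccurate ε := fun i hi =>
  (hh i hi).trans (mul_le_mul_of_nonneg_left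
    (Nat.cast_le.2 (h.prefixMax_mono (Nat.succ_le_of_lt hi))) hε)

variable {h} in
lemma Transcript.PrefixMaxAccurate.append {ε : ℝ} (hh : h.PrefixMaxAccurate ε)
    (hy : |y - ((o.apply h.current).card : ℝ)| ≤
      ε * (Transcript.prefixMax (h ++ [(o, y)]) (h ++ [(o, y)]).length : ℝ)) :
    Transcript.PrefixMaxAccurate ε (h ++ [(o, y)]) := by
  intro i hi
  rcases Nat.lt_or_ge i h.length with h1 | h1
  · rw [List.getElem_append_left h1, h.card_append_of_le o y h1, h.prefixMax_append_of_le o y h1]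
    exact hh i h1
  · have h2 : i = h.length := by simp at hi; omega
    subst h2
    have h3 : h.length + 1 = (h ++ [(o, y)]).length := by simp
    rw [h3, Transcript.card_length, Transcript.current_append]
    simpa using hy

end TranscriptLemmas

/-! ### The sampling algorithm -/

/-- The state of the sampling algorithm. In phase `J`, every active key is stored with probability
`2 ^ (-J)`. The noise of level `r < l` belongs to the current node of level `r` in a dyadic tree over
the insertions, the noise of level `l` to the keys stored when the phase began. -/
@[ext] structure SampleState (U : Type*) (l : ℕ) where
  /-- the sampled keys -/
  keys : Finset U
  /-- the noise in use, by level of the tree -/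
  noise : Fin (l + 1) → ℤ
  /-- the number of insertions so far -/
  clock : ℕ
  /-- the value of the clock when the phase began -/
  start : ℕ
  /-- the number of times that the sampling rate was halved -/
  phase : ℕ

namespace SampleState
variable {U : Type*} {l : ℕ}

/-- The noisy sample size. -/
def noisyCard (s : SampleState U l) : ℤ := s.keys.card + ∑ r, s.noise r

/-- The published estimate: the noisy sample size over the sampling rate. -/
noncomputable def estimate (s : SampleState U l) : ℝ := 2 ^ s.phase * (s.noisyCard : ℝ)

/-- The condition that starts a new phase: the noisy sample size exceeds `k` (and the number of phases
does not yet exceed `l`). -/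
def Full (k : ℕ) (s : SampleState U l) : Prop := s.phase < l ∧ (k : ℤ) < s.noisyCard

/-- The empty state. -/
def empty : SampleState U l := ⟨∅, 0, 0, 0, 0⟩

end SampleState

/-- The sampling rate of a phase. -/
noncomputable def rate (J : ℕ) : ℝ≥0∞ := 2⁻¹ ^ J

lemma rate_le_one (J : ℕ) : rate J ≤ 1 := pow_le_one₀ (zero_le) (by simp)

@[simp] lemma rate_zero : rate 0 = 1 := by simp [rate]

lemma rate_succ (J : ℕ) : rate J = rate (J + 1) + rate (J + 1) := by
  rw [rate, rate, pow_succ, ← mul_add, ENNReal.inv_two_add_inv_two, mul_one]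

lemma rate_ne_top (J : ℕ) : rate J ≠ ∞ := ne_top_of_le_ne_top ENNReal.one_ne_top (rate_le_one J)

lemma rate_toReal (J : ℕ) : (rate J).toReal = (2 ^ J)⁻¹ := by simp [rate]

/-- The decision whether to sample a key in phase `J`. -/
noncomputable def coin (J : ℕ) : PMF Bool :=
  PMF.ofFintype (fun b => if b then rate J else 1 - rate J) (by
    simp [add_tsub_cancel_of_le (rate_le_one J)])

lemma coin_apply (J : ℕ) (b : Bool) : coin J b = if b then rate J else 1 - rate J := rfl

/-- The noise drawn in phase `J`: none at sampling rate one, when the sample size is exact. -/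
noncomputable def noiseLaw (g : PMF ℤ) (J : ℕ) : PMF ℤ := if J = 0 then PMF.pure 0 else g

/-- The level of the node of the dyadic tree that is opened at time `c`. -/
def nodeLevel (l c : ℕ) : Fin (l + 1) := ⟨min (padicValNat 2 c) l, by omega⟩

/-- Opening a node of level `v` with noise `z` closes all nodes of lower levels. -/
def refresh {l : ℕ} (v : Fin (l + 1)) (Z : Fin (l + 1) → ℤ) (z : ℤ) : Fin (l + 1) → ℤ :=
  fun r => if r < v then 0 else if r = v then z else Z r

open Classical in
/-- The check for a new phase, before an insertion: the sampling rate is halved, and all keys stored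
so far are attached to a single node, with fresh noise. -/
noncomputable def phaseStep {U : Type*} {l : ℕ} (k : ℕ) (g : PMF ℤ) (s : SampleState U l) : PMF (SampleState U l) :=
  if s.Full k then
    (PMF.uniformOfFinset s.keys.powerset (Finset.powerset_nonempty _)).bind fun R =>
      (noiseLaw g (s.phase + 1)).map fun z =>
        ⟨R, Pi.single (Fin.last l) z, s.clock, s.clock, s.phase + 1⟩
  else PMF.pure s

lemma mem_support_phaseStep {U : Type*} {l k : ℕ} {g : PMF ℤ} {s s' : SampleState U l}
    (h : s' ∈ (phaseStep k g s).support) :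
    (¬ s.Full k ∧ s' = s) ∨ (s.Full k ∧ ∃ R ⊆ s.keys, ∃ z : ℤ,
      s' = ⟨R, Pi.single (Fin.last l) z, s.clock, s.clock, s.phase + 1⟩) := by
  unfold phaseStep at h
  split_ifs at h with hf
  · right
    simp only [PMF.mem_support_bind_iff, PMF.mem_support_map_iff] at h
    obtain ⟨R, hR, z, -, rfl⟩ := h
    exact ⟨hf, R, Finset.mem_powerset.1 ((PMF.mem_support_uniformOfFinset_iff _ _).1 hR), z, rfl⟩
  · left
    exact ⟨hf, by simpa using h⟩

section Algorithm
variable {U : Type*} [DecidableEq U] {l : ℕ}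

/-- The sampling of an inserted key, with a decision independent of earlier ones. -/
noncomputable def sampleStep (x : U) (s : SampleState U l) : PMF (SampleState U l) :=
  (coin s.phase).map fun b =>
    { s with keys := if b then insert x s.keys else s.keys.erase x }

/-- The noise of a new insertion. -/
noncomputable def noiseStep (g : PMF ℤ) (s : SampleState U l) : PMF (SampleState U l) :=
  (noiseLaw g s.phase).map fun z =>
    { s with noise := refresh (nodeLevel l (s.clock + 1)) s.noise z, clock := s.clock + 1 }

/-- One update of the sampling algorithm. A deletion uses no randomness: it reveals whether the
deleted key was sampled, but that key is no longer active. -/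
noncomputable def sampleUpdate (k : ℕ) (g : PMF ℤ) (s : SampleState U l) :
    Op U → PMF (SampleState U l)
  | .insert x => (phaseStep k g s).bind fun s₁ => (sampleStep x s₁).bind (noiseStep g)
  | .delete x => PMF.pure { s with keys := s.keys.erase x }

/-- The interaction of the sampling algorithm, without any bound on its memory, with an adversary. -/
noncomputable def sampleRun (l k : ℕ) (g : PMF ℤ) (adv : Adversary U) (n : ℕ) :
    PMF (Transcript U × SampleState U l) :=
  interact (sampleUpdate k g) SampleState.estimate SampleState.empty adv n

lemma mem_support_coin_zero {b : Bool} (h : b ∈ (coin 0).support) : b = true := by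
  by_contra hb
  rw [PMF.mem_support_iff, coin_apply] at h
  simp [hb] at h

lemma mem_support_noiseLaw_zero {g : PMF ℤ} {z : ℤ} (h : z ∈ (noiseLaw g 0).support) : z = 0 := by
  simpa [noiseLaw] using h

/-- The possible outcomes of an insertion. -/
lemma mem_support_sampleUpdate_insert {k : ℕ} {g : PMF ℤ} {s s' : SampleState U l} {x : U}
    (h : s' ∈ (sampleUpdate k g s (.insert x)).support) :
    ∃ s₁ ∈ (phaseStep k g s).support, ∃ b ∈ (coin s₁.phase).support, ∃ z ∈ (noiseLaw g s₁.phase).support,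
      s' = ⟨if b then insert x s₁.keys else s₁.keys.erase x,
        refresh (nodeLevel l (s₁.clock + 1)) s₁.noise z, s₁.clock + 1, s₁.start, s₁.phase⟩ := by
  simp only [sampleUpdate, PMF.mem_support_bind_iff, sampleStep, noiseStep, PMF.mem_support_map_iff] at h
  obtain ⟨s₁, h1, s₂, ⟨b, hb, rfl⟩, z, hz, rfl⟩ := h
  exact ⟨s₁, h1, b, hb, z, hz, rfl⟩

/-- What holds in every reachable configuration. -/
structure Consistent (τ : Transcript U) (s : SampleState U l) : Prop where
  clock_eq : s.clock = τ.insertions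
  phase_le : s.phase ≤ l
  keys_subset : s.keys ⊆ τ.current
  exact_of_zero : s.phase = 0 → s.keys = τ.current ∧ s.noise = 0
  start_lt : s.phase ≠ 0 → s.start < s.clock
  start_le : s.start ≤ s.clock

lemma Consistent.step {k : ℕ} {g : PMF ℤ} {τ : Transcript U} {s s' : SampleState U l} {o : Op U}
    (hs : Consistent τ s) (h : s' ∈ (sampleUpdate k g s o).support) (y : ℝ) :
    Consistent (τ ++ [(o, y)]) s' := by
  cases o with
  | delete x =>
    simp only [sampleUpdate, PMF.mem_support_pure_iff] at h
    subst h
    refine ⟨by simpa using hs.clock_eq, hs.phase_le, ?_, fun h0 => ⟨?_, (hs.exact_of_zero h0).2⟩,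
      hs.start_lt, hs.start_le⟩
    · simpa [Op.apply] using Finset.erase_subset_erase x hs.keys_subset
    · simp [Op.apply, (hs.exact_of_zero h0).1]
  | insert x =>
    obtain ⟨s₁, h1, b, hb, z, hz, rfl⟩ := mem_support_sampleUpdate_insert h
    have hsub : s₁.keys ⊆ s.keys → (if b then insert x s₁.keys else s₁.keys.erase x)
        ⊆ Transcript.current (τ ++ [(Op.insert x, y)]) := by
      intro h2
      rw [Transcript.current_append, Op.apply]
      split_ifs
      · exact Finset.insert_subset_insert _ (h2.trans hs.keys_subset)
      · exact (Finset.erase_subset _ _).trans ((h2.trans hs.keys_subset).trans (Finset.subset_insert _ _))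
    rcases mem_support_phaseStep h1 with ⟨hf, rfl⟩ | ⟨hf, R, hR, z0, rfl⟩
    · refine ⟨by simpa using hs.clock_eq, hs.phase_le, hsub subset_rfl, fun h0 => ?_,
        fun _ => Nat.lt_succ_of_le hs.start_le, Nat.le_succ_of_le hs.start_le⟩
      simp only at h0
      rw [h0] at hb hz
      have hb := mem_support_coin_zero hb
      have hz := mem_support_noiseLaw_zero hz
      subst hb hz
      refine ⟨by simp [Op.apply, (hs.exact_of_zero h0).1], ?_⟩
      funext r
      simp [refresh, (hs.exact_of_zero h0).2]
    · refine ⟨by simpa using hs.clock_eq, hf.1, hsub hR, fun h0 => ?_, fun _ => Nat.lt_succ_self _,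
        Nat.le_succ _⟩
      simp at h0

lemma consistent_of_mem_support {k : ℕ} {g : PMF ℤ} {adv : Adversary U} {n : ℕ}
    {z : Transcript U × SampleState U l} (h : z ∈ (sampleRun l k g adv n).support) :
    Consistent z.1 z.2 := by
  induction n generalizing z with
  | zero =>
    simp only [sampleRun, interact, PMF.mem_support_pure_iff] at h
    subst h
    exact ⟨rfl, Nat.zero_le _, by simp [SampleState.empty], fun _ => ⟨rfl, rfl⟩,
      fun h => absurd rfl h, le_rfl⟩
  | succ n ih =>
    rw [sampleRun, interact, PMF.mem_support_bind_iff] at h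
    obtain ⟨z0, h0, h1⟩ := h
    obtain ⟨o, -, s, hs, rfl⟩ := mem_support_interactRound.1 h1
    exact (ih h0).step hs _

end Algorithm

/-! ### The published estimates hide which active keys are sampled -/

/-- The image of a weight function under a random step. -/
noncomputable def pushWeight {σ : Type*} (w : σ → ℝ≥0∞) (κ : σ → PMF σ) (s' : σ) : ℝ≥0∞ :=
  ∑' s, w s * κ s s'

lemma pushWeight_bind {σ : Type*} (w : σ → ℝ≥0∞) (κ₁ κ₂ : σ → PMF σ) :
    pushWeight w (fun s => (κ₁ s).bind κ₂) = pushWeight (pushWeight w κ₁) κ₂ := by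
  funext s'
  simp only [pushWeight, PMF.bind_apply, ← ENNReal.tsum_mul_left, ← ENNReal.tsum_mul_right]
  rw [ENNReal.tsum_comm]
  refine tsum_congr fun a => tsum_congr fun b => ?_
  ring

/-- The change of a noise configuration by `u` at position `j`. -/
def shiftAt {l : ℕ} (Z : Fin (l + 1) → ℤ) (j : Fin (l + 1)) (u : ℤ) : Fin (l + 1) → ℤ :=
  fun r => Z r + if r = j then u else 0

lemma shiftAt_of_ne {l : ℕ} (Z : Fin (l + 1) → ℤ) {j r : Fin (l + 1)} (h : r ≠ j) (u : ℤ) :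
    shiftAt Z j u r = Z r := by simp [shiftAt, h]

@[simp] lemma shiftAt_self {l : ℕ} (Z : Fin (l + 1) → ℤ) (j : Fin (l + 1)) (u : ℤ) :
    shiftAt Z j u j = Z j + u := by simp [shiftAt]

/-- The change at one position as a bijection. -/
def shiftEquiv {l : ℕ} (j : Fin (l + 1)) (u : ℤ) : (Fin (l + 1) → ℤ) ≃ (Fin (l + 1) → ℤ) where
  toFun Z := shiftAt Z j u
  invFun Z := shiftAt Z j (-u)
  left_inv Z := by funext r; by_cases h : r = j <;> simp [shiftAt, h]
  right_inv Z := by funext r; by_cases h : r = j <;> simp [shiftAt, h]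

lemma tsum_shiftAt {l : ℕ} (j : Fin (l + 1)) (u : ℤ) (f : (Fin (l + 1) → ℤ) → ℝ≥0∞) :
    ∑' Z, f (shiftAt Z j u) = ∑' Z, f Z := (shiftEquiv j u).tsum_eq f

/-- `Hidden F w x c c₀ J j`: under the weight `w`, whether the key `x` is sampled in phase `J` is as
likely as without further information, up to a factor `F`. More precisely, a state that contains `x`
is compared to the state without `x` in which the noise at position `j` makes up for the difference
in the noisy sample size. -/
def Hidden {U : Type*} [DecidableEq U] {l : ℕ} (F : ℝ≥0∞) (w : SampleState U l → ℝ≥0∞) (x : U)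
    (c c₀ J : ℕ) (j : Fin (l + 1)) : Prop :=
  ∀ S : Finset U, x ∉ S → ∀ Z : Fin (l + 1) → ℤ,
    (1 - rate J) * w ⟨insert x S, Z, c, c₀, J⟩ ≤ F * (rate J * w ⟨S, shiftAt Z j 1, c, c₀, J⟩) ∧
    rate J * w ⟨S, Z, c, c₀, J⟩ ≤
      F * ((1 - rate J) * w ⟨insert x S, shiftAt Z j (-1), c, c₀, J⟩)

/-- Position `j` holds the noise of a node that is open at time `c`: the node of the keys stored at
the beginning of the phase, or a node of the dyadic tree. -/
def NodeOpen (l j c : ℕ) : Prop :=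
  j = l ∨ ∃ d, 1 ≤ d ∧ d ≤ c ∧ padicValNat 2 d = j ∧ c < d + 2 ^ j

/-- The noise law allows unit shifts at the cost of a factor `E`. -/
def ShiftBound (E : ℝ≥0∞) (g : PMF ℤ) : Prop :=
  (∀ z, g z ≤ E * g (z + 1)) ∧ ∀ z, g z ≤ E * g (z + -1)

section Privacy
variable {U : Type*} {l : ℕ}

lemma pushWeight_noiseStep (g : PMF ℤ) (w : SampleState U l → ℝ≥0∞) (S : Finset U)
    (Z : Fin (l + 1) → ℤ) (c c₀ J : ℕ) :
    pushWeight w (noiseStep g) ⟨S, Z, c + 1, c₀, J⟩ =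
      (if ∀ r < nodeLevel l (c + 1), Z r = 0 then 1 else 0) *
      noiseLaw g J (Z (nodeLevel l (c + 1))) *
      ∑' Y : Fin (l + 1) → ℤ, if ∀ r, nodeLevel l (c + 1) < r → Y r = Z r then w ⟨S, Y, c, c₀, J⟩ else 0 := by
  classical
  set v := nodeLevel l (c + 1) with hv
  have hinj : Function.Injective (fun Y : Fin (l + 1) → ℤ => (⟨S, Y, c, c₀, J⟩ : SampleState U l)) :=
    fun a b h => congrArg SampleState.noise h
  have hrange : ∀ s : SampleState U l, noiseStep g s ⟨S, Z, c + 1, c₀, J⟩ ≠ 0 →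
      s ∈ Set.range (fun Y : Fin (l + 1) → ℤ => (⟨S, Y, c, c₀, J⟩ : SampleState U l)) := by
    intro s hs
    rw [← PMF.mem_support_iff, noiseStep, PMF.mem_support_map_iff] at hs
    obtain ⟨z, -, hz⟩ := hs
    simp only [SampleState.mk.injEq, Nat.add_right_cancel_iff] at hz
    exact ⟨s.noise, by ext1 <;> simp [hz]⟩
  unfold pushWeight
  rw [← hinj.tsum_eq]
  · rw [← ENNReal.tsum_mul_left]
    refine tsum_congr fun Y => ?_
    have key : noiseStep g (⟨S, Y, c, c₀, J⟩ : SampleState U l) ⟨S, Z, c + 1, c₀, J⟩ =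
        if (∀ r < v, Z r = 0) ∧ (∀ r, v < r → Y r = Z r) then noiseLaw g J (Z v) else 0 := by
      rw [noiseStep, PMF.map_apply]
      simp only [SampleState.mk.injEq, true_and, and_true, ← hv]
      rw [tsum_eq_single (Z v)]
      · congr 1
        rw [eq_iff_iff]
        constructor
        · intro h
          constructor
          · intro r hr; rw [h]; simp [refresh, hr]
          · intro r hr; rw [h]; simp [refresh, hr.not_gt, hr.ne']
        · rintro ⟨h1, h2⟩
          funext r
          rcases lt_trichotomy r v with hr | hr | hr
          · simp [refresh, hr, h1 r hr]
          · simp [refresh, hr]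
          · simp [refresh, hr.not_gt, hr.ne', h2 r hr]
      · intro z hz
        rw [if_neg]
        intro h
        apply hz
        rw [h]; simp [refresh]
    rw [key]
    by_cases h1 : ∀ r < v, Z r = 0
    · by_cases h2 : ∀ r, v < r → Y r = Z r
      · simp only [if_pos h1, if_pos h2, if_pos (And.intro h1 h2)]; ring
      · simp [h2]
    · simp [h1]
  · intro s hs
    exact hrange s (right_ne_zero_of_mul hs)

variable [DecidableEq U]

lemma Hidden.mono {F F' : ℝ≥0∞} {w : SampleState U l → ℝ≥0∞} {x : U} {c c₀ J : ℕ}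
    {j : Fin (l + 1)} (h : Hidden F w x c c₀ J j) (hF : F ≤ F') : Hidden F' w x c c₀ J j :=
  fun S hS Z => ⟨(h S hS Z).1.trans (by gcongr), (h S hS Z).2.trans (by gcongr)⟩

lemma noisyCard_insert_eq {x : U} {S : Finset U} (hx : x ∉ S) (Z : Fin (l + 1) → ℤ) (c c₀ J : ℕ)
    (j : Fin (l + 1)) :
    (⟨insert x S, Z, c, c₀, J⟩ : SampleState U l).noisyCard =
      (⟨S, shiftAt Z j 1, c, c₀, J⟩ : SampleState U l).noisyCard := by
  simp [SampleState.noisyCard, shiftAt, Finset.card_insert_of_notMem hx, Finset.sum_add_distrib]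
  ring

lemma noisyCard_insert_eq' {x : U} {S : Finset U} (hx : x ∉ S) (Z : Fin (l + 1) → ℤ) (c c₀ J : ℕ)
    (j : Fin (l + 1)) :
    (⟨insert x S, shiftAt Z j (-1), c, c₀, J⟩ : SampleState U l).noisyCard =
      (⟨S, Z, c, c₀, J⟩ : SampleState U l).noisyCard := by
  simp [SampleState.noisyCard, shiftAt, Finset.card_insert_of_notMem hx, Finset.sum_add_distrib]
  ring

/-- Restricting to an event that depends on the state only through the phase and the noisy sample
size preserves `Hidden`. -/
lemma Hidden.restrict {F : ℝ≥0∞} {w w' : SampleState U l → ℝ≥0∞} {x : U} {c c₀ J : ℕ}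
    {j : Fin (l + 1)} (h : Hidden F w x c c₀ J j) (f : ℤ → ℝ≥0∞)
    (hw : ∀ S Z, w' ⟨S, Z, c, c₀, J⟩ =
      f (⟨S, Z, c, c₀, J⟩ : SampleState U l).noisyCard * w ⟨S, Z, c, c₀, J⟩) :
    Hidden F w' x c c₀ J j := by
  intro S hS Z
  obtain ⟨h1, h2⟩ := h S hS Z
  constructor
  · rw [hw, hw, noisyCard_insert_eq hS Z c c₀ J j]
    calc _ = f (⟨S, shiftAt Z j 1, c, c₀, J⟩ : SampleState U l).noisyCard *
          ((1 - rate J) * w ⟨insert x S, Z, c, c₀, J⟩) := by ring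
      _ ≤ f (⟨S, shiftAt Z j 1, c, c₀, J⟩ : SampleState U l).noisyCard *
          (F * (rate J * w ⟨S, shiftAt Z j 1, c, c₀, J⟩)) := by gcongr
      _ = _ := by ring
  · rw [hw, hw, noisyCard_insert_eq' hS Z c c₀ J j]
    calc _ = f (⟨S, Z, c, c₀, J⟩ : SampleState U l).noisyCard *
          (rate J * w ⟨S, Z, c, c₀, J⟩) := by ring
      _ ≤ f (⟨S, Z, c, c₀, J⟩ : SampleState U l).noisyCard *
          (F * ((1 - rate J) * w ⟨insert x S, shiftAt Z j (-1), c, c₀, J⟩)) := by gcongr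
      _ = _ := by ring

/-! ### Deletions and sampling -/

/-- A sum over all states that agree with a given one outside an element `y` of the key set. -/
lemma tsum_state_erase (y : U) (S : Finset U) (Z : Fin (l + 1) → ℤ) (c c₀ J : ℕ)
    (f : SampleState U l → ℝ≥0∞)
    (hf : ∀ s, f s ≠ 0 → s.keys.erase y = S.erase y ∧ s.noise = Z ∧ s.clock = c ∧ s.start = c₀ ∧
      s.phase = J) :
    ∑' s, f s = f ⟨S.erase y, Z, c, c₀, J⟩ + f ⟨insert y S, Z, c, c₀, J⟩ := by
  classical
  rw [tsum_eq_sum (s := {⟨S.erase y, Z, c, c₀, J⟩, ⟨insert y S, Z, c, c₀, J⟩})]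
  · rw [Finset.sum_pair]
    intro h
    have h1 : S.erase y = insert y S := congrArg SampleState.keys h
    have := Finset.mem_insert_self y S
    rw [← h1] at this
    simp at this
  · intro s hs
    by_contra h0
    obtain ⟨h1, h2, h3, h4, h5⟩ := hf s h0
    apply hs
    simp only [Finset.mem_insert, Finset.mem_singleton]
    by_cases hy : y ∈ s.keys
    · right
      ext1
      · rw [← Finset.insert_erase hy, h1]
        ext a; by_cases ha : a = y <;> simp [ha]
      all_goals assumption
    · left
      ext1
      · rw [← h1, Finset.erase_eq_of_notMem hy]
      all_goals assumption

lemma pushWeight_delete (k : ℕ) (g : PMF ℤ) (w : SampleState U l → ℝ≥0∞) (y : U) (S : Finset U)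
    (Z : Fin (l + 1) → ℤ) (c c₀ J : ℕ) :
    pushWeight w (fun s => sampleUpdate k g s (.delete y)) ⟨S, Z, c, c₀, J⟩ =
      if y ∈ S then 0 else w ⟨S, Z, c, c₀, J⟩ + w ⟨insert y S, Z, c, c₀, J⟩ := by
  have hne : ∀ s : SampleState U l, (⟨S, Z, c, c₀, J⟩ : SampleState U l) = { s with keys := s.keys.erase y } ↔
      S = s.keys.erase y ∧ Z = s.noise ∧ c = s.clock ∧ c₀ = s.start ∧ J = s.phase := by
    intro s; simp
  unfold pushWeight sampleUpdate
  simp only [PMF.pure_apply, hne]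
  split_ifs with hy
  · refine ENNReal.tsum_eq_zero.2 fun s => ?_
    rw [if_neg]
    · simp
    · rintro ⟨rfl, -⟩; simp at hy
  · rw [tsum_state_erase y S Z c c₀ J]
    · simp [Finset.erase_eq_of_notMem hy, Finset.erase_insert hy]
    · intro s hs
      have h2 : S = s.keys.erase y ∧ Z = s.noise ∧ c = s.clock ∧ c₀ = s.start ∧ J = s.phase := by
        by_contra h; simp [h] at hs
      obtain ⟨h1, h2, h3, h4, h5⟩ := h2
      refine ⟨?_, h2.symm, h3.symm, h4.symm, h5.symm⟩
      rw [Finset.erase_eq_of_notMem hy, h1]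

lemma Hidden.delete {F : ℝ≥0∞} {w : SampleState U l → ℝ≥0∞} {x y : U} {c c₀ J : ℕ}
    {j : Fin (l + 1)} (h : Hidden F w x c c₀ J j) (hxy : x ≠ y) (k : ℕ) (g : PMF ℤ) :
    Hidden F (pushWeight w (fun s => sampleUpdate k g s (.delete y))) x c c₀ J j := by
  intro S hS Z
  simp only [pushWeight_delete]
  have hy : y ∈ insert x S ↔ y ∈ S := by simp [hxy.symm]
  simp only [hy]
  split_ifs with h1
  · simp
  · have hS' : x ∉ insert y S := by simp [hxy, hS]
    obtain ⟨a1, a2⟩ := h S hS Z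
    obtain ⟨b1, b2⟩ := h _ hS' Z
    rw [Finset.insert_comm] at b1 b2
    constructor
    · calc _ = _ := mul_add _ _ _
        _ ≤ _ := add_le_add a1 b1
        _ = _ := by ring
    · calc _ = _ := mul_add _ _ _
        _ ≤ _ := add_le_add a2 b2
        _ = _ := by ring

lemma pushWeight_sampleStep (w : SampleState U l → ℝ≥0∞) (y : U) (S : Finset U)
    (Z : Fin (l + 1) → ℤ) (c c₀ J : ℕ) :
    pushWeight w (sampleStep y) ⟨S, Z, c, c₀, J⟩ =
      (if y ∈ S then rate J else 1 - rate J) *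
        (w ⟨S.erase y, Z, c, c₀, J⟩ + w ⟨insert y S, Z, c, c₀, J⟩) := by
  have key : ∀ s : SampleState U l, sampleStep y s ⟨S, Z, c, c₀, J⟩ =
      if s.keys.erase y = S.erase y ∧ Z = s.noise ∧ c = s.clock ∧ c₀ = s.start ∧ J = s.phase then
        (if y ∈ S then rate J else 1 - rate J) else 0 := by
    intro s
    rw [sampleStep, PMF.map_apply, tsum_bool]
    simp only [SampleState.mk.injEq, coin_apply, Bool.false_eq_true, if_false, if_true]
    by_cases hr : Z = s.noise ∧ c = s.clock ∧ c₀ = s.start ∧ J = s.phase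
    · obtain ⟨rfl, rfl, rfl, rfl⟩ := hr
      simp only [and_true]
      by_cases hy : y ∈ S
      · have h1 : S ≠ s.keys.erase y := by rintro rfl; simp at hy
        have h2 : S = insert y s.keys ↔ s.keys.erase y = S.erase y := by
          constructor
          · rintro rfl; ext a; by_cases ha : a = y <;> simp [ha]
          · intro h; rw [← Finset.insert_erase hy, ← h]
            ext a; by_cases ha : a = y <;> simp [ha]
        simp [hy, h1, h2]
      · have h1 : S ≠ insert y s.keys := by rintro rfl; simp at hy
        have h2 : S = s.keys.erase y ↔ s.keys.erase y = S.erase y := by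
          rw [Finset.erase_eq_of_notMem hy, eq_comm]
        simp only [hy, h1, if_false, add_zero, h2]
    · rw [if_neg (by tauto), if_neg (by tauto), if_neg (by tauto), add_zero]
  unfold pushWeight
  simp only [key]
  rw [tsum_state_erase y S Z c c₀ J]
  · have : (insert y S).erase y = S.erase y := by
      ext a; by_cases ha : a = y <;> simp [ha]
    simp only [this, Finset.erase_idem, and_self, if_true]
    ring
  · intro s hs
    by_contra h
    apply hs
    rw [if_neg]
    · simp
    · rintro ⟨h1, h2, h3, h4, h5⟩
      exact h ⟨h1, h2.symm, h3.symm, h4.symm, h5.symm⟩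

/-- Sampling another key. -/
lemma Hidden.sampleStep {F : ℝ≥0∞} {w : SampleState U l → ℝ≥0∞} {x y : U} {c c₀ J : ℕ}
    {j : Fin (l + 1)} (h : Hidden F w x c c₀ J j) (hxy : x ≠ y) :
    Hidden F (pushWeight w (sampleStep y)) x c c₀ J j := by
  intro S hS Z
  simp only [pushWeight_sampleStep]
  have hy : y ∈ insert x S ↔ y ∈ S := by simp [hxy.symm]
  simp only [hy]
  have hS1 : x ∉ insert y S := by simp [hxy, hS]
  have hS2 : x ∉ S.erase y := by simp [hS]
  rw [Finset.insert_comm, Finset.erase_insert_of_ne hxy]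
  obtain ⟨a1, a2⟩ := h _ hS2 Z
  obtain ⟨b1, b2⟩ := h _ hS1 Z
  set t := if y ∈ S then rate J else 1 - rate J
  constructor
  · calc _ = t * ((1 - rate J) * w ⟨insert x (S.erase y), Z, c, c₀, J⟩ +
          (1 - rate J) * w ⟨insert x (insert y S), Z, c, c₀, J⟩) := by ring
      _ ≤ _ := mul_le_mul_right (add_le_add a1 b1) t
      _ = _ := by ring
  · calc _ = t * (rate J * w ⟨S.erase y, Z, c, c₀, J⟩ +
          rate J * w ⟨insert y S, Z, c, c₀, J⟩) := by ring
      _ ≤ _ := mul_le_mul_right (add_le_add a2 b2) t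
      _ = _ := by ring

/-- The decision for a newly inserted key is independent of everything else. -/
lemma sampleStep_self (w : SampleState U l → ℝ≥0∞) (y : U) (S : Finset U) (hy : y ∉ S)
    (Z : Fin (l + 1) → ℤ) (c c₀ J : ℕ) :
    (1 - rate J) * pushWeight w (_root_.sampleStep y) ⟨insert y S, Z, c, c₀, J⟩ =
      rate J * pushWeight w (_root_.sampleStep y) ⟨S, Z, c, c₀, J⟩ := by
  rw [pushWeight_sampleStep, pushWeight_sampleStep, if_neg hy, if_pos (Finset.mem_insert_self _ _),
    Finset.erase_insert hy, Finset.erase_eq_of_notMem hy, Finset.insert_idem]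
  ring

/-! ### Noise -/

/-- Effect of the noise step on a comparison of two noise configurations that differ by a shift at
position `j`. A closed node is replaced by the new one, at the cost of a factor `E`. -/
lemma noise_compare {E F : ℝ≥0∞} {ν : ℤ → ℝ≥0∞} {u : ℤ} (hν : ∀ z, ν z ≤ E * ν (z + u))
    (v j j' : Fin (l + 1)) (f h : (Fin (l + 1) → ℤ) → ℝ≥0∞) (F' : ℝ≥0∞)
    (hjj : (v < j ∧ j' = j ∧ F' = F) ∨ (j < v ∧ j' = v ∧ F' = F * E))
    (hfh : ∀ Z, f Z ≤ F * h (shiftAt Z j u)) (Z : Fin (l + 1) → ℤ) :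
    (if ∀ r < v, Z r = 0 then 1 else 0) * ν (Z v) * (∑' Y, if ∀ r, v < r → Y r = Z r then f Y else 0) ≤
    F' * ((if ∀ r < v, (shiftAt Z j' u) r = 0 then 1 else 0) * ν ((shiftAt Z j' u) v) *
      (∑' Y, if ∀ r, v < r → Y r = (shiftAt Z j' u) r then h Y else 0)) := by
  have hshift : ∀ P : (Fin (l + 1) → ℤ) → Prop, ∀ [DecidablePred P],
      (∑' Y, if P Y then h (shiftAt Y j u) else 0) =
        ∑' Y, if P (shiftAt Y j (-u)) then h Y else 0 := by
    intro P _
    rw [← tsum_shiftAt j u (fun Y => if P (shiftAt Y j (-u)) then h Y else 0)]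
    refine tsum_congr fun Y => ?_
    rw [show shiftAt (shiftAt Y j u) j (-u) = Y from (shiftEquiv j u).left_inv Y]
  have hsum : (∑' Y, if ∀ r, v < r → Y r = Z r then f Y else 0) ≤
      F * ∑' Y, if ∀ r, v < r → (shiftAt Y j (-u)) r = Z r then h Y else 0 := by
    rw [← hshift (fun Y => ∀ r, v < r → Y r = Z r), ← ENNReal.tsum_mul_left]
    refine ENNReal.tsum_le_tsum fun Y => ?_
    split_ifs
    · exact hfh Y
    · simp
  rcases hjj with ⟨hvj, rfl, rfl⟩ | ⟨hjv, rfl, rfl⟩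
  · have e1 : (∀ r < v, (shiftAt Z j' u) r = 0) ↔ ∀ r < v, Z r = 0 := by
      refine forall₂_congr fun r hr => ?_
      simp [shiftAt_of_ne _ (hr.trans hvj).ne]
    have e2 : (shiftAt Z j' u) v = Z v := by simp [shiftAt_of_ne _ hvj.ne]
    have e3 : ∀ Y : Fin (l + 1) → ℤ, (∀ r, v < r → Y r = (shiftAt Z j' u) r) ↔
        ∀ r, v < r → (shiftAt Y j' (-u)) r = Z r := by
      intro Y
      refine forall₂_congr fun r hr => ?_
      by_cases h : r = j'
      · subst h; simp only [shiftAt_self]; constructor <;> intro h <;> omega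
      · simp [shiftAt_of_ne _ h]
    simp only [e1, e2, e3]
    calc _ ≤ (if ∀ r < v, Z r = 0 then 1 else 0) * ν (Z v) * _ := mul_le_mul_right hsum _
      _ = _ := by ring
  · have e1 : (∀ r < j', (shiftAt Z j' u) r = 0) ↔ ∀ r < j', Z r = 0 := by
      refine forall₂_congr fun r hr => ?_
      simp [shiftAt_of_ne _ hr.ne]
    have e2 : (shiftAt Z j' u) j' = Z j' + u := by simp
    have e3 : ∀ Y : Fin (l + 1) → ℤ, (∀ r, j' < r → Y r = (shiftAt Z j' u) r) ↔
        ∀ r, j' < r → (shiftAt Y j (-u)) r = Z r := by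
      intro Y
      refine forall₂_congr fun r hr => ?_
      simp [shiftAt_of_ne _ hr.ne', shiftAt_of_ne _ (hjv.trans hr).ne']
    simp only [e1, e2, e3]
    calc _ ≤ (if ∀ r < j', Z r = 0 then 1 else 0) * (E * ν (Z j' + u)) * _ :=
          mul_le_mul' (mul_le_mul_right (hν _) _) hsum
      _ = _ := by ring

lemma Hidden.noiseStep {E F F' : ℝ≥0∞} {g : PMF ℤ} (hg : ShiftBound E g)
    {w : SampleState U l → ℝ≥0∞} {x : U} {c c₀ J : ℕ} (hJ : J ≠ 0) {j j' : Fin (l + 1)}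
    (h : Hidden F w x c c₀ J j)
    (hjj : (nodeLevel l (c + 1) < j ∧ j' = j ∧ F' = F) ∨
      (j < nodeLevel l (c + 1) ∧ j' = nodeLevel l (c + 1) ∧ F' = F * E)) :
    Hidden F' (pushWeight w (_root_.noiseStep g)) x (c + 1) c₀ J j' := by
  intro S hS Z
  simp only [pushWeight_noiseStep, noiseLaw, if_neg hJ]
  constructor
  · have := noise_compare (f := fun Z => (1 - rate J) * w ⟨insert x S, Z, c, c₀, J⟩)
      (h := fun Z => rate J * w ⟨S, Z, c, c₀, J⟩) hg.1 (nodeLevel l (c + 1)) j j' F' hjj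
      (fun Z => (h S hS Z).1) Z
    simp only [← mul_ite_zero, ENNReal.tsum_mul_left] at this
    calc _ = _ := by ring
      _ ≤ _ := this
      _ = _ := by ring
  · have := noise_compare (f := fun Z => rate J * w ⟨S, Z, c, c₀, J⟩)
      (h := fun Z => (1 - rate J) * w ⟨insert x S, Z, c, c₀, J⟩) hg.2 (nodeLevel l (c + 1)) j j' F' hjj
      (fun Z => (h S hS Z).2) Z
    simp only [← mul_ite_zero, ENNReal.tsum_mul_left] at this
    calc _ = _ := by ring
      _ ≤ _ := this
      _ = _ := by ring

lemma noise_compare_self {E : ℝ≥0∞} {ν : ℤ → ℝ≥0∞} {u : ℤ} (hν : ∀ z, ν z ≤ E * ν (z + u))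
    (v : Fin (l + 1)) (h : (Fin (l + 1) → ℤ) → ℝ≥0∞) (Z : Fin (l + 1) → ℤ) :
    (if ∀ r < v, Z r = 0 then 1 else 0) * ν (Z v) * (∑' Y, if ∀ r, v < r → Y r = Z r then h Y else 0) ≤
    E * ((if ∀ r < v, (shiftAt Z v u) r = 0 then 1 else 0) * ν ((shiftAt Z v u) v) *
      (∑' Y, if ∀ r, v < r → Y r = (shiftAt Z v u) r then h Y else 0)) := by
  have e1 : (∀ r < v, (shiftAt Z v u) r = 0) ↔ ∀ r < v, Z r = 0 := by
    refine forall₂_congr fun r hr => ?_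
    simp [shiftAt_of_ne _ hr.ne]
  have e2 : (shiftAt Z v u) v = Z v + u := by simp
  have e3 : ∀ Y : Fin (l + 1) → ℤ, (∀ r, v < r → Y r = (shiftAt Z v u) r) ↔
      ∀ r, v < r → Y r = Z r := by
    intro Y
    refine forall₂_congr fun r hr => ?_
    simp [shiftAt_of_ne _ hr.ne']
  simp only [e1, e2, e3]
  calc _ ≤ (if ∀ r < v, Z r = 0 then 1 else 0) * (E * ν (Z v + u)) * _ :=
        mul_le_mul_left (mul_le_mul_right (hν _) _) _
    _ = _ := by ring

/-- A newly inserted key is hidden by the noise of the node opened by its insertion. -/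
lemma hidden_new {E : ℝ≥0∞} {g : PMF ℤ} (hg : ShiftBound E g) (w : SampleState U l → ℝ≥0∞) (y : U)
    {c c₀ J : ℕ} (hJ : J ≠ 0) :
    Hidden E (pushWeight (pushWeight w (sampleStep y)) (noiseStep g)) y (c + 1) c₀ J
      (nodeLevel l (c + 1)) := by
  intro S hS Z
  have hself := fun Z => sampleStep_self w y S hS Z c c₀ J
  simp only [pushWeight_noiseStep, noiseLaw, if_neg hJ]
  set w2 := pushWeight w (sampleStep y)
  have hsum : ∀ P : (Fin (l + 1) → ℤ) → Prop, ∀ [DecidablePred P],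
      (1 - rate J) * (∑' Y, if P Y then w2 ⟨insert y S, Y, c, c₀, J⟩ else 0) =
        rate J * ∑' Y, if P Y then w2 ⟨S, Y, c, c₀, J⟩ else 0 := by
    intro P _
    rw [← ENNReal.tsum_mul_left, ← ENNReal.tsum_mul_left]
    refine tsum_congr fun Y => ?_
    split_ifs
    · exact hself Y
    · simp
  constructor
  · calc _ = rate J * ((if ∀ r < nodeLevel l (c + 1), Z r = 0 then 1 else 0) *
          g (Z (nodeLevel l (c + 1))) * ∑' Y, if ∀ r, nodeLevel l (c + 1) < r → Y r = Z r then
            w2 ⟨S, Y, c, c₀, J⟩ else 0) := by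
            rw [mul_left_comm, hsum]; ring
      _ ≤ rate J * _ := mul_le_mul_right (noise_compare_self hg.1 _ (fun Y => w2 ⟨S, Y, c, c₀, J⟩) Z) _
      _ = _ := by ring
  · calc _ = (1 - rate J) * ((if ∀ r < nodeLevel l (c + 1), Z r = 0 then 1 else 0) *
          g (Z (nodeLevel l (c + 1))) * ∑' Y, if ∀ r, nodeLevel l (c + 1) < r → Y r = Z r then
            w2 ⟨insert y S, Y, c, c₀, J⟩ else 0) := by
            rw [mul_left_comm (1 - rate J), hsum]; ring
      _ ≤ (1 - rate J) * _ :=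
          mul_le_mul_right (noise_compare_self hg.2 _ (fun Y => w2 ⟨insert y S, Y, c, c₀, J⟩) Z) _
      _ = _ := by ring
end Privacy

/-! ### A new phase -/

/-- A sum over finite sets, split according to the membership of `x`. -/
lemma tsum_finset_split {U : Type*} [DecidableEq U] (x : U) (φ : Finset U → ℝ≥0∞) :
    ∑' S, φ S = ∑' S, if x ∈ S then 0 else φ S + φ (insert x S) := by
  let e : Finset U ≃ Finset U := Function.Involutive.toPerm
    (fun S => if x ∈ S then S.erase x else insert x S) (by
      intro S
      by_cases h : x ∈ S
      · simp [h, Finset.insert_erase h]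
      · simp [h, Finset.erase_insert h])
  have he : ∀ S, e S = if x ∈ S then S.erase x else insert x S := fun _ => rfl
  have h1 : ∑' S, φ S = ∑' S, (if x ∈ S then 0 else φ S) + ∑' S, (if x ∈ S then φ S else 0) := by
    rw [← ENNReal.tsum_add]
    refine tsum_congr fun S => ?_
    split_ifs <;> simp
  rw [h1, ← e.tsum_eq (fun S => if x ∈ S then φ S else 0), ← ENNReal.tsum_add]
  refine tsum_congr fun S => ?_
  by_cases h : x ∈ S <;> simp [he, h]

section NewPhase
variable {U : Type*} {l : ℕ}

/-- The law of the noise at the beginning of phase `J + 1`. -/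
noncomputable def startNoise (l : ℕ) (g : PMF ℤ) (Z : Fin (l + 1) → ℤ) : ℝ≥0∞ :=
  if ∀ r, r ≠ Fin.last l → Z r = 0 then g (Z (Fin.last l)) else 0

lemma startNoise_le {E : ℝ≥0∞} {g : PMF ℤ} {u : ℤ} (h : ∀ z, g z ≤ E * g (z + u))
    (Z : Fin (l + 1) → ℤ) : startNoise l g Z ≤ E * startNoise l g (shiftAt Z (Fin.last l) u) := by
  have e : (∀ r, r ≠ Fin.last l → shiftAt Z (Fin.last l) u r = 0) ↔
      ∀ r, r ≠ Fin.last l → Z r = 0 :=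
    forall₂_congr fun r hr => by rw [shiftAt_of_ne _ hr]
  unfold startNoise
  simp only [e, shiftAt_self]
  split_ifs
  · exact h _
  · simp

lemma uniformOfFinset_powerset_apply (S R : Finset U) (h : S.powerset.Nonempty)
    [Decidable (R ⊆ S)] :
    PMF.uniformOfFinset S.powerset h R = if R ⊆ S then rate S.card else 0 := by
  rw [PMF.uniformOfFinset_apply]
  simp only [Finset.mem_powerset, Finset.card_powerset]
  congr 1
  simp [rate, ENNReal.inv_pow]

lemma phaseStep_apply_of_full [DecidableEq U] {k : ℕ} {g : PMF ℤ} {s : SampleState U l} (hs : s.Full k)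
    (S : Finset U) (Z : Fin (l + 1) → ℤ) (c c₀ J : ℕ) :
    phaseStep k g s ⟨S, Z, c, c₀, J⟩ =
      if s.clock = c ∧ c₀ = c ∧ J = s.phase + 1 ∧ S ⊆ s.keys then
        rate s.keys.card * startNoise l g Z else 0 := by
  rw [phaseStep, if_pos hs, PMF.bind_apply]
  simp only [uniformOfFinset_powerset_apply, PMF.map_apply, SampleState.mk.injEq, noiseLaw,
    Nat.add_eq_zero_iff, one_ne_zero, and_false, if_false]
  rw [tsum_eq_single S (fun R hR => by simp [hR.symm])]
  have h1 : (∑' z : ℤ, if S = S ∧ Z = Pi.single (Fin.last l) z ∧ c = s.clock ∧ c₀ = s.clock ∧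
      J = s.phase + 1 then g z else 0) =
      if c = s.clock ∧ c₀ = s.clock ∧ J = s.phase + 1 then startNoise l g Z else 0 := by
    by_cases hr : c = s.clock ∧ c₀ = s.clock ∧ J = s.phase + 1
    · simp only [hr, and_true, true_and, if_true]
      rw [tsum_eq_single (Z (Fin.last l))]
      · unfold startNoise
        congr 1
        rw [eq_iff_iff]
        constructor
        · intro h r hr; rw [h]; simp [hr]
        · intro h; funext r
          by_cases hr : r = Fin.last l
          · subst hr; simp
          · simp [hr, h r hr]
      · intro z hz
        rw [if_neg]
        intro h; apply hz; rw [h]; simp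
    · simp only [hr, and_false, if_false, tsum_zero]
  rw [h1]
  by_cases h2 : S ⊆ s.keys <;> by_cases h3 : s.clock = c ∧ c₀ = c ∧ J = s.phase + 1
  · obtain ⟨rfl, rfl, rfl⟩ := h3; simp [h2]
  · rw [if_pos h2, if_neg, if_neg, mul_zero]
    · tauto
    · rintro ⟨rfl, rfl, rfl⟩; tauto
  · simp [h2]
  · simp [h2]

open Classical in
/-- The weight of the states from which a new phase starts, by key set. -/
noncomputable def fullWeight (k : ℕ) (w : SampleState U l → ℝ≥0∞) (c J : ℕ) (S : Finset U) : ℝ≥0∞ :=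
  ∑' (c₀ : ℕ) (Z : Fin (l + 1) → ℤ),
    if (⟨S, Z, c, c₀, J⟩ : SampleState U l).Full k then w ⟨S, Z, c, c₀, J⟩ else 0

lemma pushWeight_phaseStep_succ [DecidableEq U] {k : ℕ} {g : PMF ℤ} (w : SampleState U l → ℝ≥0∞) {c J : ℕ}
    (hw : ∀ S Z, w ⟨S, Z, c, c, J + 1⟩ = 0) (S : Finset U) (Z : Fin (l + 1) → ℤ) :
    pushWeight w (phaseStep k g) ⟨S, Z, c, c, J + 1⟩ =
      startNoise l g Z * ∑' R, if S ⊆ R then rate R.card * fullWeight k w c J R else 0 := by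
  let ι : Finset U × ℕ × (Fin (l + 1) → ℤ) → SampleState U l := fun q => ⟨q.1, q.2.2, c, q.2.1, J⟩
  have hι : Function.Injective ι := by
    rintro ⟨a, b, d⟩ ⟨a', b', d'⟩ h
    simp only [ι, SampleState.mk.injEq, true_and, and_true] at h
    obtain ⟨rfl, rfl, rfl⟩ := h
    rfl
  have hnot : ∀ s : SampleState U l, ¬ s.Full k →
      w s * phaseStep k g s ⟨S, Z, c, c, J + 1⟩ = 0 := by
    intro s hs
    rw [phaseStep, if_neg hs, PMF.pure_apply]
    split_ifs with h
    · rw [← h, hw]; simp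
    · simp
  unfold pushWeight
  rw [← hι.tsum_eq]
  · simp only [ENNReal.tsum_prod', fullWeight]
    rw [← ENNReal.tsum_mul_left]
    refine tsum_congr fun R => ?_
    split_ifs with hR
    · simp only [← ENNReal.tsum_mul_left]
      refine tsum_congr fun c₀ => tsum_congr fun Y => ?_
      split_ifs with hF
      · rw [phaseStep_apply_of_full hF, if_pos ⟨rfl, rfl, rfl, hR⟩]
        ring
      · rw [hnot _ hF]; simp
    · rw [mul_zero]
      refine ENNReal.tsum_eq_zero.2 fun c₀ => ENNReal.tsum_eq_zero.2 fun Y => ?_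
      by_cases hF : (ι (R, c₀, Y)).Full k
      · rw [phaseStep_apply_of_full hF, if_neg, mul_zero]
        exact fun h => hR h.2.2.2
      · exact hnot _ hF
  · intro s hs
    have hF : s.Full k := by
      by_contra h; exact hs (hnot s h)
    have := right_ne_zero_of_mul hs
    rw [phaseStep_apply_of_full hF] at this
    have h2 : s.clock = c ∧ c = c ∧ J + 1 = s.phase + 1 ∧ S ⊆ s.keys := by
      by_contra h; exact this (if_neg h)
    refine ⟨(s.keys, s.start, s.noise), ?_⟩
    obtain ⟨h3, -, h4, -⟩ := h2
    ext1 <;> simp [ι, h3]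
    omega

lemma pushWeight_phaseStep_same [DecidableEq U] {k : ℕ} {g : PMF ℤ} (w : SampleState U l → ℝ≥0∞) {c c₀ J : ℕ}
    (hc : c₀ ≠ c) (S : Finset U) (Z : Fin (l + 1) → ℤ)
    [Decidable ((⟨S, Z, c, c₀, J⟩ : SampleState U l).Full k)] :
    pushWeight w (phaseStep k g) ⟨S, Z, c, c₀, J⟩ =
      if (⟨S, Z, c, c₀, J⟩ : SampleState U l).Full k then 0 else w ⟨S, Z, c, c₀, J⟩ := by
  unfold pushWeight
  rw [tsum_eq_single ⟨S, Z, c, c₀, J⟩]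
  · split_ifs with h
    · rw [phaseStep_apply_of_full h, if_neg (fun h => hc h.2.1), mul_zero]
    · simp [phaseStep, if_neg h]
  · intro s hs
    by_cases h : s.Full k
    · rw [phaseStep_apply_of_full h, if_neg (fun h => hc h.2.1), mul_zero]
    · simp [phaseStep, if_neg h, hs.symm]

variable [DecidableEq U]

/-- Halving the sampling rate preserves the conditional odds of each key, up to the factor `F`. -/
lemma halving_compare {F : ℝ≥0∞} (hF : 1 ≤ F) {x : U} {J : ℕ} {H : Finset U → ℝ≥0∞}
    (h : ∀ S, x ∉ S → (1 - rate J) * H (insert x S) ≤ F * (rate J * H S) ∧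
      rate J * H S ≤ F * ((1 - rate J) * H (insert x S))) (S : Finset U) (hS : x ∉ S) :
    (1 - rate (J + 1)) * (∑' R, if insert x S ⊆ R then rate R.card * H R else 0) ≤
      F * (rate (J + 1) * ∑' R, if S ⊆ R then rate R.card * H R else 0) ∧
    rate (J + 1) * (∑' R, if S ⊆ R then rate R.card * H R else 0) ≤
      F * ((1 - rate (J + 1)) * ∑' R, if insert x S ⊆ R then rate R.card * H R else 0) := by
  have hp : 1 - rate (J + 1) = (1 - rate J) + rate (J + 1) := by
    have h1 : rate (J + 1) + rate (J + 1) ≤ 1 := rate_succ J ▸ rate_le_one J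
    have h2 : rate (J + 1) ≤ 1 - rate (J + 1) :=
      ENNReal.le_sub_of_add_le_left (rate_ne_top _) h1
    rw [rate_succ J, ← tsub_tsub, tsub_add_cancel_of_le h2]
  have e1 : (∑' R, if insert x S ⊆ R then rate R.card * H R else 0) =
      ∑' R, if x ∈ R then 0 else if S ⊆ R then rate (R.card + 1) * H (insert x R) else 0 := by
    rw [tsum_finset_split x]
    refine tsum_congr fun R => ?_
    by_cases hx : x ∈ R
    · simp [hx]
    · have h1 : ¬ insert x S ⊆ R := fun h => hx (h (Finset.mem_insert_self x S))
      simp only [hx, h1, if_false, zero_add, Finset.insert_subset_insert_iff hS,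
        Finset.card_insert_of_notMem hx]
  have e2 : (∑' R, if S ⊆ R then rate R.card * H R else 0) =
      ∑' R, if x ∈ R then 0 else if S ⊆ R then
        rate R.card * H R + rate (R.card + 1) * H (insert x R) else 0 := by
    rw [tsum_finset_split x]
    refine tsum_congr fun R => ?_
    by_cases hx : x ∈ R
    · simp [hx]
    · simp only [hx, if_false, Finset.subset_insert_iff_of_notMem hS,
        Finset.card_insert_of_notMem hx]
      split_ifs <;> simp
  rw [e1, e2]
  simp only [← ENNReal.tsum_mul_left]
  constructor
  · refine ENNReal.tsum_le_tsum fun R => ?_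
    split_ifs with hx h1
    · simp
    · set a := rate (R.card + 1)
      have h2 := (h R hx).1
      rw [hp, rate_succ R.card]
      rw [rate_succ J] at h2
      calc _ = a * ((1 - (rate (J + 1) + rate (J + 1))) * H (insert x R))
            + 1 * (rate (J + 1) * a * H (insert x R)) := by rw [← rate_succ J]; ring
        _ ≤ a * (F * ((rate (J + 1) + rate (J + 1)) * H R)) +
            F * (rate (J + 1) * a * H (insert x R)) := by gcongr
        _ = _ := by ring
    · simp
  · refine ENNReal.tsum_le_tsum fun R => ?_
    split_ifs with hx h1
    · simp
    · set a := rate (R.card + 1)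
      have h2 := (h R hx).2
      rw [hp, rate_succ R.card]
      nth_rewrite 1 [rate_succ J] at h2
      calc _ = a * ((rate (J + 1) + rate (J + 1)) * H R)
            + 1 * (rate (J + 1) * a * H (insert x R)) := by ring
        _ ≤ a * (F * ((1 - rate J) * H (insert x R))) +
            F * (rate (J + 1) * a * H (insert x R)) := by gcongr
        _ = _ := by ring
    · simp

lemma fullWeight_compare {F : ℝ≥0∞} {k : ℕ} {w : SampleState U l → ℝ≥0∞} {x : U} {c J : ℕ}
    (h : ∀ c₀, ∃ j, Hidden F w x c c₀ J j) (S : Finset U) (hS : x ∉ S) :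
    (1 - rate J) * fullWeight k w c J (insert x S) ≤ F * (rate J * fullWeight k w c J S) ∧
      rate J * fullWeight k w c J S ≤ F * ((1 - rate J) * fullWeight k w c J (insert x S)) := by
  classical
  simp only [fullWeight, ← ENNReal.tsum_mul_left]
  constructor
  · refine ENNReal.tsum_le_tsum fun c₀ => ?_
    obtain ⟨j, hj⟩ := h c₀
    rw [← tsum_shiftAt j 1 (fun Z => F * (rate J * _))]
    refine ENNReal.tsum_le_tsum fun Z => ?_
    have hf : (⟨insert x S, Z, c, c₀, J⟩ : SampleState U l).Full k ↔
        (⟨S, shiftAt Z j 1, c, c₀, J⟩ : SampleState U l).Full k := by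
      simp only [SampleState.Full, noisyCard_insert_eq hS Z c c₀ J j]
    simp only [hf]
    split_ifs
    · exact (hj S hS Z).1
    · simp
  · refine ENNReal.tsum_le_tsum fun c₀ => ?_
    obtain ⟨j, hj⟩ := h c₀
    rw [← tsum_shiftAt j (-1) (fun Z => F * ((1 - rate J) * _))]
    refine ENNReal.tsum_le_tsum fun Z => ?_
    have hf : (⟨insert x S, shiftAt Z j (-1), c, c₀, J⟩ : SampleState U l).Full k ↔
        (⟨S, Z, c, c₀, J⟩ : SampleState U l).Full k := by
      simp only [SampleState.Full, noisyCard_insert_eq' hS Z c c₀ J j]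
    simp only [hf]
    split_ifs
    · exact (hj S hS Z).2
    · simp

/-- At the beginning of a phase all keys are hidden by the same noise. -/
lemma hidden_phaseStep_succ {E F : ℝ≥0∞} (hF : 1 ≤ F) {k : ℕ} {g : PMF ℤ} (hg : ShiftBound E g)
    {w : SampleState U l → ℝ≥0∞} {x : U} {c J : ℕ} (hw : ∀ S Z, w ⟨S, Z, c, c, J + 1⟩ = 0)
    (h : ∀ c₀, ∃ j, Hidden F w x c c₀ J j) :
    Hidden (E * F) (pushWeight w (phaseStep k g)) x c c (J + 1) (Fin.last l) := by
  intro S hS Z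
  simp only [pushWeight_phaseStep_succ w hw]
  obtain ⟨h1, h2⟩ := halving_compare hF (fullWeight_compare (k := k) h) S hS
  constructor
  · calc _ = startNoise l g Z * _ := mul_left_comm _ _ _
      _ ≤ E * startNoise l g (shiftAt Z (Fin.last l) 1) * _ := mul_le_mul' (startNoise_le hg.1 Z) h1
      _ = _ := by ring
  · calc _ = startNoise l g Z * _ := mul_left_comm _ _ _
      _ ≤ E * startNoise l g (shiftAt Z (Fin.last l) (-1)) * _ := mul_le_mul' (startNoise_le hg.2 Z) h2
      _ = _ := by ring

/-! ### Privacy throughout the interaction -/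

lemma pushWeight_insert (k : ℕ) (g : PMF ℤ) (w : SampleState U l → ℝ≥0∞) (y : U) :
    pushWeight w (fun s => sampleUpdate k g s (.insert y)) =
      pushWeight (pushWeight (pushWeight w (phaseStep k g)) (sampleStep y)) (noiseStep g) := by
  simp only [sampleUpdate]
  rw [pushWeight_bind w (phaseStep k g) (fun s₁ => (sampleStep y s₁).bind (noiseStep g)),
    pushWeight_bind]

/-- Each active key is hidden, by the noise of an open node. The factor accounts for one unit shift
per phase and, within the tree, one per level. -/
def AllHidden (E : ℝ≥0∞) (τ : Transcript U) (w : SampleState U l → ℝ≥0∞) : Prop :=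
  ∀ x ∈ τ.current, ∀ c₀ J, ∃ j : Fin (l + 1), NodeOpen l j τ.insertions ∧
    Hidden (E ^ (j + 1 + J : ℕ)) w x τ.insertions c₀ J j

/-- The insertion of another key keeps `x` hidden: the node whose noise hides `x` stays open, or is
absorbed by the node of higher level that the insertion opens, or a new phase begins. -/
lemma hidden_insert_other {E : ℝ≥0∞} (hE : 1 ≤ E) {k : ℕ} {g : PMF ℤ} (hg : ShiftBound E g)
    {w : SampleState U l → ℝ≥0∞} {x y : U} (hxy : x ≠ y) {c c₀ J : ℕ}
    (hw : ∀ S Z J, w ⟨S, Z, c, c, J + 1⟩ = 0) (hJ : J ≠ 0) (hc : c + 1 < 2 ^ l)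
    (h : ∀ c₀ J, ∃ j : Fin (l + 1), NodeOpen l j c ∧ Hidden (E ^ (j + 1 + J : ℕ)) w x c c₀ J j) :
    ∃ j : Fin (l + 1), NodeOpen l j (c + 1) ∧ Hidden (E ^ (j + 1 + J : ℕ))
      (pushWeight w (fun s => sampleUpdate k g s (.insert y))) x (c + 1) c₀ J j := by
  rw [pushWeight_insert]
  obtain ⟨J, rfl⟩ := Nat.exists_eq_succ_of_ne_zero hJ
  have hv := padicValNat_two_lt (l := l) (Nat.succ_le_succ (Nat.zero_le c)) hc
  have hv' : ((nodeLevel l (c + 1) : Fin (l + 1)) : ℕ) = padicValNat 2 (c + 1) := by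
    simp only [nodeLevel]; exact min_eq_left hv.le
  -- the situation after the check for a new phase
  obtain ⟨j, hj, hH⟩ : ∃ j : Fin (l + 1), NodeOpen l j c ∧
      Hidden (E ^ (j + 1 + (J + 1) : ℕ)) (pushWeight w (phaseStep k g)) x c c₀ (J + 1) j := by
    by_cases hcc : c₀ = c
    · subst hcc
      refine ⟨Fin.last l, Or.inl rfl, ?_⟩
      have := hidden_phaseStep_succ (F := E ^ (l + 1 + J)) (one_le_pow₀ hE) (k := k) hg
        (fun S Z => hw S Z J)
        (fun c₁ => by
          obtain ⟨j, -, hj⟩ := h c₁ J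
          exact ⟨j, hj.mono (pow_le_pow_right₀ hE (by omega))⟩)
      rw [← pow_succ'] at this
      exact this
    · obtain ⟨j, hj, hH⟩ := h c₀ (J + 1)
      refine ⟨j, hj, ?_⟩
      classical
      refine hH.restrict (fun m => if J + 1 < l ∧ (k : ℤ) < m then 0 else 1) fun S Z => ?_
      rw [pushWeight_phaseStep_same w hcc]
      by_cases hf : (⟨S, Z, c, c₀, J + 1⟩ : SampleState U l).Full k
      · have hf' : J + 1 < l ∧ (k : ℤ) < (⟨S, Z, c, c₀, J + 1⟩ : SampleState U l).noisyCard := hf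
        rw [if_pos hf, if_pos hf', zero_mul]
      · have hf' : ¬ (J + 1 < l ∧ (k : ℤ) < (⟨S, Z, c, c₀, J + 1⟩ : SampleState U l).noisyCard) := hf
        rw [if_neg hf, if_neg hf', one_mul]
  have hH2 := hH.sampleStep hxy
  have hcase : nodeLevel l (c + 1) < j ∧ NodeOpen l j (c + 1) ∨
      j < nodeLevel l (c + 1) := by
    simp only [Fin.lt_def, hv']
    rcases hj with hj | ⟨d, hd1, hd2, hd3, hd4⟩
    · left; exact ⟨by rw [hj]; exact hv, Or.inl hj⟩
    · rcases dyadic_level_step hd1 hd3 hd2 hd4 with ⟨h1, h2⟩ | h1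
      · left; exact ⟨h2, Or.inr ⟨d, hd1, by omega, hd3, h1⟩⟩
      · right; exact h1
  rcases hcase with ⟨h1, h2⟩ | h1
  · exact ⟨j, h2, hH2.noiseStep hg (Nat.succ_ne_zero J) (Or.inl ⟨h1, rfl, rfl⟩)⟩
  · refine ⟨nodeLevel l (c + 1), Or.inr ⟨c + 1, by omega, le_rfl, hv'.symm, by simp⟩, ?_⟩
    refine (hH2.noiseStep hg (Nat.succ_ne_zero J) (Or.inr ⟨h1, rfl, rfl⟩)).mono ?_
    rw [← pow_succ]
    refine pow_le_pow_right₀ hE ?_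
    have : (j : ℕ) < (nodeLevel l (c + 1) : Fin (l + 1)) := h1
    omega

/-- The published estimate is a function of the phase and of the noisy sample size, so conditioning on
it preserves the comparison, for every adversary. -/
lemma allHidden_sampleRun {E : ℝ≥0∞} (hE : 1 ≤ E) {k : ℕ} {g : PMF ℤ} (hg : ShiftBound E g)
    (adv : Adversary U) (n : ℕ) (τ : Transcript U) (hτ : τ.insertions < 2 ^ l) :
    AllHidden E τ (fun s : SampleState U l => sampleRun l k g adv n (τ, s)) := by
  classical
  induction n generalizing τ with
  | zero =>
    intro x hx c₀ J
    refine ⟨Fin.last l, Or.inl rfl, fun S hS Z => ?_⟩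
    have h0 : ∀ s : SampleState U l, sampleRun l k g adv 0 (τ, s) = 0 := by
      intro s
      simp only [sampleRun, interact, PMF.pure_apply]
      rw [if_neg]
      rintro h
      simp only [Prod.mk.injEq] at h
      rw [h.1] at hx
      simp at hx
    simp [h0]
  | succ n ih =>
    intro x hx c₀ J
    rcases List.eq_nil_or_concat' τ with rfl | ⟨τ, ⟨o, y⟩, rfl⟩
    · simp at hx
    have hcons : ∀ m (τ : Transcript U) (s : SampleState U l), sampleRun l k g adv m (τ, s) ≠ 0 →
        Consistent τ s := fun m τ s h => consistent_of_mem_support ((PMF.mem_support_iff _ _).2 h)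
    -- at sampling rate one, all active keys are sampled
    rcases Nat.eq_zero_or_pos J with rfl | hJ
    · refine ⟨Fin.last l, Or.inl rfl, fun S hS Z => ?_⟩
      constructor
      · simp
      · have : sampleRun l k g adv (n + 1) (τ ++ [(o, y)], ⟨S, Z, Transcript.insertions (τ ++ [(o, y)]), c₀, 0⟩) = 0 := by
          by_contra h
          have h1 : S = _ := ((hcons _ _ _ h).exact_of_zero rfl).1
          rw [h1] at hS
          exact hS hx
        simp [this]
    · have hle := Transcript.insertions_le_append τ o y
      have hAll := ih τ (hle.trans_lt hτ)
      suffices hmain : ∃ j : Fin (l + 1), NodeOpen l j (Transcript.insertions (τ ++ [(o, y)])) ∧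
          Hidden (E ^ (j + 1 + J : ℕ)) (pushWeight (fun s => sampleRun l k g adv n (τ, s))
            (fun s => sampleUpdate k g s o)) x (Transcript.insertions (τ ++ [(o, y)])) c₀ J j by
        obtain ⟨j, hj, hH⟩ := hmain
        refine ⟨j, hj, ?_⟩
        refine hH.restrict (fun m => if y = 2 ^ J * (m : ℝ) then adv τ o else 0) fun S Z => ?_
        rw [sampleRun, interact_succ_apply]
        by_cases hy : y = (⟨S, Z, Transcript.insertions (τ ++ [(o, y)]), c₀, J⟩ :
            SampleState U l).estimate
        · have hy' : y = 2 ^ J * ((⟨S, Z, Transcript.insertions (τ ++ [(o, y)]), c₀, J⟩ :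
              SampleState U l).noisyCard : ℝ) := hy
          rw [if_pos hy, if_pos hy']; rfl
        · have hy' : ¬ y = 2 ^ J * ((⟨S, Z, Transcript.insertions (τ ++ [(o, y)]), c₀, J⟩ :
              SampleState U l).noisyCard : ℝ) := hy
          rw [if_neg hy, if_neg hy', zero_mul]
      cases o with
      | delete y =>
        simp only [Transcript.current_append, Op.apply, Finset.mem_erase] at hx
        obtain ⟨j, hj, hH⟩ := hAll x hx.2 c₀ J
        rw [Transcript.insertions_append_delete]
        exact ⟨j, hj, hH.delete hx.1 k g⟩
      | insert y =>
        rw [Transcript.insertions_append_insert] at hτ ⊢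
        by_cases hxy : x = y
        · subst hxy
          have hv := padicValNat_two_lt (l := l) (Nat.succ_le_succ (Nat.zero_le (Transcript.insertions τ))) hτ
          have hv' : ((nodeLevel l (Transcript.insertions τ + 1) : Fin (l + 1)) : ℕ) =
              padicValNat 2 (Transcript.insertions τ + 1) := by
            simp only [nodeLevel]; exact min_eq_left hv.le
          refine ⟨nodeLevel l (Transcript.insertions τ + 1),
            Or.inr ⟨Transcript.insertions τ + 1, by omega, le_rfl, hv'.symm, by simp⟩, ?_⟩
          rw [pushWeight_insert]
          refine (hidden_new hg _ x hJ.ne').mono ?_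
          exact le_self_pow₀ hE (by omega)
        · simp only [Transcript.current_append, Op.apply, Finset.mem_insert, hxy, false_or] at hx
          refine hidden_insert_other hE hg hxy ?_ hJ.ne' hτ (hAll x hx)
          -- after the insertion that began the current phase, the clock exceeds the start of the phase
          intro S Z J
          by_contra h
          have := (hcons _ _ _ h).start_lt (Nat.succ_ne_zero J)
          exact absurd this (lt_irrefl _)

end NewPhase

/-! ### Concentration of the sample size given the transcript -/

/-- The sample size deviates from its mean by at most a fraction `θ` of the mean plus `k`. -/
def SampleAccurate {U : Type*} [DecidableEq U] {l : ℕ} (θ : ℝ) (k : ℕ) (τ : Transcript U)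
    (s : SampleState U l) : Prop :=
  |(s.keys.card : ℝ) - (2 ^ s.phase)⁻¹ * τ.current.card| ≤
    θ * ((2 ^ s.phase)⁻¹ * τ.current.card + k)

section Posterior
variable {U : Type*} {l : ℕ}

/-- States as tuples, the public components first. -/
def sampleStateEquiv (U : Type*) (l : ℕ) :
    SampleState U l ≃ (ℕ × ℕ × ℕ) × Finset U × (Fin (l + 1) → ℤ) where
  toFun s := ((s.clock, s.start, s.phase), s.keys, s.noise)
  invFun q := ⟨q.2.1, q.2.2, q.1.1, q.1.2.1, q.1.2.2⟩
  left_inv _ := rfl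
  right_inv _ := rfl

lemma tsum_sampleState (f : SampleState U l → ℝ≥0∞) :
    ∑' s, f s = ∑' (q : ℕ × ℕ × ℕ) (S : Finset U) (Z : Fin (l + 1) → ℤ),
      f ⟨S, Z, q.1, q.2.1, q.2.2⟩ := by
  rw [← (sampleStateEquiv U l).symm.tsum_eq, ENNReal.tsum_prod']
  refine tsum_congr fun q => ?_
  rw [ENNReal.tsum_prod']
  rfl

variable [DecidableEq U]

open Classical in
/-- Given any transcript, the sample size is concentrated as if the keys were sampled independently
of the adversary: the published estimates hide the sampling decisions of the active keys. -/
lemma tsum_not_sampleAccurate_le {E : ℝ≥0∞} (hE : 1 ≤ E) {k : ℕ} {g : PMF ℤ} (hg : ShiftBound E g)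
    {θ : ℝ} (hθ0 : 0 < θ) (hθ1 : θ ≤ 1) (hEθ : E ^ (2 * l + 1) ≤ ENNReal.ofReal (Real.exp (θ / 4)))
    (adv : Adversary U) (n : ℕ) (τ : Transcript U) (hτ : τ.insertions < 2 ^ l) :
    ∑' s : SampleState U l, (if SampleAccurate θ k τ s then 0 else sampleRun l k g adv n (τ, s)) ≤
      ENNReal.ofReal (2 * Real.exp (-(θ ^ 2 * k / 4))) *
        ∑' s : SampleState U l, sampleRun l k g adv n (τ, s) := by
  set w : SampleState U l → ℝ≥0∞ := fun s => sampleRun l k g adv n (τ, s) with hw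
  have hcons : ∀ s : SampleState U l, w s ≠ 0 → Consistent τ s :=
    fun s h => consistent_of_mem_support (z := (τ, s)) ((PMF.mem_support_iff _ _).2 h)
  have hwtop : ∑' s, w s ≠ ∞ := by
    refine ne_top_of_le_ne_top (PMF.tsum_coe_ne_top (sampleRun l k g adv n)) ?_
    exact ENNReal.tsum_comp_le_tsum_of_injective (fun a b h => (Prod.mk.inj h).2) _
  rw [tsum_sampleState, tsum_sampleState w, ← ENNReal.tsum_mul_left]
  refine ENNReal.tsum_le_tsum fun q => ?_
  obtain ⟨c, c₀, J⟩ := q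
  simp only
  by_cases hq : c = τ.insertions ∧ J ≤ l
  swap
  · have h0 : ∀ S Z, w ⟨S, Z, c, c₀, J⟩ = 0 := by
      intro S Z; by_contra h
      exact hq ⟨(hcons _ h).clock_eq, (hcons _ h).phase_le⟩
    simp only [hw] at h0
    simp [h0]
  obtain ⟨rfl, hJ⟩ := hq
  set ν : Finset U → ℝ≥0∞ := fun S => ∑' Z, w ⟨S, Z, τ.insertions, c₀, J⟩ with hν
  have hνtop : ∀ S, ν S ≠ ∞ := by
    intro S
    refine ne_top_of_le_ne_top hwtop ?_
    exact ENNReal.tsum_comp_le_tsum_of_injective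
      (f := fun Z => (⟨S, Z, τ.insertions, c₀, J⟩ : SampleState U l))
      (fun a b h => congrArg SampleState.noise h) w
  have hν0 : ∀ S, S ∉ τ.current.powerset → ν S = 0 := by
    intro S hS
    refine ENNReal.tsum_eq_zero.2 fun Z => ?_
    by_contra h
    exact hS (Finset.mem_powerset.2 (hcons _ h).keys_subset)
  set p : ℝ := (2 ^ J)⁻¹ with hp
  have hp0 : 0 ≤ p := by positivity
  have hp1 : p ≤ 1 := inv_le_one_of_one_le₀ (one_le_pow₀ (by norm_num))
  have hF1 : (1 : ℝ) ≤ Real.exp (θ / 4) := Real.one_le_exp (by positivity)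
  have hF0 := Real.exp_pos (θ / 4)
  have hrate : (1 - rate J).toReal = 1 - p := by
    rw [ENNReal.toReal_sub_of_le (rate_le_one J) ENNReal.one_ne_top, rate_toReal]; simp [hp]
  have hodds : ∀ x ∈ τ.current, ∀ S, x ∉ S →
      (1 - p) * (ν (insert x S)).toReal ≤ Real.exp (θ / 4) * (p * (ν S).toReal) ∧
      p * (ν S).toReal ≤ Real.exp (θ / 4) * ((1 - p) * (ν (insert x S)).toReal) := by
    intro x hx S hS
    obtain ⟨j, -, hj⟩ := allHidden_sampleRun hE hg (k := k) adv n τ hτ x hx c₀ J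
    have hj' := hj.mono (F' := ENNReal.ofReal (Real.exp (θ / 4)))
      ((pow_le_pow_right₀ hE (by omega)).trans hEθ)
    have hr : rate J ≠ ∞ := rate_ne_top J
    have hr' : 1 - rate J ≠ ∞ := ne_top_of_le_ne_top ENNReal.one_ne_top tsub_le_self
    have h1 : (1 - rate J) * ν (insert x S) ≤ ENNReal.ofReal (Real.exp (θ / 4)) * (rate J * ν S) := by
      simp only [hν]
      rw [← tsum_shiftAt j 1 (fun Z => w ⟨S, Z, τ.insertions, c₀, J⟩)]
      simp only [← ENNReal.tsum_mul_left]
      exact ENNReal.tsum_le_tsum fun Z => (hj' S hS Z).1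
    have h2 : rate J * ν S ≤ ENNReal.ofReal (Real.exp (θ / 4)) * ((1 - rate J) * ν (insert x S)) := by
      simp only [hν]
      rw [← tsum_shiftAt j (-1) (fun Z => w ⟨insert x S, Z, τ.insertions, c₀, J⟩)]
      simp only [← ENNReal.tsum_mul_left]
      exact ENNReal.tsum_le_tsum fun Z => (hj' S hS Z).2
    have h1' := ENNReal.toReal_mono (ENNReal.mul_ne_top ENNReal.ofReal_ne_top
      (ENNReal.mul_ne_top hr (hνtop S))) h1
    have h2' := ENNReal.toReal_mono (ENNReal.mul_ne_top ENNReal.ofReal_ne_top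
      (ENNReal.mul_ne_top hr' (hνtop (insert x S)))) h2
    simp only [ENNReal.toReal_mul, hrate, rate_toReal, ENNReal.toReal_ofReal hF0.le, ← hp] at h1' h2'
    exact ⟨h1', h2'⟩
  have key := sum_powerset_deviation_le τ.current (fun S => (ν S).toReal)
    (fun S => ENNReal.toReal_nonneg) (k := k) hp0 hp1 hF1 le_rfl hθ0 hθ1
    (fun x hx S hS => by
      have h1 := (hodds x hx S hS).1
      have h2 : 0 ≤ (ν (insert x S)).toReal := ENNReal.toReal_nonneg
      nlinarith [mul_nonneg (sub_nonneg.2 hF1) (mul_nonneg hp0 h2)])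
    (fun x hx S hS => by
      have h1 := (hodds x hx S hS).2
      have h2 : 0 ≤ (ν (insert x S)).toReal := ENNReal.toReal_nonneg
      nlinarith [mul_nonneg (sub_nonneg.2 hF1) (mul_nonneg hp0 h2)])
  have hacc : ∀ S Z, SampleAccurate θ k τ (⟨S, Z, τ.insertions, c₀, J⟩ : SampleState U l) ↔
      ¬ θ * (p * τ.current.card + k) < |(S.card : ℝ) - p * τ.current.card| := by
    intro S Z
    rw [SampleAccurate, not_lt]
  have hL : (∑' S, ∑' Z, if SampleAccurate θ k τ (⟨S, Z, τ.insertions, c₀, J⟩ : SampleState U l) then 0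
      else w ⟨S, Z, τ.insertions, c₀, J⟩) = ENNReal.ofReal (∑ S ∈ τ.current.powerset,
        (if θ * (p * τ.current.card + k) < |(S.card : ℝ) - p * τ.current.card| then (ν S).toReal else 0)) := by
    rw [ENNReal.ofReal_sum_of_nonneg (fun S _ => by split_ifs <;> simp), tsum_eq_sum]
    · refine Finset.sum_congr rfl fun S _ => ?_
      simp only [hacc, ite_not]
      split_ifs
      · rw [ENNReal.ofReal_toReal (hνtop S)]
      · simp
    · intro S hS
      refine ENNReal.tsum_eq_zero.2 fun Z => ?_
      have := ENNReal.tsum_eq_zero.1 (hν0 S hS) Z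
      simp [this]
  have hR : ∑' S, ∑' Z, w ⟨S, Z, τ.insertions, c₀, J⟩ =
      ENNReal.ofReal (∑ S ∈ τ.current.powerset, (ν S).toReal) := by
    rw [ENNReal.ofReal_sum_of_nonneg (fun S _ => ENNReal.toReal_nonneg), tsum_eq_sum (hf := hν0)]
    exact Finset.sum_congr rfl fun S _ => (ENNReal.ofReal_toReal (hνtop S)).symm
  rw [hL, hR, ← ENNReal.ofReal_mul (by positivity)]
  exact ENNReal.ofReal_le_ofReal key

end Posterior

/-! ### Magnitude of the noise -/

/-- The total magnitude of the noise in use. -/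
def SampleState.noiseSize {U : Type*} {l : ℕ} (s : SampleState U l) : ℕ := ∑ r, (s.noise r).natAbs

/-- An upper bound, at time `c`, for the expectation of `ρ ^ |Z|` at a later time `t`, where `|Z|` is
the magnitude of the noise: a node that is in use at time `t` contributes its exact value if it is
open already at time `c`, and the bound `2` for its exponential moment otherwise. -/
noncomputable def nodePotential {l : ℕ} (ρ : ℝ≥0∞) (t : ℕ) (Z : Fin (l + 1) → ℤ) (c : ℕ) : ℝ≥0∞ :=
  ∏ r : Fin (l + 1), if t / 2 ^ (r : ℕ) * 2 ^ (r : ℕ) ≤ c then ρ ^ (Z r).natAbs else 2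

section Potential
variable {l : ℕ} {ρ : ℝ≥0∞} {g : PMF ℤ}

lemma tsum_noiseLaw_mul_le (hg : ∑' z, g z * ρ ^ z.natAbs ≤ 2) (J : ℕ) :
    ∑' z, noiseLaw g J z * ρ ^ z.natAbs ≤ 2 := by
  unfold noiseLaw
  split_ifs
  · rw [PMF.tsum_pure_mul]; simp
  · exact hg

/-- Opening a node does not increase the potential on average. -/
lemma tsum_nodePotential_refresh_le (hρ : 1 ≤ ρ) (hg : ∑' z, g z * ρ ^ z.natAbs ≤ 2) (J : ℕ)
    {t c : ℕ} (ht : c + 1 ≤ t) (hc : c + 1 < 2 ^ l) (Z : Fin (l + 1) → ℤ) :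
    ∑' z, noiseLaw g J z * nodePotential ρ t (refresh (nodeLevel l (c + 1)) Z z) (c + 1) ≤
      nodePotential ρ t Z c := by
  set v := nodeLevel l (c + 1) with hv
  have hv' : (v : ℕ) = padicValNat 2 (c + 1) := by
    simp only [hv, nodeLevel]; exact min_eq_left (padicValNat_two_lt (by omega) hc).le
  set φ : Fin (l + 1) → ℝ≥0∞ := fun r =>
    if t / 2 ^ (r : ℕ) * 2 ^ (r : ℕ) ≤ c then ρ ^ (Z r).natAbs else 2 with hφ
  have hφv : φ v = 2 := by
    simp only [hφ]
    rw [if_neg]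
    rw [hv', not_le]
    exact lt_dyadic_start ht
  have hother : ∀ z, ∀ r ∈ Finset.univ.erase v,
      (if t / 2 ^ (r : ℕ) * 2 ^ (r : ℕ) ≤ c + 1 then ρ ^ (refresh v Z z r).natAbs else 2) ≤ φ r := by
    intro z r hr
    have hrv : r ≠ v := (Finset.mem_erase.1 hr).1
    rcases lt_or_gt_of_ne hrv with h | h
    · have h0 : refresh v Z z r = 0 := by simp [refresh, h]
      rw [h0]
      simp only [hφ, Int.natAbs_zero, pow_zero]
      split_ifs with h1 h2 h2
      · exact one_le_pow₀ hρ
      · exact one_le_two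
      · omega
      · exact le_rfl
    · have h0 : refresh v Z z r = Z r := by simp [refresh, h.not_gt, h.ne']
      rw [h0]
      simp only [hφ]
      split_ifs with h1 h2 h2
      · exact le_rfl
      · have h3 : t / 2 ^ (r : ℕ) * 2 ^ (r : ℕ) = c + 1 := by omega
        have h4 : 2 ^ (r : ℕ) ∣ c + 1 := h3 ▸ Dvd.intro_left _ rfl
        rw [two_pow_dvd_iff_le (by omega), ← hv'] at h4
        exact absurd h4 (not_le.2 h)
      · omega
      · exact le_rfl
  have hself : ∀ z, (if t / 2 ^ (v : ℕ) * 2 ^ (v : ℕ) ≤ c + 1 then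
      ρ ^ (refresh v Z z v).natAbs else 2) ≤
      if t / 2 ^ (v : ℕ) * 2 ^ (v : ℕ) ≤ c + 1 then ρ ^ z.natAbs else 2 := by
    intro z
    simp [refresh]
  calc _ ≤ ∑' z, noiseLaw g J z * ((if t / 2 ^ (v : ℕ) * 2 ^ (v : ℕ) ≤ c + 1 then ρ ^ z.natAbs else 2) *
        ∏ r ∈ Finset.univ.erase v, φ r) := by
        refine ENNReal.tsum_le_tsum fun z => ?_
        rw [nodePotential, ← Finset.mul_prod_erase _ _ (Finset.mem_univ v)]
        exact mul_le_mul_right (mul_le_mul' (hself z) (Finset.prod_le_prod' (hother z))) _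
    _ = (∑' z, noiseLaw g J z * (if t / 2 ^ (v : ℕ) * 2 ^ (v : ℕ) ≤ c + 1 then ρ ^ z.natAbs else 2)) *
        ∏ r ∈ Finset.univ.erase v, φ r := by
        rw [← ENNReal.tsum_mul_right]
        simp only [mul_assoc]
    _ ≤ 2 * ∏ r ∈ Finset.univ.erase v, φ r := by
        gcongr
        split_ifs
        · exact tsum_noiseLaw_mul_le hg J
        · exact PMF.tsum_mul_le _ fun _ _ => le_rfl
    _ = nodePotential ρ t Z c := by
        rw [← hφv, Finset.mul_prod_erase _ _ (Finset.mem_univ v)]; rfl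

lemma nodePotential_single_le {t : ℕ} (ht : t < 2 ^ l) (z : ℤ) (c : ℕ) :
    nodePotential ρ t (Pi.single (Fin.last l) z) c ≤ ρ ^ z.natAbs * 2 ^ l := by
  rw [nodePotential, Fin.prod_univ_castSucc, mul_comm]
  have h1 : t / 2 ^ l = 0 := Nat.div_eq_of_lt ht
  refine mul_le_mul' ?_ ?_
  · simp [h1]
  · refine (Finset.prod_le_pow_card _ _ 2 fun r _ => ?_).trans (by simp)
    have : (Pi.single (Fin.last l) z : Fin (l + 1) → ℤ) r.castSucc = 0 :=
      by simp [(Fin.castSucc_lt_last r).ne]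
    rw [this]
    split_ifs
    · simp
    · exact le_rfl

variable {U : Type*}

/-- The potential of a state with respect to time `t`. The second term pays for the noise of phases
that may begin before time `t`. -/
noncomputable def statePotential (ρ : ℝ≥0∞) (t : ℕ) (s : SampleState U l) : ℝ≥0∞ :=
  nodePotential ρ t s.noise s.clock + 2 ^ (l + 1) * ((l - s.phase : ℕ) : ℝ≥0∞)

lemma tsum_phaseStep_mul_statePotential_le (hg : ∑' z, g z * ρ ^ z.natAbs ≤ 2) (k : ℕ) {t : ℕ}
    (ht : t < 2 ^ l) (s : SampleState U l) :
    ∑' s₁, phaseStep k g s s₁ * statePotential ρ t s₁ ≤ statePotential ρ t s := by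
  unfold phaseStep
  split_ifs with h
  · rw [PMF.tsum_bind_mul]
    refine PMF.tsum_mul_le _ fun R _ => ?_
    rw [PMF.tsum_map_mul]
    have h1 : l - s.phase = (l - (s.phase + 1)) + 1 := by have := h.1; omega
    calc _ ≤ ∑' z, (noiseLaw g (s.phase + 1) z * ρ ^ z.natAbs * 2 ^ l +
          noiseLaw g (s.phase + 1) z * (2 ^ (l + 1) * ((l - (s.phase + 1) : ℕ) : ℝ≥0∞))) := by
          refine ENNReal.tsum_le_tsum fun z => ?_
          rw [statePotential, mul_add, mul_assoc]
          gcongr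
          exact nodePotential_single_le ht z _
      _ ≤ 2 * 2 ^ l + 2 ^ (l + 1) * ((l - (s.phase + 1) : ℕ) : ℝ≥0∞) := by
          rw [ENNReal.tsum_add, ENNReal.tsum_mul_right]
          gcongr
          · exact tsum_noiseLaw_mul_le hg _
          · exact PMF.tsum_mul_le _ fun _ _ => le_rfl
      _ = 2 ^ (l + 1) * ((l - s.phase : ℕ) : ℝ≥0∞) := by
          rw [h1]; push_cast; ring
      _ ≤ _ := le_add_self
  · rw [PMF.tsum_pure_mul]

/-- The expected number of later insertions, up to time `T`, after which the magnitude of the noise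
exceeds `m`, is at most this. -/
noncomputable def noisePotential (ρ : ℝ≥0∞) (m T : ℕ) (s : SampleState U l) : ℝ≥0∞ :=
  ∑ t ∈ Finset.Ioc s.clock T, (ρ ^ (m + 1))⁻¹ * statePotential ρ t s

lemma one_le_statePotential (hρ : 1 ≤ ρ) (hρt : ρ ≠ ∞) {m : ℕ} {s : SampleState U l} (h : m < s.noiseSize) :
    1 ≤ (ρ ^ (m + 1))⁻¹ * statePotential ρ s.clock s := by
  have h1 : nodePotential ρ s.clock s.noise s.clock = ρ ^ s.noiseSize := by
    rw [nodePotential, SampleState.noiseSize, ← Finset.prod_pow_eq_pow_sum]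
    refine Finset.prod_congr rfl fun r _ => if_pos (Nat.div_mul_le_self _ _)
  have h2 : ρ ^ (m + 1) ≤ statePotential ρ s.clock s := by
    rw [statePotential, h1]
    exact (pow_le_pow_right₀ hρ h).trans le_self_add
  have h0 : ρ ^ (m + 1) ≠ 0 := pow_ne_zero _ (zero_lt_one.trans_le hρ).ne'
  calc (1 : ℝ≥0∞) = (ρ ^ (m + 1))⁻¹ * ρ ^ (m + 1) := (ENNReal.inv_mul_cancel h0 (ENNReal.pow_ne_top hρt)).symm
    _ ≤ _ := mul_le_mul_right h2 _

lemma noisePotential_empty_le (m T : ℕ) (hT : T < 2 ^ l) :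
    noisePotential ρ m T (SampleState.empty : SampleState U l) ≤
      (ρ ^ (m + 1))⁻¹ * (T * (2 ^ (l + 1) * (l + 1))) := by
  have h : ∀ t ∈ Finset.Ioc 0 T, (ρ ^ (m + 1))⁻¹ *
      statePotential ρ t (SampleState.empty : SampleState U l) ≤
      (ρ ^ (m + 1))⁻¹ * (2 ^ (l + 1) * (l + 1)) := by
    intro t ht
    refine mul_le_mul_right ?_ _
    rw [statePotential]
    have h1 := nodePotential_single_le (ρ := ρ) (l := l) (t := t)
      (by have := (Finset.mem_Ioc.1 ht).2; omega) 0 0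
    simp only [Pi.single_zero, Int.natAbs_zero, pow_zero, one_mul] at h1
    calc _ ≤ (2 : ℝ≥0∞) ^ l + 2 ^ (l + 1) * (l : ℝ≥0∞) := add_le_add h1 le_rfl
      _ ≤ 2 ^ (l + 1) + 2 ^ (l + 1) * (l : ℝ≥0∞) := by
          gcongr
          · exact one_le_two
          · omega
      _ = _ := by ring
  refine (Finset.sum_le_sum h).trans_eq ?_
  simp
  ring

variable [DecidableEq U]

lemma tsum_insert_mul_statePotential_le (hρ : 1 ≤ ρ) (hg : ∑' z, g z * ρ ^ z.natAbs ≤ 2) (k : ℕ)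
    {t : ℕ} (ht : t < 2 ^ l) (s : SampleState U l) (hs : s.clock + 1 ≤ t) (x : U) :
    ∑' s', sampleUpdate k g s (.insert x) s' * statePotential ρ t s' ≤ statePotential ρ t s := by
  refine le_trans ?_ (tsum_phaseStep_mul_statePotential_le hg k ht s)
  rw [sampleUpdate, PMF.tsum_bind_mul]
  refine ENNReal.tsum_le_tsum fun s₁ => ?_
  by_cases hs1 : s₁ ∈ (phaseStep k g s).support
  swap
  · rw [(PMF.apply_eq_zero_iff _ _).2 hs1]; simp
  have hclock : s₁.clock = s.clock := by
    rcases mem_support_phaseStep hs1 with ⟨-, rfl⟩ | ⟨-, R, -, z, rfl⟩ <;> rfl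
  refine mul_le_mul_right ?_ _
  rw [PMF.tsum_bind_mul, sampleStep, PMF.tsum_map_mul]
  refine PMF.tsum_mul_le _ fun b _ => ?_
  rw [noiseStep, PMF.tsum_map_mul]
  simp only [statePotential, mul_add]
  rw [ENNReal.tsum_add]
  refine add_le_add ?_ (PMF.tsum_mul_le _ fun _ _ => le_rfl)
  exact tsum_nodePotential_refresh_le hρ hg _ (by omega) (by omega) _

open Classical in
/-- An insertion decreases the potential, on average, by at least the probability that the noise is
large afterwards. -/
lemma tsum_insert_mul_noisePotential_le (hρ : 1 ≤ ρ) (hρt : ρ ≠ ∞)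
    (hg : ∑' z, g z * ρ ^ z.natAbs ≤ 2) (k m : ℕ)
    {T : ℕ} (hT : T < 2 ^ l) (s : SampleState U l) (hs : s.clock + 1 ≤ T) (x : U) :
    ∑' s', sampleUpdate k g s (.insert x) s' *
        ((if m < s'.noiseSize then 1 else 0) + noisePotential ρ m T s') ≤ noisePotential ρ m T s := by
  calc _ ≤ ∑' s', sampleUpdate k g s (.insert x) s' *
        ∑ t ∈ Finset.Ioc s.clock T, (ρ ^ (m + 1))⁻¹ * statePotential ρ t s' := by
        refine ENNReal.tsum_le_tsum fun s' => ?_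
        by_cases hs' : s' ∈ (sampleUpdate k g s (.insert x)).support
        swap
        · rw [(PMF.apply_eq_zero_iff _ _).2 hs']; simp
        have hclock : s'.clock = s.clock + 1 := by
          obtain ⟨s₁, h1, b, -, z, -, rfl⟩ := mem_support_sampleUpdate_insert hs'
          rcases mem_support_phaseStep h1 with ⟨-, rfl⟩ | ⟨-, R, -, z, rfl⟩ <;> rfl
        refine mul_le_mul_right ?_ _
        have hIoc : Finset.Ioc s.clock T = insert (s.clock + 1) (Finset.Ioc (s.clock + 1) T) := by
          ext a; simp only [Finset.mem_Ioc, Finset.mem_insert]; omega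
        rw [hIoc, Finset.sum_insert (by simp), noisePotential, ← hclock]
        gcongr
        split_ifs with h
        · exact one_le_statePotential hρ hρt h
        · exact zero_le
    _ = ∑ t ∈ Finset.Ioc s.clock T, (ρ ^ (m + 1))⁻¹ *
        ∑' s', sampleUpdate k g s (.insert x) s' * statePotential ρ t s' := by
        simp only [Finset.mul_sum]
        rw [Summable.tsum_finsetSum (fun _ _ => ENNReal.summable)]
        refine Finset.sum_congr rfl fun t _ => ?_
        rw [← ENNReal.tsum_mul_left]
        exact tsum_congr fun s' => by ring
    _ ≤ _ := by
        refine Finset.sum_le_sum fun t ht => mul_le_mul_right ?_ _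
        rw [Finset.mem_Ioc] at ht
        exact tsum_insert_mul_statePotential_le hρ hg k (by omega) s (by omega) x

end Potential

/-! ### Accounting for the failure probability -/

/-- The mass of a Markov chain started at `z₀` that has stayed in `G` at all times `1, …, n`. -/
noncomputable def survivingMass {α : Type*} (K : α → PMF α) (z₀ : α) (G : α → Prop)
    [DecidablePred G] : ℕ → α → ℝ≥0∞
  | 0 => PMF.pure z₀
  | n + 1 => fun z' => if G z' then ∑' z, survivingMass K z₀ G n z * K z z' else 0

lemma survivingMass_le {α : Type*} {K : α → PMF α} {z₀ : α} {G : α → Prop} [DecidablePred G]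
    {P : ℕ → PMF α} (h0 : P 0 = PMF.pure z₀) (hP : ∀ n, P (n + 1) = (P n).bind K) (n : ℕ) (z : α) :
    survivingMass K z₀ G n z ≤ P n z := by
  induction n generalizing z with
  | zero => rw [h0]; rfl
  | succ n ih =>
    rw [hP, PMF.bind_apply]
    change (if G z then _ else 0) ≤ _
    split_ifs
    · exact ENNReal.tsum_le_tsum fun z' => mul_le_mul_left (ih z') _
    · exact zero_le

/-- A bound for the probability of leaving `G`. Each exit is caused by an event counted by `N`, whose
expected number is controlled by the potential `pot` along the surviving paths, or by an event counted
by `S`. The latter has small probability at each time when it can occur, in the sense that its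
expectation is at most that of `ef`, and the expected total of `ef` is controlled by the potential
`pe`. -/
lemma one_le_tsum_survivingMass_add {α : Type*} {K : α → PMF α} {z₀ : α} {G : α → Prop}
    [DecidablePred G] {P : ℕ → PMF α} (h0 : P 0 = PMF.pure z₀)
    (hP : ∀ n, P (n + 1) = (P n).bind K) {pot pe N S ef : α → ℝ≥0∞} (hB : pot z₀ + pe z₀ ≠ ∞) (n : ℕ)
    (hpot : ∀ i < n, ∀ z, survivingMass K z₀ G i z ≠ 0 → ∑' z', K z z' * (N z' + pot z') ≤ pot z)
    (hS : ∀ i, ∑' z, P i z * S z ≤ ∑' z, P i z * ef z)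
    (hpe : ∀ z, ∑' z', K z z' * (ef z' + pe z') ≤ pe z)
    (hG : ∀ i < n, ∀ z, survivingMass K z₀ G i z ≠ 0 → ∀ z' ∈ (K z).support, ¬ G z' → 1 ≤ N z' + S z') :
    1 ≤ ∑' z, survivingMass K z₀ G n z + (pot z₀ + pe z₀) := by
  set w := survivingMass K z₀ G with hw
  have hw1 : ∀ n, ∑' z, w n z ≤ 1 := fun n => by
    rw [← (P n).tsum_coe]
    exact ENNReal.tsum_le_tsum (survivingMass_le h0 hP n)
  suffices h : 1 + ∑' z, w n z * pot z + ∑' z, P n z * pe z ≤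
      ∑' z, w n z + (pot z₀ + pe z₀) from
    le_trans (by rw [add_assoc]; exact le_self_add) h
  induction n with
  | zero =>
    have e1 : ∑' z, w 0 z * pot z = pot z₀ := PMF.tsum_pure_mul z₀ pot
    have e2 : ∑' z, w 0 z = 1 := (PMF.pure z₀).tsum_coe
    rw [e1, e2, h0, PMF.tsum_pure_mul, add_assoc]
  | succ n ih =>
    have ih := ih (fun i hi => hpot i (by omega)) (fun i hi => hG i (by omega))
    set u : α → ℝ≥0∞ := fun z' => ∑' z, w n z * K z z' with hu
    have hut : ∀ f : α → ℝ≥0∞, ∑' z', u z' * f z' = ∑' z, w n z * ∑' z', K z z' * f z' := by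
      intro f
      simp only [hu, ← ENNReal.tsum_mul_right, ← ENNReal.tsum_mul_left]
      rw [ENNReal.tsum_comm]
      simp only [mul_assoc]
    have htot : ∑' z, w n z = ∑' z', u z' := by
      have := hut 1
      simp only [Pi.one_apply, mul_one, PMF.tsum_coe] at this
      exact this.symm
    have huP : ∀ z', u z' ≤ P (n + 1) z' := by
      intro z'
      rw [hP, PMF.bind_apply]
      exact ENNReal.tsum_le_tsum fun z => mul_le_mul_left (survivingMass_le h0 hP n z) _
    have hpt : ∀ z', u z' + w (n + 1) z' * pot z' ≤
        w (n + 1) z' + u z' * (N z' + pot z') + u z' * S z' := by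
      intro z'
      have hwz : w (n + 1) z' = if G z' then u z' else 0 := rfl
      rw [hwz]
      split_ifs with h
      · calc _ ≤ u z' + u z' * (N z' + pot z') := by gcongr; exact le_add_self
          _ ≤ _ := le_self_add
      · by_cases hz : u z' = 0
        · simp [hz]
        · obtain ⟨z, hz⟩ : ∃ z, w n z * K z z' ≠ 0 := by
            by_contra hcon
            push Not at hcon
            exact hz (ENNReal.tsum_eq_zero.2 hcon)
          have h1 := hG n (by omega) z (left_ne_zero_of_mul hz) z'
            ((PMF.mem_support_iff _ _).2 (right_ne_zero_of_mul hz)) h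
          calc u z' + 0 * pot z' = u z' * 1 := by ring
            _ ≤ u z' * (N z' + S z') := by gcongr
            _ ≤ u z' * (N z' + S z') + u z' * pot z' := le_self_add
            _ = _ := by ring
    have hsum : ∑' z, w n z + ∑' z, w (n + 1) z * pot z + ∑' z, P (n + 1) z * pe z ≤
        ∑' z, w (n + 1) z + ∑' z, w n z * pot z + ∑' z, P n z * pe z := by
      have h1 : ∑' z', u z' * (N z' + pot z') ≤ ∑' z, w n z * pot z := by
        rw [hut]
        refine ENNReal.tsum_le_tsum fun z => ?_
        by_cases hz : w n z = 0
        · simp [hz]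
        · exact mul_le_mul_right (hpot n (by omega) z hz) _
      have h2 : ∑' z', u z' * S z' ≤ ∑' z, P (n + 1) z * ef z :=
        (ENNReal.tsum_le_tsum fun z' => mul_le_mul_left (huP z') _).trans (hS (n + 1))
      have h3 : ∑' z, P (n + 1) z * ef z + ∑' z, P (n + 1) z * pe z ≤ ∑' z, P n z * pe z := by
        rw [← ENNReal.tsum_add]
        simp only [← mul_add]
        rw [hP, PMF.tsum_bind_mul]
        exact ENNReal.tsum_le_tsum fun z => mul_le_mul_right (hpe z) _
      calc _ = ∑' z', (u z' + w (n + 1) z' * pot z') + ∑' z, P (n + 1) z * pe z := by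
            rw [htot, ENNReal.tsum_add]
        _ ≤ ∑' z', (w (n + 1) z' + u z' * (N z' + pot z') + u z' * S z') + ∑' z, P (n + 1) z * pe z := by
            exact add_le_add (ENNReal.tsum_le_tsum hpt) le_rfl
        _ = ∑' z, w (n + 1) z + ∑' z', u z' * (N z' + pot z') +
            (∑' z', u z' * S z' + ∑' z, P (n + 1) z * pe z) := by
            rw [ENNReal.tsum_add, ENNReal.tsum_add, add_assoc]
        _ ≤ ∑' z, w (n + 1) z + ∑' z, w n z * pot z +
            (∑' z, P (n + 1) z * ef z + ∑' z, P (n + 1) z * pe z) := by gcongr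
        _ ≤ _ := by gcongr
    set t := ∑' z, w n z
    set t' := ∑' z, w (n + 1) z
    set a := ∑' z, w n z * pot z
    set a' := ∑' z, w (n + 1) z * pot z
    set b := ∑' z, P n z * pe z
    set b' := ∑' z, P (n + 1) z * pe z
    have ht : t ≠ ∞ := ne_top_of_le_ne_top ENNReal.one_ne_top (hw1 n)
    have hfin : t + (1 + a + b) ≠ ∞ :=
      ENNReal.add_ne_top.2 ⟨ht, ne_top_of_le_ne_top (ENNReal.add_ne_top.2 ⟨ht, hB⟩) ih⟩
    have hfin' : t + (a + b) ≠ ∞ := by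
      refine ne_top_of_le_ne_top hfin ?_
      rw [add_assoc 1]
      exact add_le_add le_rfl le_add_self
    refine (ENNReal.add_le_add_iff_left hfin').1 ?_
    calc t + (a + b) + (1 + a' + b') = (1 + a + b) + (t + a' + b') := by ring
      _ ≤ (t + (pot z₀ + pe z₀)) + (t' + a + b) := add_le_add ih hsum
      _ = _ := by ring

/-! ### Updates that change the set of active keys -/

/-- The last update of the transcript is an insertion or the deletion of an active key, and there are at
most `T` insertions so far. -/
def Transcript.Effective {U : Type*} [DecidableEq U] (T : ℕ) (h : Transcript U) : Prop :=
  h.insertions ≤ T ∧ ∃ (τ : Transcript U) (o : Op U) (y : ℝ), h = τ ++ [(o, y)] ∧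
    (o.isInsert ∨ o.key ∈ τ.current)

/-- A bound for the number of later effective updates. -/
def Transcript.effectiveBudget {U : Type*} [DecidableEq U] (T : ℕ) (h : Transcript U) : ℕ :=
  if h.insertions ≤ T then 2 * (T - h.insertions) + h.current.card else 0

open Classical in
lemma Transcript.effectiveBudget_append {U : Type*} [DecidableEq U] (T : ℕ) (h : Transcript U)
    (o : Op U) (y : ℝ) :
    (if Transcript.Effective T (h ++ [(o, y)]) then 1 else 0) +
      Transcript.effectiveBudget T (h ++ [(o, y)]) ≤ h.effectiveBudget T := by
  have hle := Transcript.insertions_le_append h o y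
  by_cases hT : Transcript.insertions (h ++ [(o, y)]) ≤ T
  swap
  · have : ¬ Transcript.Effective T (h ++ [(o, y)]) := fun h => hT h.1
    rw [if_neg this, Transcript.effectiveBudget, if_neg hT]
    exact Nat.zero_le _
  rw [Transcript.effectiveBudget, Transcript.effectiveBudget, if_pos hT, if_pos (hle.trans hT)]
  cases o with
  | insert x =>
    have h1 := Op.card_apply_le (.insert x) h.current
    rw [Transcript.insertions_append_insert] at hT
    rw [Transcript.current_append, Transcript.insertions_append_insert]
    split_ifs <;> omega
  | delete x =>
    rw [Transcript.current_append, Transcript.insertions_append_delete]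
    by_cases hx : x ∈ h.current
    · have h1 : (h.current.erase x).card = h.current.card - 1 := Finset.card_erase_of_mem hx
      have h2 := Finset.card_pos.2 ⟨x, hx⟩
      simp only [Op.apply]
      split_ifs <;> omega
    · have h1 : ¬ Transcript.Effective T (h ++ [(Op.delete x, y)]) := by
        rintro ⟨-, τ, o, y', he, h2⟩
        have h3 := List.append_inj' he rfl
        simp only [List.cons.injEq, Prod.mk.injEq, and_true] at h3
        obtain ⟨rfl, rfl, -⟩ := h3
        simp [Op.isInsert, Op.key, hx] at h2
      rw [if_neg h1]
      simp [Op.apply, Finset.erase_eq_of_notMem hx]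

/-! ### The invariant of a successful run -/

/-- The invariant of a successful run: the noise is small, the sample is representative and not too
large, the sampling rate is not lower than the maximal cardinality so far requires, and all estimates
so far are accurate. -/
structure Successful {U : Type*} [DecidableEq U] {l : ℕ} (ε θ : ℝ) (k m : ℕ) (τ : Transcript U)
    (s : SampleState U l) : Prop where
  noise_le : s.noiseSize ≤ m
  sample : SampleAccurate θ k τ s
  card_le : s.keys.card ≤ 2 * k
  phase_le : s.phase ≠ 0 → (k : ℝ) * 2 ^ s.phase ≤ 4 * τ.prefixMax τ.length
  accurate : τ.PrefixMaxAccurate ε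

section SuccessfulRun
variable {U : Type*} {l : ℕ} {ε θ : ℝ} {k m T : ℕ}

lemma SampleState.abs_noisyCard_sub_le (s : SampleState U l) :
    |(s.noisyCard : ℝ) - s.keys.card| ≤ s.noiseSize := by
  have h1 : (s.noisyCard : ℝ) - s.keys.card = ((∑ r, s.noise r : ℤ) : ℝ) := by
    simp [SampleState.noisyCard]
  rw [h1, ← Int.cast_abs]
  have h2 : |∑ r, s.noise r| ≤ ∑ r, |s.noise r| := Finset.abs_sum_le_sum_abs _ _
  have h3 : ∑ r, |s.noise r| = ((s.noiseSize : ℕ) : ℤ) := by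
    simp [SampleState.noiseSize]
  rw [h3] at h2
  exact_mod_cast h2

variable [DecidableEq U]

lemma SampleAccurate.bounds {τ : Transcript U} {s : SampleState U l} (h : SampleAccurate θ k τ s)
    (hθ : θ ≤ 1 / 16) :
    |(s.keys.card : ℝ) - (2 ^ s.phase)⁻¹ * τ.current.card| ≤
      1 / 16 * ((2 ^ s.phase)⁻¹ * τ.current.card + k) :=
  h.trans (mul_le_mul_of_nonneg_right hθ (by positivity))

/-- If the noisy sample size exceeds `k`, then so does, up to a constant, its mean. -/
lemma Successful.le_of_lt_noisyCard {τ : Transcript U} {s : SampleState U l} (h : Successful ε θ k m τ s)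
    (hθ : θ ≤ 1 / 16) (hm : (m : ℝ) ≤ θ * k) (hk : (k : ℤ) < s.noisyCard) :
    (k : ℝ) ≤ 2 * ((2 ^ s.phase)⁻¹ * τ.current.card) := by
  have h1 := abs_le.1 s.abs_noisyCard_sub_le
  have h2 : (s.noiseSize : ℝ) ≤ m := Nat.cast_le.2 h.noise_le
  have h3 : (k : ℝ) < s.noisyCard := by exact_mod_cast hk
  have h4 := abs_le.1 (h.sample.bounds hθ)
  have h5 : θ * (k : ℝ) ≤ 1 / 16 * k := mul_le_mul_of_nonneg_right hθ (Nat.cast_nonneg _)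
  linarith

/-- The invariant is preserved as long as the noise is small and the sample is representative. The sample
is bounded because a new phase starts when it exceeds `k`; at the start of a phase the number of active
keys is of order `k` over the sampling rate, so the errors of noise and sample, which are of order `θ * k`
over the rate, are small compared to it. -/
lemma Successful.step {g : PMF ℤ} {τ : Transcript U} {s s' : SampleState U l} {o : Op U}
    (hε : 0 ≤ ε) (hθε : θ = ε / 16) (hε1 : ε ≤ 1) (hm : (m : ℝ) ≤ θ * k) (hk : 2 ≤ k)
    (hT : T < 2 ^ l) (hτT : τ.insertions ≤ T)
    (hcons : Consistent τ s) (h : Successful ε θ k m τ s) (hs' : s' ∈ (sampleUpdate k g s o).support)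
    (hnoise : s'.noiseSize ≤ m) (hsample : SampleAccurate θ k (τ ++ [(o, s'.estimate)]) s') :
    Successful ε θ k m (τ ++ [(o, s'.estimate)]) s' := by
  have hθ : θ ≤ 1 / 16 := by rw [hθε]; linarith
  have hθ0 : 0 ≤ θ := by rw [hθε]; positivity
  have hcons' := hcons.step hs' s'.estimate
  have hkθ : θ * (k : ℝ) ≤ 1 / 16 * k := mul_le_mul_of_nonneg_right hθ (Nat.cast_nonneg _)
  have hk2 : (2 : ℝ) ≤ k := by exact_mod_cast hk
  have hbd' := abs_le.1 (hsample.bounds hθ)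
  have hprefix : (τ.prefixMax τ.length : ℝ) ≤
      Transcript.prefixMax (τ ++ [(o, s'.estimate)]) (τ ++ [(o, s'.estimate)]).length :=
    Nat.cast_le.2 (τ.prefixMax_le_append o _)
  have hcur : (τ.current.card : ℝ) ≤ τ.prefixMax τ.length :=
    Nat.cast_le.2 τ.card_current_le_prefixMax
  have hsize : s'.keys.card ≤ 2 * k ∧ (s'.phase ≠ 0 → (k : ℝ) * 2 ^ s'.phase ≤
      4 * Transcript.prefixMax (τ ++ [(o, s'.estimate)]) (τ ++ [(o, s'.estimate)]).length) := by
    cases o with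
    | delete x =>
      simp only [sampleUpdate, PMF.mem_support_pure_iff] at hs'
      subst hs'
      refine ⟨(Finset.card_le_card (Finset.erase_subset _ _)).trans h.card_le, fun h0 => ?_⟩
      exact (h.phase_le h0).trans (by linarith)
    | insert x =>
      obtain ⟨s₁, h1, b, -, z, -, rfl⟩ := mem_support_sampleUpdate_insert hs'
      rcases mem_support_phaseStep h1 with ⟨hf, rfl⟩ | ⟨hf, R, hR, z0, rfl⟩
      · refine ⟨?_, fun h0 => (h.phase_le h0).trans (by linarith)⟩
        have hnc : ¬ (k : ℤ) < s₁.noisyCard := by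
          intro hlt
          -- otherwise the maximal number of phases is reached, with more than `T` active keys
          have hph : s₁.phase = l := le_antisymm hcons.phase_le (by
            by_contra hcon; exact hf ⟨not_le.1 hcon, hlt⟩)
          have h2 := h.le_of_lt_noisyCard hθ hm hlt
          rw [hph] at h2
          have h3 : (τ.current.card : ℝ) ≤ T := Nat.cast_le.2 (τ.card_current_le_insertions.trans hτT)
          have h4 : (T : ℝ) < 2 ^ l := by exact_mod_cast hT
          have h5 : (0 : ℝ) < 2 ^ l := by positivity
          have h6 : ((2 : ℝ) ^ l)⁻¹ * τ.current.card < 1 := by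
            rw [inv_mul_lt_iff₀ h5]; linarith
          linarith
        have h2 : (s₁.noisyCard : ℝ) ≤ k := by exact_mod_cast not_lt.1 hnc
        have h3 := abs_le.1 s₁.abs_noisyCard_sub_le
        have h4 : (s₁.noiseSize : ℝ) ≤ m := Nat.cast_le.2 h.noise_le
        have h5 : (if b then insert x s₁.keys else s₁.keys.erase x).card ≤ s₁.keys.card + 1 := by
          split_ifs
          · exact Finset.card_insert_le _ _
          · exact (Finset.card_le_card (Finset.erase_subset _ _)).trans (Nat.le_succ _)
        have h6 : ((if b then insert x s₁.keys else s₁.keys.erase x).card : ℝ) ≤ s₁.keys.card + 1 := by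
          exact_mod_cast h5
        have h7 : ((if b then insert x s₁.keys else s₁.keys.erase x).card : ℝ) ≤ 2 * k := by linarith
        exact_mod_cast h7
      · have hlow := h.le_of_lt_noisyCard hθ hm hf.2
        have hpow : (0 : ℝ) < 2 ^ s.phase := by positivity
        constructor
        · -- the previous sample size bounds the cardinality, hence the mean at half the rate
          have h2 := abs_le.1 (h.sample.bounds hθ)
          have h3 : (s.keys.card : ℝ) ≤ 2 * k := by exact_mod_cast h.card_le
          have h4 : ((Transcript.current (τ ++ [(Op.insert x, SampleState.estimate
              (⟨if b then insert x R else R.erase x, refresh (nodeLevel l (s.clock + 1))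
                (Pi.single (Fin.last l) z0) z, s.clock + 1, s.clock, s.phase + 1⟩ :
                SampleState U l))])).card : ℝ) ≤ τ.current.card + 1 := by
            rw [Transcript.current_append]
            exact_mod_cast Op.card_apply_le _ _
          have h5 : ((2 : ℝ) ^ (s.phase + 1))⁻¹ = (2 ^ s.phase)⁻¹ / 2 := by
            rw [pow_succ, mul_inv]; ring
          have h6 : ((2 : ℝ) ^ s.phase)⁻¹ ≤ 1 := inv_le_one_of_one_le₀ (one_le_pow₀ (by norm_num))
          have h7 : (0 : ℝ) ≤ (2 ^ s.phase)⁻¹ := by positivity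
          have h8 := mul_le_mul_of_nonneg_left h4 h7
          simp only at hbd'
          rw [h5] at hbd'
          have h9 : ((if b then insert x R else R.erase x).card : ℝ) ≤ 2 * k := by
            linarith
          exact_mod_cast h9
        · intro _
          have h2 : (k : ℝ) * 2 ^ s.phase ≤ 2 * τ.current.card := by
            calc (k : ℝ) * 2 ^ s.phase ≤ 2 * ((2 ^ s.phase)⁻¹ * τ.current.card) * 2 ^ s.phase :=
                  mul_le_mul_of_nonneg_right hlow hpow.le
              _ = 2 * τ.current.card * ((2 ^ s.phase)⁻¹ * 2 ^ s.phase) := by ring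
              _ = _ := by rw [inv_mul_cancel₀ hpow.ne', mul_one]
          have h3 : (k : ℝ) * 2 ^ (s.phase + 1) ≤ 4 * τ.current.card := by
            rw [pow_succ]; linarith
          exact h3.trans (by linarith)
  refine ⟨hnoise, hsample, hsize.1, hsize.2, h.accurate.append o _ ?_⟩
  have hcur' : ((o.apply τ.current).card : ℝ) ≤
      Transcript.prefixMax (τ ++ [(o, s'.estimate)]) (τ ++ [(o, s'.estimate)]).length := by
    have := Transcript.card_current_le_prefixMax (τ ++ [(o, s'.estimate)])
    rw [Transcript.current_append] at this
    exact_mod_cast this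
  set M : ℝ := (Transcript.prefixMax (τ ++ [(o, s'.estimate)]) (τ ++ [(o, s'.estimate)]).length : ℝ)
  have hM : 0 ≤ M := Nat.cast_nonneg _
  rcases Nat.eq_zero_or_pos s'.phase with h0 | hpos
  · obtain ⟨h1, h2⟩ := hcons'.exact_of_zero h0
    rw [Transcript.current_append] at h1
    have : s'.estimate = ((o.apply τ.current).card : ℝ) := by
      simp [SampleState.estimate, SampleState.noisyCard, h0, h1, h2]
    rw [this, sub_self, abs_zero]
    positivity
  · have hph := hsize.2 hpos.ne'
    have hpow : (0 : ℝ) < 2 ^ s'.phase := by positivity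
    have h1 := s'.abs_noisyCard_sub_le
    have h2 : (s'.noiseSize : ℝ) ≤ m := Nat.cast_le.2 hnoise
    have h3 := hsample
    rw [SampleAccurate, Transcript.current_append] at h3
    set N : ℝ := ((o.apply τ.current).card : ℝ)
    have h4 : s'.estimate - N = 2 ^ s'.phase * (((s'.noisyCard : ℝ) - s'.keys.card) +
        ((s'.keys.card : ℝ) - (2 ^ s'.phase)⁻¹ * N)) := by
      rw [SampleState.estimate]; field_simp; ring
    have h5 : (2 : ℝ) ^ s'.phase * (θ * ((2 ^ s'.phase)⁻¹ * N + k)) = θ * N + θ * (k * 2 ^ s'.phase) := by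
      field_simp
    rw [h4, abs_mul, abs_of_pos hpow]
    calc (2 : ℝ) ^ s'.phase * |((s'.noisyCard : ℝ) - s'.keys.card) +
        ((s'.keys.card : ℝ) - (2 ^ s'.phase)⁻¹ * N)|
        ≤ 2 ^ s'.phase * (θ * k + θ * ((2 ^ s'.phase)⁻¹ * N + k)) := by
          refine mul_le_mul_of_nonneg_left ((abs_add_le _ _).trans ?_) hpow.le
          exact add_le_add (h1.trans (h2.trans hm)) h3
      _ = θ * N + 2 * (θ * (k * 2 ^ s'.phase)) := by rw [mul_add, h5]; ring
      _ ≤ θ * M + 2 * (θ * (4 * M)) := by gcongr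
      _ ≤ ε * M := by rw [hθε]; nlinarith

end SuccessfulRun

/-! ### The sketch with bounded memory -/

namespace SampleState
variable {U : Type*} {l : ℕ}

/-- A state as the contents of a memory. -/
def encode (s : SampleState U l) : Memory U :=
  ⟨s.keys, (s.clock : ℤ) :: (s.start : ℤ) :: (s.phase : ℤ) :: List.ofFn s.noise⟩

/-- The state that is stored in a memory. -/
def decode (l : ℕ) (M : Memory U) : SampleState U l :=
  ⟨M.keys, fun r => M.counters.getD (r + 3) 0, (M.counters.getD 0 0).toNat,
    (M.counters.getD 1 0).toNat, (M.counters.getD 2 0).toNat⟩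

@[simp] lemma decode_encode (s : SampleState U l) : decode l s.encode = s := by
  refine SampleState.ext rfl (funext fun r => ?_) (by simp [decode, encode])
    (by simp [decode, encode]) (by simp [decode, encode])
  simp [decode, encode, -List.ofFn_succ, Nat.lt_succ_iff.1 r.2]

lemma encode_injective : Function.Injective (encode : SampleState U l → Memory U) :=
  Function.LeftInverse.injective decode_encode

/-- The sample has at most `2 * k` keys and no counter exceeds `T`. -/
structure Fits (k T : ℕ) (s : SampleState U l) : Prop where
  card_le : s.keys.card ≤ 2 * k
  clock_le : s.clock ≤ T
  start_le : s.start ≤ T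
  phase_le : s.phase ≤ T
  noise_le : ∀ r, (s.noise r).natAbs ≤ T

lemma fits_empty (k T : ℕ) : (empty : SampleState U l).Fits k T := by
  constructor <;> simp [empty]

lemma Fits.cells_encode_le {k T : ℕ} {s : SampleState U l} (h : s.Fits k T) :
    s.encode.cells ≤ 2 * k + (l + 4) := by
  have := h.card_le
  simp only [encode, Memory.cells, List.length_cons, List.length_ofFn]
  omega

lemma Fits.natAbs_le_of_mem {k T : ℕ} {s : SampleState U l} (h : s.Fits k T) {c : ℤ}
    (hc : c ∈ s.encode.counters) : c.natAbs ≤ T := by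
  simp only [encode, List.mem_cons, List.mem_ofFn] at hc
  rcases hc with rfl | rfl | rfl | ⟨r, rfl⟩
  · simpa using h.clock_le
  · simpa using h.start_le
  · simpa using h.phase_le
  · exact h.noise_le r

open Classical in
/-- Reset a state that is too large for the memory. -/
noncomputable def clip (k T : ℕ) (s : SampleState U l) : SampleState U l :=
  if s.Fits k T then s else empty

lemma fits_clip (k T : ℕ) (s : SampleState U l) : (s.clip k T).Fits k T := by
  unfold clip
  split_ifs with h
  · exact h
  · exact fits_empty k T

lemma Fits.clip_eq {k T : ℕ} {s : SampleState U l} (h : s.Fits k T) : s.clip k T = s := if_pos h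

lemma keys_clip_subset (k T : ℕ) (s : SampleState U l) : (s.clip k T).keys ⊆ s.keys := by
  unfold clip
  split_ifs
  · exact subset_rfl
  · exact Finset.empty_subset _

end SampleState

section Sketch
variable {U : Type*} [DecidableEq U]

lemma keys_subset_of_mem_support_sampleUpdate {l k : ℕ} {g : PMF ℤ} {s s' : SampleState U l} {o : Op U}
    (h : s' ∈ (sampleUpdate k g s o).support) : s'.keys ⊆ insert o.key s.keys := by
  cases o with
  | delete x =>
    simp only [sampleUpdate, PMF.mem_support_pure_iff] at h
    subst h
    exact (Finset.erase_subset _ _).trans (Finset.subset_insert _ _)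
  | insert x =>
    obtain ⟨s₁, h1, b, -, z, -, rfl⟩ := mem_support_sampleUpdate_insert h
    have hsub : s₁.keys ⊆ s.keys := by
      rcases mem_support_phaseStep h1 with ⟨-, rfl⟩ | ⟨-, R, hR, z, rfl⟩
      · exact subset_rfl
      · exact hR
    simp only [Op.key]
    split_ifs
    · exact Finset.insert_subset_insert _ hsub
    · exact (Finset.erase_subset _ _).trans (hsub.trans (Finset.subset_insert _ _))

/-- The sampling algorithm as a sketch, which is reset whenever its state becomes too large. -/
noncomputable def boundedSketch (U : Type*) [DecidableEq U] (l k T : ℕ) (g : PMF ℤ) : Sketch U where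
  init := (SampleState.empty : SampleState U l).encode
  step M o := (sampleUpdate k g (SampleState.decode l M) o).map fun s => (s.clip k T).encode
  estimate M := (SampleState.decode l M).estimate
  init_keys := rfl
  step_keys M o M' h := by
    obtain ⟨s, hs, rfl⟩ := (PMF.mem_support_map_iff _ _ _).1 h
    exact (s.keys_clip_subset k T).trans (keys_subset_of_mem_support_sampleUpdate hs)

lemma boundedSketch_fits {l k T : ℕ} {g : PMF ℤ} {adv : Adversary U} {n : ℕ}
    {z : Transcript U × Memory U} (h : z ∈ ((boundedSketch U l k T g).run adv n).support) :
    ∃ s : SampleState U l, s.Fits k T ∧ z.2 = s.encode := by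
  rw [Sketch.run_eq_interact] at h
  cases n with
  | zero =>
    simp only [interact, PMF.mem_support_pure_iff] at h
    exact ⟨_, SampleState.fits_empty k T, by rw [h]; rfl⟩
  | succ n =>
    rw [interact, PMF.mem_support_bind_iff] at h
    obtain ⟨z0, -, h1⟩ := h
    obtain ⟨o, -, M, hM, rfl⟩ := mem_support_interactRound.1 h1
    obtain ⟨s, -, rfl⟩ := (PMF.mem_support_map_iff _ _ _).1 hM
    exact ⟨_, s.fits_clip k T, rfl⟩

/-- A bound for the number of insertions of all transcripts of length `n` applies to each update that
the adversary may choose before that. -/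
lemma Sketch.insertions_append_le {A : Sketch U} {adv : Adversary U} {n T : ℕ}
    (hT : ∀ z ∈ (A.run adv n).support, z.1.insertions ≤ T) {i : ℕ} (hi : i < n)
    {z : Transcript U × Memory U} (hz : z ∈ (A.run adv i).support) {o : Op U}
    (ho : o ∈ (adv z.1).support) (y : ℝ) : Transcript.insertions (z.1 ++ [(o, y)]) ≤ T := by
  have hext : ∀ j, ∃ z' ∈ (A.run adv (i + 1 + j)).support,
      Transcript.insertions (z.1 ++ [(o, y)]) ≤ z'.1.insertions := by
    intro j
    simp only [Sketch.run_eq_interact] at hz ⊢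
    induction j with
    | zero =>
      obtain ⟨M, hM⟩ := (A.step z.2 o).support_nonempty
      refine ⟨(z.1 ++ [(o, A.estimate M)], M), ?_, ?_⟩
      · rw [add_zero, interact, PMF.mem_support_bind_iff]
        exact ⟨z, hz, mem_support_interactRound.2 ⟨o, ho, M, hM, rfl⟩⟩
      · cases o <;> simp
    | succ j ih =>
      obtain ⟨z', hz', hle⟩ := ih
      obtain ⟨o', ho'⟩ := (adv z'.1).support_nonempty
      obtain ⟨M, hM⟩ := (A.step z'.2 o').support_nonempty
      refine ⟨(z'.1 ++ [(o', A.estimate M)], M), ?_, hle.trans (Transcript.insertions_le_append _ _ _)⟩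
      rw [← add_assoc, interact, PMF.mem_support_bind_iff]
      exact ⟨z', hz', mem_support_interactRound.2 ⟨o', ho', M, hM, rfl⟩⟩
  obtain ⟨z', hz', hle⟩ := hext (n - (i + 1))
  rw [show i + 1 + (n - (i + 1)) = n by omega] at hz'
  exact hle.trans (hT z' hz')

/-! ### The sampling algorithm is likely to be successful -/

variable {l k m T : ℕ} {g : PMF ℤ} {ε θ : ℝ} {adv : Adversary U}

open Classical in
/-- The law of the sampling algorithm restricted to the runs that are successful at all times. -/
noncomputable def successfulRun (l k m : ℕ) (g : PMF ℤ) (ε θ : ℝ) (adv : Adversary U) (n : ℕ) :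
    Transcript U × SampleState U l → ℝ≥0∞ :=
  survivingMass (interactRound (sampleUpdate k g) SampleState.estimate adv) ([], SampleState.empty)
    (fun z => Successful ε θ k m z.1 z.2) n

open Classical in
lemma successfulRun_le (n : ℕ) (z : Transcript U × SampleState U l) :
    successfulRun l k m g ε θ adv n z ≤ sampleRun l k g adv n z :=
  survivingMass_le (P := sampleRun l k g adv) rfl (fun _ => rfl) n z

lemma consistent_of_successfulRun {n : ℕ} {z : Transcript U × SampleState U l}
    (h : successfulRun l k m g ε θ adv n z ≠ 0) : Consistent z.1 z.2 :=
  consistent_of_mem_support ((PMF.mem_support_iff _ _).2 fun h0 =>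
    h (le_antisymm ((successfulRun_le n z).trans_eq h0) zero_le))

lemma successful_of_successfulRun (hθ : 0 ≤ θ) {n : ℕ} {z : Transcript U × SampleState U l}
    (h : successfulRun l k m g ε θ adv n z ≠ 0) : Successful ε θ k m z.1 z.2 := by
  cases n with
  | zero =>
    have hz : z = ([], SampleState.empty) := by
      by_contra hz
      exact h (by simp [successfulRun, survivingMass, hz])
    subst hz
    refine ⟨by simp [SampleState.noiseSize, SampleState.empty], ?_, by simp [SampleState.empty],
      by simp [SampleState.empty], fun i hi => by simp at hi⟩
    simp only [SampleAccurate, SampleState.empty]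
    simp
    positivity
  | succ n =>
    by_contra hcon
    exact h (if_neg hcon)

lemma Successful.fits {τ : Transcript U} {s : SampleState U l} (h : Successful ε θ k m τ s)
    (hc : Consistent τ s) (hτ : τ.insertions ≤ T) (hm : m ≤ T) (hl : l ≤ T) : s.Fits k T := by
  refine ⟨h.card_le, hc.clock_eq.trans_le hτ, (hc.start_le.trans_eq hc.clock_eq).trans hτ,
    hc.phase_le.trans hl, fun r => ?_⟩
  refine le_trans ?_ (h.noise_le.trans hm)
  exact Finset.single_le_sum (f := fun r => (s.noise r).natAbs) (fun _ _ => Nat.zero_le _)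
    (Finset.mem_univ r)

/-- Successful runs of the sampling algorithm are runs of the sketch with bounded memory. -/
lemma successfulRun_le_run (hθ : 0 ≤ θ) (hm : m ≤ T) (hl : l ≤ T) {n : ℕ}
    (hT : ∀ z ∈ ((boundedSketch U l k T g).run adv n).support, z.1.insertions ≤ T) {i : ℕ} (hi : i ≤ n)
    (τ : Transcript U) (s : SampleState U l) :
    successfulRun l k m g ε θ adv i (τ, s) ≤ (boundedSketch U l k T g).run adv i (τ, s.encode) := by
  induction i generalizing τ s with
  | zero =>
    by_cases h : (τ, s) = ([], SampleState.empty)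
    · rw [Prod.mk.injEq] at h
      obtain ⟨rfl, rfl⟩ := h
      simp [successfulRun, survivingMass, Sketch.run, boundedSketch]
    · simp [successfulRun, survivingMass, h]
  | succ i ih =>
    by_cases h0 : successfulRun l k m g ε θ adv (i + 1) (τ, s) = 0
    · rw [h0]; exact zero_le
    have hgood := successful_of_successfulRun hθ h0
    have hcons := consistent_of_successfulRun h0
    set A := boundedSketch U l k T g with hA
    have hval : successfulRun l k m g ε θ adv (i + 1) (τ, s) = ∑' z, successfulRun l k m g ε θ adv i z *
        interactRound (sampleUpdate k g) SampleState.estimate adv z (τ, s) := if_pos hgood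
    have hrun : A.run adv (i + 1) (τ, s.encode) =
        ∑' z, A.run adv i z * interactRound A.step A.estimate adv z (τ, s.encode) := by
      rw [Sketch.run_eq_interact, Sketch.run_eq_interact, interact, PMF.bind_apply]
    rw [hval, hrun]
    have hinj : Function.Injective
        (fun z : Transcript U × SampleState U l => ((z.1, z.2.encode) : Transcript U × Memory U)) :=
      fun z z' h => by
        rw [Prod.mk.injEq] at h
        exact Prod.ext h.1 (SampleState.encode_injective h.2)
    refine le_trans ?_ (ENNReal.tsum_comp_le_tsum_of_injective hinj _)
    refine ENNReal.tsum_le_tsum fun z => ?_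
    by_cases hz : successfulRun l k m g ε θ adv i z = 0
    · rw [hz, zero_mul]; exact zero_le
    refine mul_le_mul' (ih (by omega) z.1 z.2) ?_
    by_cases hKz : interactRound (sampleUpdate k g) SampleState.estimate adv z (τ, s) = 0
    · rw [hKz]; exact zero_le
    obtain ⟨o, ho, s', hs', he⟩ := mem_support_interactRound.1 ((PMF.mem_support_iff _ _).2 hKz)
    rw [Prod.mk.injEq] at he
    obtain ⟨rfl, rfl⟩ := he
    have hzrun : (z.1, z.2.encode) ∈ (A.run adv i).support := by
      rw [PMF.mem_support_iff]
      exact fun h => hz (le_antisymm ((ih (by omega) z.1 z.2).trans_eq h) zero_le)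
    have hfits : s.Fits k T :=
      hgood.fits hcons (Sketch.insertions_append_le hT (by omega) hzrun ho _) hm hl
    simp only [interactRound, PMF.bind_apply]
    refine ENNReal.tsum_le_tsum fun o' => mul_le_mul_right ?_ _
    have hmap : A.step z.2.encode o' =
        (sampleUpdate k g z.2 o').map fun s => (s.clip k T).encode := by
      simp [hA, boundedSketch]
    rw [hmap, PMF.map_comp, PMF.map_apply, PMF.map_apply]
    refine ENNReal.tsum_le_tsum fun s'' => ?_
    split_ifs with h1 h2
    · exact le_rfl
    · rw [Prod.mk.injEq] at h1
      obtain ⟨h1, rfl⟩ := h1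
      refine absurd ?_ h2
      simp only [Function.comp_apply, hfits.clip_eq]
      rw [h1]
      simp [hA, boundedSketch]
    · exact zero_le
    · exact zero_le

open Classical in
/-- The sampling algorithm is successful at all times, up to a failure probability that consists of
the risk of large noise and, for each effective update, of the risk that the sample is not
representative. -/
lemma one_le_tsum_successfulRun_add {E ρ : ℝ≥0∞} (hE : 1 ≤ E) (hg : ShiftBound E g) (hρ : 1 ≤ ρ)
    (hρt : ρ ≠ ∞) (hgρ : ∑' z, g z * ρ ^ z.natAbs ≤ 2) (hε : 0 < ε) (hε1 : ε ≤ 1) (hθε : θ = ε / 16)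
    (hEθ : E ^ (2 * l + 1) ≤ ENNReal.ofReal (Real.exp (θ / 4))) (hmθ : (m : ℝ) ≤ θ * k) (hk : 2 ≤ k)
    (hm : m ≤ T) (hl : l ≤ T) (hTl : T < 2 ^ l) {n : ℕ}
    (hT : ∀ z ∈ ((boundedSketch U l k T g).run adv n).support, z.1.insertions ≤ T) :
    1 ≤ ∑' z, successfulRun l k m g ε θ adv n z +
      ((ρ ^ (m + 1))⁻¹ * (T * (2 ^ (l + 1) * (l + 1))) +
        ENNReal.ofReal (2 * Real.exp (-(θ ^ 2 * k / 4))) * (2 * T)) := by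
  have hθ0 : 0 < θ := by rw [hθε]; positivity
  have hθ1 : θ ≤ 1 := by rw [hθε]; linarith
  set δ' : ℝ≥0∞ := ENNReal.ofReal (2 * Real.exp (-(θ ^ 2 * k / 4))) with hδ'
  have hins : ∀ i < n, ∀ z, successfulRun l k m g ε θ adv i z ≠ 0 → ∀ o ∈ (adv z.1).support, ∀ y : ℝ,
      Transcript.insertions (z.1 ++ [(o, y)]) ≤ T := by
    intro i hi z hz o ho y
    refine Sketch.insertions_append_le hT hi (z := (z.1, z.2.encode)) ?_ ho y
    rw [PMF.mem_support_iff]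
    exact fun h => hz (le_antisymm
      ((successfulRun_le_run hθ0.le hm hl hT hi.le z.1 z.2).trans_eq h) zero_le)
  have hρm : (ρ ^ (m + 1))⁻¹ ≠ ∞ :=
    ENNReal.inv_ne_top.2 (pow_ne_zero _ (zero_lt_one.trans_le hρ).ne')
  have hB : noisePotential ρ m T (SampleState.empty : SampleState U l) +
      δ' * ((Transcript.effectiveBudget T ([] : Transcript U) : ℕ) : ℝ≥0∞) ≤
      (ρ ^ (m + 1))⁻¹ * (T * (2 ^ (l + 1) * (l + 1))) + δ' * (2 * T) := by
    refine add_le_add (noisePotential_empty_le m T hTl) ?_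
    simp [Transcript.effectiveBudget]
  have hBt : (ρ ^ (m + 1))⁻¹ * (T * (2 ^ (l + 1) * (l + 1))) + δ' * (2 * T) ≠ ∞ := by
    refine ENNReal.add_ne_top.2 ⟨ENNReal.mul_ne_top hρm ?_, ENNReal.mul_ne_top ENNReal.ofReal_ne_top ?_⟩
    · exact_mod_cast ENNReal.natCast_ne_top (T * (2 ^ (l + 1) * (l + 1)))
    · exact_mod_cast ENNReal.natCast_ne_top (2 * T)
  refine le_trans (one_le_tsum_survivingMass_add (P := sampleRun l k g adv)
    (G := fun z => Successful ε θ k m z.1 z.2)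
    (pot := fun z => noisePotential ρ m T z.2)
    (pe := fun z => δ' * (Transcript.effectiveBudget T z.1 : ℝ≥0∞))
    (N := fun z => if m < z.2.noiseSize then 1 else 0)
    (S := fun z => if Transcript.Effective T z.1 ∧ ¬ SampleAccurate θ k z.1 z.2 then 1 else 0)
    (ef := fun z => if Transcript.Effective T z.1 then δ' else 0)
    rfl (fun _ => rfl) (ne_top_of_le_ne_top hBt hB) n ?_ ?_ ?_ ?_) (add_le_add le_rfl hB)
  · intro i hi z hz
    rw [tsum_interactRound_mul]
    refine PMF.tsum_mul_le _ fun o ho => ?_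
    have hle := hins i hi z hz o ho 0
    cases o with
    | insert x =>
      refine tsum_insert_mul_noisePotential_le hρ hρt hgρ k m hTl z.2 ?_ x
      rw [(consistent_of_successfulRun hz).clock_eq]
      simpa using hle
    | delete x =>
      rw [sampleUpdate, PMF.tsum_pure_mul]
      have h1 : ¬ m < z.2.noiseSize := not_lt.2 (successful_of_successfulRun hθ0.le hz).noise_le
      have h2 : ¬ m < SampleState.noiseSize
          (⟨z.2.keys.erase x, z.2.noise, z.2.clock, z.2.start, z.2.phase⟩ : SampleState U l) := h1
      simp only [h2, if_false, zero_add]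
      exact le_rfl
  · intro i
    rw [ENNReal.tsum_prod', ENNReal.tsum_prod']
    refine ENNReal.tsum_le_tsum fun τ => ?_
    by_cases hτ : Transcript.Effective T τ
    · simp only [hτ, true_and, if_true]
      rw [ENNReal.tsum_mul_right, mul_comm]
      refine le_trans (le_of_eq (tsum_congr fun s => ?_))
        (tsum_not_sampleAccurate_le hE hg hθ0 hθ1 hEθ adv i τ (hτ.1.trans_lt hTl))
      split_ifs with h1 <;> simp_all
    · simp [hτ]
  · intro z
    refine tsum_interactRound_mul_le fun o => PMF.tsum_mul_le _ fun s _ => ?_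
    have h1 := Transcript.effectiveBudget_append T z.1 o s.estimate
    have h2 : ((if Transcript.Effective T (z.1 ++ [(o, s.estimate)]) then 1 else 0 : ℕ) : ℝ≥0∞) +
        (Transcript.effectiveBudget T (z.1 ++ [(o, s.estimate)]) : ℝ≥0∞) ≤
        (z.1.effectiveBudget T : ℝ≥0∞) := by exact_mod_cast h1
    refine le_trans (le_of_eq ?_) (mul_le_mul_right h2 δ')
    rw [mul_add]
    split_ifs <;> simp
  · intro i hi z hz z' hz' hnot
    obtain ⟨o, ho, s, hs, rfl⟩ := mem_support_interactRound.1 hz'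
    have hle := hins i hi z hz o ho
    have hc := consistent_of_successfulRun hz
    have hgood := successful_of_successfulRun hθ0.le hz
    by_cases hN : m < s.noiseSize
    · simp [hN]
    have hbad : ¬ SampleAccurate θ k (z.1 ++ [(o, s.estimate)]) s := fun hSA => hnot
      (hgood.step hε.le hθε hε1 hmθ hk hTl ((Transcript.insertions_le_append _ _ _).trans (hle 0)) hc hs
        (not_lt.1 hN) hSA)
    have heff : Transcript.Effective T (z.1 ++ [(o, s.estimate)]) := by
      refine ⟨hle _, z.1, o, s.estimate, rfl, ?_⟩
      -- the deletion of an inactive key changes neither the sample nor the active set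
      by_contra hcon
      cases o with
      | insert x => simp [Op.isInsert] at hcon
      | delete x =>
        simp only [Op.isInsert, Op.key, Bool.false_eq_true, false_or] at hcon
        simp only [sampleUpdate, PMF.mem_support_pure_iff] at hs
        subst hs
        refine hbad ?_
        have h1 : z.2.keys.erase x = z.2.keys :=
          Finset.erase_eq_of_notMem fun h => hcon (hc.keys_subset h)
        simpa [SampleAccurate, Op.apply, Finset.erase_eq_of_notMem hcon, h1] using hgood.sample
    simp [heff, hbad]

/-- All estimates are accurate in a successful run, so that the sketch is accurate with at least the
probability of these runs. -/
lemma tsum_successfulRun_le_toOuterMeasure (hε : 0 ≤ ε) (hθ : 0 ≤ θ) (hm : m ≤ T) (hl : l ≤ T) {n : ℕ}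
    (hT : ∀ z ∈ ((boundedSketch U l k T g).run adv n).support, z.1.insertions ≤ T) :
    ∑' z, successfulRun l k m g ε θ adv n z ≤
      ((boundedSketch U l k T g).run adv n).toOuterMeasure
        {z | z.1.PrefixMaxAccurate ε ∧ z.1.OverallMaxAccurate ε} := by
  rw [PMF.toOuterMeasure_apply]
  have hinj : Function.Injective
      (fun z : Transcript U × SampleState U l => ((z.1, z.2.encode) : Transcript U × Memory U)) :=
    fun z z' h => by
      rw [Prod.mk.injEq] at h
      exact Prod.ext h.1 (SampleState.encode_injective h.2)
  refine le_trans ?_ (ENNReal.tsum_comp_le_tsum_of_injective hinj _)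
  refine ENNReal.tsum_le_tsum fun z => ?_
  by_cases hz : successfulRun l k m g ε θ adv n z = 0
  · rw [hz]; exact zero_le
  have h1 := (successful_of_successfulRun hθ hz).accurate
  have h2 : ((z.1, z.2.encode) : Transcript U × Memory U) ∈
      {z : Transcript U × Memory U | z.1.PrefixMaxAccurate ε ∧ z.1.OverallMaxAccurate ε} :=
    ⟨h1, h1.overall hε⟩
  rw [Set.indicator_of_mem h2]
  exact successfulRun_le_run hθ hm hl hT le_rfl z.1 z.2

end Sketch

/-! ### The exact sketch -/

section Exact
variable {U : Type*} [DecidableEq U]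

/-- The sketch that stores all active keys. -/
noncomputable def exactSketch (U : Type*) [DecidableEq U] : Sketch U where
  init := ⟨∅, []⟩
  step M o := PMF.pure ⟨o.apply M.keys, []⟩
  estimate M := M.keys.card
  init_keys := rfl
  step_keys M o M' h := by
    rw [PMF.mem_support_pure_iff] at h
    subst h
    cases o with
    | insert x => exact subset_rfl
    | delete x => exact (Finset.erase_subset _ _).trans (Finset.subset_insert _ _)

lemma exactSketch_run {adv : Adversary U} {n : ℕ} {z : Transcript U × Memory U}
    (h : z ∈ ((exactSketch U).run adv n).support) {ε : ℝ} (hε : 0 ≤ ε) :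
    z.2 = ⟨z.1.current, []⟩ ∧ z.1.PrefixMaxAccurate ε := by
  rw [Sketch.run_eq_interact] at h
  induction n generalizing z with
  | zero =>
    simp only [interact, PMF.mem_support_pure_iff] at h
    subst h
    exact ⟨rfl, fun i hi => by simp at hi⟩
  | succ n ih =>
    rw [interact, PMF.mem_support_bind_iff] at h
    obtain ⟨z0, h0, h1⟩ := h
    obtain ⟨o, -, M, hM, rfl⟩ := mem_support_interactRound.1 h1
    obtain ⟨h2, h3⟩ := ih h0
    have hM : M = ⟨o.apply z0.1.current, []⟩ := by
      simpa [exactSketch, h2] using hM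
    subst hM
    refine ⟨by simp, h3.append o _ ?_⟩
    simp only [exactSketch, sub_self, abs_zero]
    positivity

end Exact

/-! ### The choice of the parameters -/

lemma two_pow_size_le {T : ℕ} (hT : 2 ≤ T) : 2 ^ T.size ≤ 2 * T := by
  have h1 : 0 < T.size := Nat.size_pos.2 (by omega)
  have h2 : 2 ^ (T.size - 1) ≤ T := Nat.lt_size.1 (by omega)
  calc 2 ^ T.size = 2 ^ (T.size - 1 + 1) := by rw [Nat.sub_add_cancel h1]
    _ = 2 * 2 ^ (T.size - 1) := by rw [pow_succ]; ring
    _ ≤ _ := by omega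

lemma size_le_self (T : ℕ) : T.size ≤ T := Nat.size_le.2 Nat.lt_two_pow_self

lemma size_le_log {T : ℕ} (hT : 2 ≤ T) : (T.size : ℝ) ≤ 3 * Real.log T := by
  have h1 : ((2 ^ T.size : ℕ) : ℝ) ≤ (2 * T : ℕ) := Nat.cast_le.2 (two_pow_size_le hT)
  push_cast at h1
  have hT' : (2 : ℝ) ≤ T := by exact_mod_cast hT
  have h2 := Real.log_le_log (by positivity) h1
  rw [Real.log_pow, Real.log_mul (by norm_num) (by positivity)] at h2
  have h3 := Real.log_two_gt_d9
  have h4 := Real.log_le_log (by norm_num) hT'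
  have h5 : (0 : ℝ) ≤ T.size := Nat.cast_nonneg _
  nlinarith

lemma log_le_rpow {T : ℕ} (hT : 2 ≤ T) : Real.log T ≤ 2 * Real.log T ^ (3 / 2 : ℝ) := by
  have hT' : (2 : ℝ) ≤ T := by exact_mod_cast hT
  have h3 := Real.log_two_gt_d9
  have h4 := Real.log_le_log (by norm_num) hT'
  have h5 : Real.log T ^ (3 / 2 : ℝ) = Real.log T * √(Real.log T) := by
    rw [show (3 / 2 : ℝ) = 1 + 1 / 2 by norm_num, Real.rpow_add (by linarith), Real.rpow_one,
      Real.sqrt_eq_rpow]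
  have h6 : 1 / 2 ≤ √(Real.log T) := Real.le_sqrt_of_sq_le (by linarith)
  rw [h5]
  nlinarith

lemma log_two_le_log_div {T : ℕ} (hT : 2 ≤ T) {δ : ℝ} (hδ : 0 < δ) (hδ1 : δ < 1) :
    Real.log 2 ≤ Real.log (T / δ) := by
  have hT' : (2 : ℝ) ≤ T := by exact_mod_cast hT
  refine Real.log_le_log (by norm_num) (hT'.trans ?_)
  rw [le_div_iff₀ hδ]
  nlinarith

/-- The threshold of the sample size that starts a new phase. The number of levels of the dyadic tree
is `T.size`, and the constant is such that the two risks of failure are at most `δ / 2` each. -/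
noncomputable def threshold (T : ℕ) (ε δ : ℝ) : ℕ := ⌈43008 * (T.size * Real.log (T / δ) / ε ^ 2)⌉₊

section Parameters
variable {T : ℕ} {ε δ : ℝ}

lemma one_le_size_mul_log (hT : 2 ≤ T) (hε : 0 < ε) (hε1 : ε < 1) (hδ : 0 < δ) (hδ1 : δ < 1) :
    1 ≤ T.size * Real.log (T / δ) / ε ^ 2 ∧ (T.size : ℝ) ≤ 2 * (T.size * Real.log (T / δ) / ε ^ 2) := by
  have h1 := log_two_le_log_div hT hδ hδ1
  have h2 := Real.log_two_gt_d9
  have h3 : (2 : ℝ) ≤ T.size := by exact_mod_cast Nat.lt_size.2 (by simpa using hT)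
  have h4 : T.size * Real.log (T / δ) ≤ T.size * Real.log (T / δ) / ε ^ 2 := by
    rw [le_div_iff₀ (by positivity)]
    have : ε ^ 2 ≤ 1 := pow_le_one₀ hε.le hε1.le
    exact mul_le_of_le_one_right (mul_nonneg (by linarith) (by linarith)) this
  constructor <;> nlinarith

lemma two_le_threshold (hT : 2 ≤ T) (hε : 0 < ε) (hε1 : ε < 1) (hδ : 0 < δ) (hδ1 : δ < 1) :
    2 ≤ threshold T ε δ := by
  have h1 := (one_le_size_mul_log hT hε hε1 hδ hδ1).1
  have h2 : (2 : ℝ) ≤ threshold T ε δ := le_trans (by linarith) (Nat.le_ceil _)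
  exact_mod_cast h2

/-- The space bound. -/
lemma cells_le (hT : 2 ≤ T) (hε : 0 < ε) (hε1 : ε < 1) (hδ : 0 < δ) (hδ1 : δ < 1) :
    ((2 * threshold T ε δ + (T.size + 4) : ℕ) : ℝ) ≤
      600000 * (1 / ε ^ 2 * Real.log T ^ (3 / 2 : ℝ) * Real.log (T / δ)) := by
  obtain ⟨h1, h2⟩ := one_le_size_mul_log hT hε hε1 hδ hδ1
  have h3 : (threshold T ε δ : ℝ) < 43008 * (T.size * Real.log (T / δ) / ε ^ 2) + 1 :=
    Nat.ceil_lt_add_one (by linarith)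
  have h4 : (T.size : ℝ) ≤ 6 * Real.log T ^ (3 / 2 : ℝ) := by
    have := size_le_log hT
    have := log_le_rpow hT
    linarith
  have h5 : 0 ≤ Real.log (T / δ) := (Real.log_nonneg (by norm_num)).trans (log_two_le_log_div hT hδ hδ1)
  have h6 : T.size * Real.log (T / δ) / ε ^ 2 ≤
      6 * (1 / ε ^ 2 * Real.log T ^ (3 / 2 : ℝ) * Real.log (T / δ)) := by
    calc T.size * Real.log (T / δ) / ε ^ 2
        ≤ 6 * Real.log T ^ (3 / 2 : ℝ) * Real.log (T / δ) / ε ^ 2 := by gcongr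
      _ = _ := by ring
  push_cast
  linarith

lemma exp_neg_le (hT : 2 ≤ T) (hδ : 0 < δ) {y : ℝ} {j : ℕ}
    (hy : j * Real.log (T / δ) ≤ y) : Real.exp (-y) ≤ (δ / T) ^ j := by
  have hT' : (0 : ℝ) < T := by exact_mod_cast (by omega : 0 < T)
  calc Real.exp (-y) ≤ Real.exp (j * -Real.log (T / δ)) := Real.exp_le_exp.2 (by linarith)
    _ = (δ / T) ^ j := by
      rw [Real.exp_nat_mul, Real.exp_neg, Real.exp_log (by positivity), inv_div]

/-- Each of the at most `2 * T` effective updates spoils the sample with small probability. -/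
lemma sampling_failure_le (hT : 2 ≤ T) (hε : 0 < ε) (hε1 : ε < 1) (hδ : 0 < δ) (hδ1 : δ < 1) :
    ENNReal.ofReal (2 * Real.exp (-((ε / 16) ^ 2 * threshold T ε δ / 4))) * (2 * T) ≤
      ENNReal.ofReal (δ / 2) := by
  have hT' : (2 : ℝ) ≤ T := by exact_mod_cast hT
  have hk : 43008 * (T.size * Real.log (T / δ) / ε ^ 2) ≤ threshold T ε δ := Nat.le_ceil _
  have hL := (Real.log_nonneg one_le_two).trans (log_two_le_log_div hT hδ hδ1)
  have hl : (1 : ℝ) ≤ T.size := by exact_mod_cast Nat.size_pos.2 (by omega)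
  -- four factors of `δ / T` pay for the number of updates and for `δ / 2`
  have h1 : ((4 : ℕ) : ℝ) * Real.log (T / δ) ≤ (ε / 16) ^ 2 * threshold T ε δ / 4 := by
    calc ((4 : ℕ) : ℝ) * Real.log (T / δ) ≤ 42 * (T.size * Real.log (T / δ)) := by push_cast; nlinarith
      _ = (ε / 16) ^ 2 * (43008 * (T.size * Real.log (T / δ) / ε ^ 2)) / 4 := by field_simp; ring
      _ ≤ _ := by gcongr
  have h2 := exp_neg_le hT hδ h1
  rw [show (2 * T : ℝ≥0∞) = ENNReal.ofReal (2 * T) by simp [ENNReal.ofReal_mul],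
    ← ENNReal.ofReal_mul (by positivity)]
  refine ENNReal.ofReal_le_ofReal ?_
  calc 2 * Real.exp (-((ε / 16) ^ 2 * threshold T ε δ / 4)) * (2 * T)
      ≤ 2 * (δ / T) ^ 4 * (2 * T) := by gcongr
    _ = δ / 2 * (δ ^ 3 * (8 / T ^ 3)) := by field_simp; norm_num
    _ ≤ δ / 2 * (1 * 1) := by
        have h3 : δ ^ 3 ≤ 1 := pow_le_one₀ hδ.le hδ1.le
        have h4 : 8 / (T : ℝ) ^ 3 ≤ 1 := by
          rw [div_le_one (by positivity)]
          calc (8 : ℝ) = 2 ^ 3 := by norm_num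
            _ ≤ _ := by gcongr
        gcongr
    _ = _ := by ring

/-- The risk of large noise, for the parameter `η = θ / (8 * l + 4)` of the noise, where `θ = ε / 16` and
`l = T.size`. -/
lemma noise_failure_le (hT : 2 ≤ T) (hε : 0 < ε) (hδ : 0 < δ) (hδ1 : δ < 1) {m : ℕ}
    (hm : ε / 16 * threshold T ε δ ≤ m + 1) :
    ENNReal.ofReal (Real.exp (-(ε / 16 / (8 * T.size + 4) / 2))) ^ (m + 1) *
      (T * (2 ^ (T.size + 1) * (T.size + 1))) ≤ ENNReal.ofReal (δ / 2) := by
  have hT' : (2 : ℝ) ≤ T := by exact_mod_cast hT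
  have hk : 43008 * (T.size * Real.log (T / δ) / ε ^ 2) ≤ threshold T ε δ := Nat.le_ceil _
  have hL := (Real.log_nonneg one_le_two).trans (log_two_le_log_div hT hδ hδ1)
  have hl : (1 : ℝ) ≤ T.size := by exact_mod_cast Nat.size_pos.2 (by omega)
  have hlT : (T.size : ℝ) ≤ T := by exact_mod_cast size_le_self T
  have hpow : (2 : ℝ) ^ T.size ≤ 2 * T := by exact_mod_cast two_pow_size_le hT
  -- three factors of `δ / T` pay for the `8 * T ^ 3` of the union bound, four for `δ / 2`
  have h1 : ((7 : ℕ) : ℝ) * Real.log (T / δ) ≤ (m + 1) * (ε / 16 / (8 * T.size + 4) / 2) := by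
    calc ((7 : ℕ) : ℝ) * Real.log (T / δ)
        = ε / 16 * (43008 * (T.size * Real.log (T / δ) / ε ^ 2)) * (ε / 16 / (12 * T.size) / 2) := by
          field_simp; ring
      _ ≤ ε / 16 * threshold T ε δ * (ε / 16 / (8 * T.size + 4) / 2) := by
          gcongr
          linarith
      _ ≤ _ := by gcongr
  have h2 := exp_neg_le hT hδ h1
  rw [← ENNReal.ofReal_pow (Real.exp_pos _).le, ← Real.exp_nat_mul,
    show (T * (2 ^ (T.size + 1) * (T.size + 1)) : ℝ≥0∞) =
      ENNReal.ofReal ((T * (2 ^ (T.size + 1) * (T.size + 1)) : ℕ) : ℝ) by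
        rw [ENNReal.ofReal_natCast]; push_cast; rfl,
    ← ENNReal.ofReal_mul (Real.exp_pos _).le]
  refine ENNReal.ofReal_le_ofReal ?_
  push_cast
  rw [mul_neg]
  calc Real.exp (-((m + 1) * (ε / 16 / (8 * T.size + 4) / 2))) * (T * (2 ^ (T.size + 1) * (T.size + 1)))
      ≤ (δ / T) ^ 7 * (T * (4 * T * (2 * T))) := by
        gcongr
        · rw [pow_succ]; linarith
        · linarith
    _ = δ / 2 * (δ ^ 6 * (16 / T ^ 4)) := by field_simp; norm_num
    _ ≤ δ / 2 * (1 * 1) := by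
        have h3 : δ ^ 6 ≤ 1 := pow_le_one₀ hδ.le hδ1.le
        have h4 : 16 / (T : ℝ) ^ 4 ≤ 1 := by
          rw [div_le_one (by positivity)]
          calc (16 : ℝ) = 2 ^ 4 := by norm_num
            _ ≤ _ := by gcongr
        gcongr
    _ = _ := by ring

/-- For suitable noise, the sketch with bounded memory fails with probability at most `δ`. -/
lemma exists_boundedSketch_accurate (U : Type*) [DecidableEq U] (hT : 2 ≤ T) (hε : 0 < ε) (hε1 : ε < 1)
    (hδ : 0 < δ) (hδ1 : δ < 1) (hk : threshold T ε δ ≤ T) :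
    ∃ g : PMF ℤ, ∀ (n : ℕ) (adv : Adversary U),
      (∀ z ∈ ((boundedSketch U T.size (threshold T ε δ) T g).run adv n).support, z.1.insertions ≤ T) →
      ENNReal.ofReal (1 - δ) ≤ ((boundedSketch U T.size (threshold T ε δ) T g).run adv n).toOuterMeasure
        {z | z.1.PrefixMaxAccurate ε ∧ z.1.OverallMaxAccurate ε} := by
  set l := T.size with hl
  set k := threshold T ε δ with hkdef
  -- the noise law has density proportional to `exp (-η |z|)`, and exponential moments for `ρ = exp (η / 2)`
  set a : ℝ := Real.exp (-(ε / 16 / (8 * l + 4) / 2)) with ha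
  have ha0 : 0 < a := Real.exp_pos _
  have ha1 : a < 1 := by
    rw [← Real.exp_zero]
    exact Real.exp_lt_exp.2 (by rw [neg_lt_zero]; positivity)
  obtain ⟨g, hg1, hg2, hg3⟩ := exists_two_sided_geometric a.toNNReal (Real.toNNReal_pos.2 ha0)
    (Real.toNNReal_lt_one.2 ha1)
  refine ⟨g, fun n adv hins => ?_⟩
  change ∀ z, g z ≤ ((ENNReal.ofReal a)⁻¹) ^ 2 * g (z + 1) at hg1
  change ∀ z, g z ≤ ((ENNReal.ofReal a)⁻¹) ^ 2 * g (z + -1) at hg2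
  change ∑' z, g z * ((ENNReal.ofReal a)⁻¹) ^ z.natAbs ≤ 2 at hg3
  set ρ : ℝ≥0∞ := (ENNReal.ofReal a)⁻¹ with hρ
  have hρ1 : 1 ≤ ρ := ENNReal.one_le_inv.2 (ENNReal.ofReal_le_one.2 ha1.le)
  have hρt : ρ ≠ ∞ := ENNReal.inv_ne_top.2 (ENNReal.ofReal_pos.2 ha0).ne'
  have hEθ : (ρ ^ 2) ^ (2 * l + 1) ≤ ENNReal.ofReal (Real.exp (ε / 16 / 4)) := by
    rw [hρ, ← ENNReal.ofReal_inv_of_pos ha0, ha, ← Real.exp_neg, ← pow_mul,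
      ← ENNReal.ofReal_pow (Real.exp_pos _).le, ← Real.exp_nat_mul]
    refine ENNReal.ofReal_le_ofReal (Real.exp_le_exp.2 (le_of_eq ?_))
    push_cast
    field_simp
    ring
  set m := ⌊ε / 16 * k⌋₊ with hm
  have hmk : (m : ℝ) ≤ ε / 16 * k := Nat.floor_le (by positivity)
  have hmT : m ≤ T := by
    have h1 : (m : ℝ) ≤ k := hmk.trans (mul_le_of_le_one_left (Nat.cast_nonneg _) (by linarith))
    exact (Nat.cast_le.1 h1).trans hk
  have hmain := one_le_tsum_successfulRun_add (adv := adv) (E := ρ ^ 2) (one_le_pow₀ hρ1) ⟨hg1, hg2⟩ hρ1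
    hρt hg3 hε hε1.le rfl hEθ hmk (two_le_threshold hT hε hε1 hδ hδ1) hmT (size_le_self T)
    (Nat.lt_size_self T) hins
  have hfail : (ρ ^ (m + 1))⁻¹ * (T * (2 ^ (l + 1) * (l + 1))) +
      ENNReal.ofReal (2 * Real.exp (-((ε / 16) ^ 2 * k / 4))) * (2 * T) ≤ ENNReal.ofReal δ := by
    have h1 : (ρ ^ (m + 1))⁻¹ = ENNReal.ofReal a ^ (m + 1) := by rw [hρ, ENNReal.inv_pow, inv_inv]
    rw [h1, show δ = δ / 2 + δ / 2 by ring, ENNReal.ofReal_add (by positivity) (by positivity)]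
    exact add_le_add (noise_failure_le hT hε hδ hδ1 (Nat.lt_floor_add_one _).le)
      (sampling_failure_le hT hε hε1 hδ hδ1)
  rw [ENNReal.ofReal_sub _ hδ.le, ENNReal.ofReal_one]
  refine le_trans ?_ (tsum_successfulRun_le_toOuterMeasure (m := m) (θ := ε / 16) hε.le (by positivity) hmT
    (size_le_self T) hins)
  exact tsub_le_iff_right.2 (hmain.trans (add_le_add le_rfl hfail))

end Parameters

theorem mainTheorem1 :
    ∃ C : ℝ, 0 < C ∧
      ∀ (U : Type*) [DecidableEq U] (T : ℕ) (ε δ : ℝ),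
        2 ≤ T → 0 < ε → ε < 1 → 0 < δ → δ < 1 →
        ∃ A : Sketch U,
          ∀ (n : ℕ) (adv : Adversary U),
            (∀ z ∈ (A.run adv n).support, z.1.insertions ≤ T) →
            (∀ z ∈ (A.run adv n).support,
              (z.2.cells : ℝ) ≤
                C * (1 / ε ^ 2 * Real.log T ^ (3 / 2 : ℝ) * Real.log (T / δ)) ∧
              ∀ c ∈ z.2.counters, (counterBits c : ℝ) ≤ C * Real.log T) ∧
            ENNReal.ofReal (1 - δ) ≤
              (A.run adv n).toOuterMeasure
                {z | z.1.PrefixMaxAccurate ε ∧ z.1.OverallMaxAccurate ε} := by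
  refine ⟨600000, by norm_num, fun U _ T ε δ hT hε hε1 hδ hδ1 => ?_⟩
  have hcells := cells_le hT hε hε1 hδ hδ1
  rcases le_or_gt (threshold T ε δ) T with hk | hk
  · obtain ⟨g, hg⟩ := exists_boundedSketch_accurate U hT hε hε1 hδ hδ1 hk
    refine ⟨boundedSketch U T.size (threshold T ε δ) T g, fun n adv hins => ⟨fun z hz => ?_, hg n adv hins⟩⟩
    obtain ⟨s, hs, he⟩ := boundedSketch_fits hz
    rw [he]
    refine ⟨(Nat.cast_le.2 hs.cells_encode_le).trans hcells, fun c hc => ?_⟩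
    have h1 : counterBits c ≤ T.size + 1 :=
      Nat.succ_le_succ (Nat.size_le_size (hs.natAbs_le_of_mem hc))
    have h2 : (counterBits c : ℝ) ≤ T.size + 1 := by exact_mod_cast h1
    have h3 : (1 : ℝ) ≤ T.size := by exact_mod_cast Nat.size_pos.2 (by omega)
    have h4 := size_le_log hT
    linarith
  · -- the threshold exceeds the number of insertions, so all active keys fit into the memory
    refine ⟨exactSketch U, fun n adv hins => ⟨fun z hz => ?_, ?_⟩⟩
    · obtain ⟨h1, -⟩ := exactSketch_run hz hε.le
      rw [h1]
      refine ⟨le_trans (Nat.cast_le.2 ?_) hcells, by simp⟩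
      have h2 := z.1.card_current_le_insertions.trans (hins z hz)
      simp only [Memory.cells, List.length_nil]
      omega
    · rw [(PMF.toOuterMeasure_apply_eq_one_iff _ _).2 fun z hz => ?_]
      · exact ENNReal.ofReal_le_one.2 (by linarith)
      · have h1 := (exactSketch_run hz hε.le).2
        exact ⟨h1, h1.overall hε.le⟩
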